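/- **Theorem.** Let $\varepsilon(\mathbf k)=-2(\cos k_1+\cos k_2)$ for $\mathbf k\in[-\pi,\pi]^3$ (the tight-binding band of the Hubbard model with $t=1$, $t_z=0$, i.e. of the 2D model). Throughout, $\tanh(\cdot/s):=1$ for $s=0$. For $U>0$ let $T_N=T_N(U,0)$ be the unique $T_N>0$ with $$1=\int_{[-\pi,\pi]^3}\frac{U\tanh\big(\frac{\varepsilon(\mathbf k)}{2T_N}\big)}{2\varepsilon(\mathbf k)}\frac{d\mathbf k}{(2\pi)^3},$$ for $0\le T<T_N$ let $\Delta=\Delta_{\mathrm{AF}}(U,0,T)$ be the unique positive solution of $$\Delta=\Delta\int_{[-\pi,\pi]^3}\frac{U\tanh\Big(\frac{\sqrt{\Delta^2+\varepsilon(\mathbf k)^2}}{2T}\Big)}{2\sqrt{\Delta^2+\varepsilon(\mathbf k)^2}}\frac{d\mathbf k}{(2\pi)^3},$$ and let $\hat m(U,0,T)=\Delta_{\mathrm{AF}}(U,0,T)/T_N(U,0)$. For $y\in[0,1]$ let $x=f_{\mathrm{BCS}}(y)$ be the unique $x\ge 0$ for which $$\int_0^\infty\bigg(\frac{\tanh\big(\frac{\sqrt{x^2+\epsilon^2}}{2y}\big)}{\sqrt{x^2+\epsilon^2}}-\frac{\tanh(\frac{\epsilon}{2})}{\epsilon}\bigg)d\epsilon$$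 converges absolutely and equals $0$. These quantities are well defined, $f_{\mathrm{BCS}}$ is differentiable on $[0,1)$ (from the right at $0$), and for $y\in[0,1)$ the integral in $$c_1(y)=\big(f_{\mathrm{BCS}}(y)-y f_{\mathrm{BCS}}'(y)\big)\int_0^\infty\frac{\ln(\frac{16}{\epsilon})}{2\pi}\bigg(\frac{\tanh\Big(\frac{\sqrt{f_{\mathrm{BCS}}(y)^2+\epsilon^2}}{2y}\Big)}{\sqrt{f_{\mathrm{BCS}}(y)^2+\epsilon^2}}-\frac{\tanh(\frac{\epsilon}{2})}{\epsilon}\bigg)d\epsilon$$ converges absolutely. Moreover $$\hat m(U,0,T)=f_{\mathrm{BCS}}\Big(\frac{T}{T_N(U,0)}\Big)+c_1\Big(\frac{T}{T_N(U,0)}\Big)\sqrt U+O(U)\qquad\text{as }U\downarrow0,$$ uniformly for all $T\ge0$ such that $T/T_N(U,0)$ remains in a given compact subset of $[0,1)$. In particular, for $T=0$, $$\hat m(U,0,0)=\pi e^{-\gamma}+c_1(0)\sqrt U+O(U)\qquad\text{as }U\downarrow0,$$ where $\gamma$ is Euler's constant and $$c_1(0)=\pi e^{-\gamma}\int_0^\infty\frac{\ln(\frac{16}{\epsilon})}{2\pi}\bigg(\frac{1}{\sqrt{\pi^2e^{-2\gamma}+\epsilon^2}}-\frac{\tanh(\frac{\epsilon}{2})}{\epsilon}\bigg)d\epsilon\approx0.04576,$$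 meaning $|c_1(0)-0.04576|\le 5\cdot10^{-6}$; so $c_1(0)\neq0$ and the term of order $\sqrt U$ does not vanish. -/

import Mathlib

open MeasureTheory Set Filter Topology Asymptotics

noncomputable section

namespace Hubbard

/-- `tanh (a / s)`, with the convention `tanh (· / s) = 1` for `s = 0`. -/
def tanhDiv (a s : ℝ) : ℝ :=
  if s = 0 then 1 else Real.tanh (a / s)

/-- The cube `[-π, π]³` of quasi-momenta. -/
def cube : Set (Fin 3 → ℝ) :=
  Icc (fun _ => -Real.pi) (fun _ => Real.pi)

/-- The tight-binding band relation with hopping parameters `t = 1` and `t_z`. -/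
def band (tz : ℝ) (k : Fin 3 → ℝ) : ℝ :=
  -2 * (Real.cos (k 0) + Real.cos (k 1)) - 2 * tz * Real.cos (k 2)

/-- `T` solves the equation that characterizes the Néel temperature. -/
def NeelEquation (U tz T : ℝ) : Prop :=
  1 = ∫ k in cube,
    U * Real.tanh (band tz k / (2 * T)) / (2 * band tz k) / (2 * Real.pi) ^ 3

/-- The antiferromagnetic mean-field equation for `Δ` at temperature `T ≥ 0`
(the case `T = 0` is covered by the convention in `tanhDiv`). -/
def MeanFieldEquation (U tz T Δ : ℝ) : Prop :=
  Δ = Δ * ∫ k in cube,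
    U * tanhDiv (Real.sqrt (Δ ^ 2 + band tz k ^ 2) / 2) T
      / (2 * Real.sqrt (Δ ^ 2 + band tz k ^ 2)) / (2 * Real.pi) ^ 3

open Classical in
/-- The Néel temperature `T_N(U, t_z)`: the (unique) positive solution of its equation. -/
def neelTemperature (U tz : ℝ) : ℝ :=
  if h : ∃ T : ℝ, 0 < T ∧ NeelEquation U tz T then h.choose else 0

open Classical in
/-- The antiferromagnetic order parameter `Δ_AF(U, t_z, T)`: the (unique) positive solution of
the mean-field equation if there is one, and the trivial solution `0` otherwise. -/
def orderParameter (U tz T : ℝ) : ℝ :=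
  if h : ∃ Δ : ℝ, 0 < Δ ∧ MeanFieldEquation U tz T Δ then h.choose else 0

/-- The gap ratio `m̂(U, t_z, T) = Δ_AF(U, t_z, T) / T_N(U, t_z)`. -/
def gapRatio (U tz T : ℝ) : ℝ :=
  orderParameter U tz T / neelTemperature U tz

/-- `tanh(√(x² + ε²) / (2y)) / √(x² + ε²) - tanh(ε / 2) / ε`. -/
def bcsIntegrand (x y ε : ℝ) : ℝ :=
  tanhDiv (Real.sqrt (x ^ 2 + ε ^ 2) / 2) y / Real.sqrt (x ^ 2 + ε ^ 2)
    - Real.tanh (ε / 2) / ε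

/-- `x ≥ 0` solves `J(x, y) = 0`, where `J(x, y)` is the integral of `bcsIntegrand x y` over
`(0, ∞)`. Convergence of the integral is required explicitly: at `x = y = 0` it diverges, and the
Bochner integral would have the value `0` there by convention. -/
def IsBCSSolution (x y : ℝ) : Prop :=
  0 ≤ x ∧ IntegrableOn (bcsIntegrand x y) (Ioi 0) ∧ ∫ ε in Ioi (0 : ℝ), bcsIntegrand x y ε = 0

open Classical in
/-- The function `f_BCS` on `[0, 1]`: the (unique) solution of `J(f_BCS(y), y) = 0`. -/
def fBCS (y : ℝ) : ℝ :=
  if h : ∃ x : ℝ, IsBCSSolution x y then h.choose else 0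

/-- The integrand in the definition of `c_1`, with `x` in place of `f_BCS(y)`. -/
def c1Integrand (x y ε : ℝ) : ℝ :=
  Real.log (16 / ε) / (2 * Real.pi) * bcsIntegrand x y ε

/-- The coefficient `c_1(y)`; the derivative of `f_BCS` is that of a function on `[0, 1]`, so it is
one-sided at `0`. -/
def c1 (y : ℝ) : ℝ :=
  (fBCS y - y * derivWithin fBCS (Icc 0 1) y)
    * ∫ ε in Ioi (0 : ℝ), c1Integrand (fBCS y) y ε

/-- The constant `π e^{-γ}`, with `γ` Euler's constant. -/
def gapConst : ℝ :=
  Real.pi * Real.exp (-Real.eulerMascheroniConstant)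

end Hubbard

end

/-!
Both gap equations are integrals over the Brillouin zone of an even function of the band energy, so
they reduce to integrals against the density of states (`integral_even_band`). With `t_z = 0` this is
a complete elliptic integral, `bandDensity`, which has the van Hove singularity
`N(ε) = log (16 / ε) + O(√ε)` at half filling (`abs_bandDensity_sub_log_le`). In terms of
`bandGap x T = ∫ N(ε) tanh (√(x² + ε²) / 2T) / √(x² + ε²) dε`, the Néel temperature `τ` and the order
parameter `Δ` satisfy `bandGap 0 τ = bandGap Δ T = 2π² / U`. The integrand is strictly decreasing in
the order parameter and in the temperature, which gives existence and uniqueness, and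
`bandGap 0 τ = (log τ)² / 2 + O(log τ)`, so that `L = - log τ` satisfies `1 / L = √U / 2π + O(U)`
(`exists_neelTemperature_asymptotics`).

Subtract the two equations and measure energies in units of `τ`, with `Δ = x τ` and `T = y τ`. What
is left is the BCS integrand `B` integrated against `N(τ u) = L + log (16 / u) + O(√(τ u))`, i.e.
`0 = L J(x, y) + J₁(x, y) + O(√τ)`, where `J = ∫ B` is `bcsIntegral` and `J₁ = ∫ log (16 / u) B` is
`bcsLogIntegral`. Dividing by `L` shows that to leading order `J(x, y) = 0`, hence `x = f_BCS(y)`, and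
that the next term is `- (J₁ / ∂ₓJ) √U / 2π`. Frullani's integral gives the scaling relation
`J(x, y) = J(x / y, 1) - log y` (`bcsIntegral_eq_sub_log`), whence
`f_BCS - y f_BCS' = - 1 / ∂ₓJ` (`sub_mul_derivWithin_mul_bcsSlope`), and the coefficient is `c1`. The
rigorous version evaluates the difference of the gap equations at `f_BCS + c1 √U ± C U`
(`exists_abs_bandGap_sub_div_sub_le`); since `∂ₓJ` is bounded away from zero, monotonicity in the
order parameter encloses the solution between these two values, uniformly in `y`.

At zero temperature `J(x, 0) = log (π e^{-γ} / x)`, by a Frullani integral and Wallis' product. For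
the numerical value of `c1 0` the dilogarithm and Euler's reflection formula reduce the integral to
`∫ (log ε)² / (2 cosh² (ε / 2)) dε` (`c1_zero_eq_sub`). On `[0, 1]`, with `q = e^{-ε}`, the density
`2 q / (1 + q)²` is approximated by a polynomial of degree `10` whose error is governed by a Chebyshev
polynomial; every power of `q` contributes an explicit combination of `γ`, `π²` and `log n`.
-/


noncomputable section

namespace Hubbard

open scoped ENNReal

/-! ### The hyperbolic tangent -/

theorem hasDerivAt_tanh (x : ℝ) : HasDerivAt Real.tanh (1 / Real.cosh x ^ 2) x := by
  have h := (Real.hasDerivAt_sinh x).div (Real.hasDerivAt_cosh x) (Real.cosh_pos x).ne'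
  have e : (fun y => Real.sinh y / Real.cosh y) = Real.tanh := by
    funext y; exact (Real.tanh_eq_sinh_div_cosh y).symm
  have e' : (Real.sinh / Real.cosh) = Real.tanh := e
  rw [e'] at h
  refine h.congr_deriv ?_
  rw [← Real.cosh_sq_sub_sinh_sq x]; ring

theorem continuous_tanh : Continuous Real.tanh :=
  continuous_iff_continuousAt.2 fun x => (hasDerivAt_tanh x).continuousAt

theorem strictMono_tanh : StrictMono Real.tanh := by
  apply strictMono_of_deriv_pos
  intro x
  rw [(hasDerivAt_tanh x).deriv]
  have := Real.cosh_pos x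
  positivity

theorem tanh_pos {x : ℝ} (hx : 0 < x) : 0 < Real.tanh x := by
  simpa using strictMono_tanh hx

theorem tanh_nonneg {x : ℝ} (hx : 0 ≤ x) : 0 ≤ Real.tanh x := by
  simpa using strictMono_tanh.monotone hx

/-- The function `tanh z - z / cosh² z`; up to the factor `-z⁻²` it is the derivative of
`tanh z / z`. -/
def tanhSlope (z : ℝ) : ℝ := Real.tanh z - z / Real.cosh z ^ 2

theorem hasDerivAt_tanhSlope (z : ℝ) :
    HasDerivAt tanhSlope (2 * z * Real.tanh z / Real.cosh z ^ 2) z := by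
  have hc := (Real.cosh_pos z).ne'
  have h := (hasDerivAt_tanh z).sub ((hasDerivAt_id z).div ((Real.hasDerivAt_cosh z).pow 2)
    (pow_ne_zero 2 hc))
  refine h.congr_deriv ?_
  simp only [id, Real.tanh_eq_sinh_div_cosh, Pi.pow_apply]
  field_simp
  ring

theorem continuous_tanhSlope : Continuous tanhSlope :=
  continuous_iff_continuousAt.2 fun x => (hasDerivAt_tanhSlope x).continuousAt

theorem strictMonoOn_tanhSlope : StrictMonoOn tanhSlope (Ici 0) := by
  apply strictMonoOn_of_deriv_pos (convex_Ici 0) continuous_tanhSlope.continuousOn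
  intro z hz
  rw [interior_Ici, mem_Ioi] at hz
  rw [(hasDerivAt_tanhSlope z).deriv]
  have := tanh_pos hz
  have := Real.cosh_pos z
  positivity

theorem tanhSlope_pos {z : ℝ} (hz : 0 < z) : 0 < tanhSlope z := by
  have := strictMonoOn_tanhSlope (mem_Ici.2 le_rfl) (mem_Ici.2 hz.le) hz
  simpa [tanhSlope] using this

theorem tanhSlope_le_one {z : ℝ} (hz : 0 ≤ z) : tanhSlope z ≤ 1 := by
  have := (Real.tanh_lt_one z).le
  have : 0 ≤ z / Real.cosh z ^ 2 := by positivity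
  unfold tanhSlope; linarith

theorem self_le_cosh (z : ℝ) : z ≤ Real.cosh z := by
  have h1 := Real.add_one_le_exp z
  have h2 := Real.quadratic_le_exp_of_nonneg (x := |z|) (abs_nonneg z)
  have h3 := Real.exp_pos (-|z|)
  rw [← Real.cosh_abs, Real.cosh_eq]
  have := le_abs_self z
  nlinarith [sq_nonneg (|z| - 1), sq_abs z]

theorem tanh_le_self {z : ℝ} (hz : 0 ≤ z) : Real.tanh z ≤ z := by
  have h : MonotoneOn (fun z => z - Real.tanh z) (Ici 0) := by
    apply monotoneOn_of_deriv_nonneg (convex_Ici 0)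
    · exact (continuous_id.sub continuous_tanh).continuousOn
    · intro x _
      exact ((hasDerivAt_id x).sub (hasDerivAt_tanh x)).differentiableAt.differentiableWithinAt
    · intro x _
      have := ((hasDerivAt_id x).sub (hasDerivAt_tanh x)).deriv
      have e : deriv (fun z => z - Real.tanh z) x = 1 - 1 / Real.cosh x ^ 2 := this
      rw [e]
      have := Real.one_le_cosh x
      have : 1 / Real.cosh x ^ 2 ≤ 1 := by
        rw [div_le_one (by positivity)]; nlinarith
      linarith
  have := h (mem_Ici.2 le_rfl) (mem_Ici.2 hz) hz
  simp at this
  linarith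

theorem one_sub_tanh_eq (z : ℝ) : 1 - Real.tanh z = 2 / (Real.exp (2 * z) + 1) := by
  rw [Real.tanh_eq_sinh_div_cosh, Real.sinh_eq, Real.cosh_eq]
  have h1 := Real.exp_pos z
  have h2 := Real.exp_pos (-z)
  have e : Real.exp (2 * z) = Real.exp z * Real.exp z := by rw [← Real.exp_add]; ring_nf
  have e2 : Real.exp z * Real.exp (-z) = 1 := by rw [← Real.exp_add]; simp
  rw [e]
  have : Real.exp z + Real.exp (-z) ≠ 0 := by positivity
  have : Real.exp z * Real.exp z + 1 ≠ 0 := by positivity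
  field_simp
  linear_combination 2 * Real.exp z * e2

theorem one_sub_tanh_le {z : ℝ} (hz : 0 < z) : 1 - Real.tanh z ≤ 1 / z ^ 2 := by
  rw [one_sub_tanh_eq, div_le_div_iff₀ (by positivity) (by positivity)]
  have := Real.quadratic_le_exp_of_nonneg (x := 2 * z) (by positivity)
  nlinarith

/-! ### The gap kernel -/

/-- The kernel `tanh (E / 2T) / E` of the gap equations, as a function of the temperature `T` and
of the quasi-particle energy `E`. -/
def gapKernel (T E : ℝ) : ℝ := tanhDiv (E / 2) T / E

/-- The quantity `q` with `∂_E (gapKernel T E) = - q / E²`. -/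
def gapSlope (T E : ℝ) : ℝ := if T = 0 then 1 else tanhSlope (E / (2 * T))

theorem tanhDiv_half {T : ℝ} (hT : T ≠ 0) (E : ℝ) :
    tanhDiv (E / 2) T = Real.tanh (E / (2 * T)) := by
  rw [tanhDiv, if_neg hT, div_div]

theorem gapKernel_of_ne {T : ℝ} (hT : T ≠ 0) (E : ℝ) :
    gapKernel T E = Real.tanh (E / (2 * T)) / E := by
  rw [gapKernel, tanhDiv_half hT]

theorem gapKernel_zero_left (E : ℝ) : gapKernel 0 E = 1 / E := by
  simp [gapKernel, tanhDiv]

theorem gapSlope_pos {T E : ℝ} (hT : 0 ≤ T) (hE : 0 < E) : 0 < gapSlope T E := by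
  unfold gapSlope
  split_ifs with h
  · exact one_pos
  · have : 0 < T := lt_of_le_of_ne hT (Ne.symm h)
    exact tanhSlope_pos (by positivity)

theorem gapSlope_le_one {T E : ℝ} (hT : 0 ≤ T) (hE : 0 ≤ E) : gapSlope T E ≤ 1 := by
  unfold gapSlope
  split_ifs with h
  · exact le_rfl
  · exact tanhSlope_le_one (by positivity)

theorem le_gapSlope {T E : ℝ} (hT : 0 ≤ T) (hT1 : T ≤ 1) {a : ℝ} (ha : 0 ≤ a) (haE : a ≤ E) :
    tanhSlope (a / 2) ≤ gapSlope T E := by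
  unfold gapSlope
  split_ifs with h
  · exact tanhSlope_le_one (by positivity)
  · have : 0 < T := lt_of_le_of_ne hT (Ne.symm h)
    apply strictMonoOn_tanhSlope.monotoneOn (mem_Ici.2 (by positivity))
      (mem_Ici.2 (div_nonneg (ha.trans haE) (by positivity)))
    apply div_le_div₀ (ha.trans haE) haE (by positivity)
    linarith

theorem hasDerivAt_gapKernel {T E : ℝ} (hT : 0 ≤ T) (hE : 0 < E) :
    HasDerivAt (gapKernel T) (-gapSlope T E / E ^ 2) E := by
  rcases eq_or_ne T 0 with rfl | h
  · have e : gapKernel 0 = fun E => E⁻¹ := by funext E; simp [gapKernel_zero_left]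
    rw [e]
    exact (hasDerivAt_inv hE.ne').congr_deriv (by simp [gapSlope, neg_div])
  · have e : gapKernel T = fun E => Real.tanh (E / (2 * T)) / E := by
      funext E; exact gapKernel_of_ne h E
    have hT' : 0 < T := lt_of_le_of_ne hT (Ne.symm h)
    rw [e]
    have h1 : HasDerivAt (fun E => Real.tanh (E / (2 * T)))
        (1 / Real.cosh (E / (2 * T)) ^ 2 * (1 / (2 * T))) E :=
      (hasDerivAt_tanh _).comp E ((hasDerivAt_id E).div_const (2 * T))
    refine (h1.div (hasDerivAt_id E) hE.ne').congr_deriv ?_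
    simp only [gapSlope, if_neg h, tanhSlope, id]
    have := Real.cosh_pos (E / (2 * T))
    field_simp
    ring

theorem hasDerivAt_gapSlope {T E : ℝ} (hT : 0 ≤ T) (hE : 0 < E) :
    ∃ d, HasDerivAt (gapSlope T) d E ∧ |d| ≤ 2 / E := by
  rcases eq_or_ne T 0 with rfl | h
  · refine ⟨0, ?_, by simpa using by positivity⟩
    have e : gapSlope 0 = fun _ => 1 := by funext E; simp [gapSlope]
    rw [e]; exact hasDerivAt_const _ _
  · have hT' : 0 < T := lt_of_le_of_ne hT (Ne.symm h)
    have e : gapSlope T = fun E => tanhSlope (E / (2 * T)) := by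
      funext E; simp [gapSlope, h]
    set z := E / (2 * T) with hz
    refine ⟨2 * z * Real.tanh z / Real.cosh z ^ 2 * (1 / (2 * T)), ?_, ?_⟩
    · rw [e]
      exact (hasDerivAt_tanhSlope _).comp E ((hasDerivAt_id E).div_const (2 * T))
    · have hzpos : 0 < z := by positivity
      have h1 : 1 / (2 * T) = z / E := by rw [hz]; field_simp
      have h2 := (tanh_pos hzpos).le
      have h3 := (Real.tanh_lt_one z).le
      have h4 := self_le_cosh z
      have h5 := Real.cosh_pos z
      rw [h1, abs_of_nonneg (by positivity)]
      have : 2 * z * Real.tanh z / Real.cosh z ^ 2 * (z / E)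
          = (2 / E) * (Real.tanh z * (z / Real.cosh z) ^ 2) := by field_simp
      rw [this]
      have h6 : (z / Real.cosh z) ^ 2 ≤ 1 := by
        rw [sq_le_one_iff₀ (by positivity)]; exact (div_le_one h5).2 h4
      calc _ ≤ 2 / E * (1 * 1) := by gcongr
        _ = _ := by ring

theorem strictAntiOn_gapKernel {T : ℝ} (hT : 0 ≤ T) : StrictAntiOn (gapKernel T) (Ioi 0) := by
  apply strictAntiOn_of_deriv_neg (convex_Ioi 0)
  · exact fun E hE => (hasDerivAt_gapKernel hT hE).continuousAt.continuousWithinAt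
  · intro E hE
    rw [interior_Ioi] at hE
    rw [(hasDerivAt_gapKernel hT hE).deriv]
    have := gapSlope_pos hT hE
    have hE' : 0 < E := hE
    have : 0 < gapSlope T E / E ^ 2 := by positivity
    rw [neg_div]; linarith

theorem tanhDiv_nonneg {T a : ℝ} (hT : 0 ≤ T) (ha : 0 ≤ a) : 0 ≤ tanhDiv a T := by
  unfold tanhDiv
  split_ifs
  · exact zero_le_one
  · exact tanh_nonneg (by positivity)

theorem tanhDiv_le_one (a T : ℝ) : tanhDiv a T ≤ 1 := by
  unfold tanhDiv
  split_ifs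
  · exact le_rfl
  · exact (Real.tanh_lt_one _).le

theorem gapKernel_nonneg {T E : ℝ} (hT : 0 ≤ T) (hE : 0 ≤ E) : 0 ≤ gapKernel T E :=
  div_nonneg (tanhDiv_nonneg hT (by positivity)) hE

theorem gapKernel_le_inv {T E : ℝ} (hE : 0 ≤ E) : gapKernel T E ≤ 1 / E :=
  div_le_div_of_nonneg_right (tanhDiv_le_one _ _) hE

theorem gapKernel_le {T E : ℝ} (hT : 0 < T) (hE : 0 ≤ E) : gapKernel T E ≤ 1 / (2 * T) := by
  rw [gapKernel_of_ne hT.ne']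
  rcases hE.eq_or_lt with rfl | h
  · simp; positivity
  · rw [div_le_iff₀ h]
    exact (tanh_le_self (by positivity)).trans (le_of_eq (by ring))

theorem one_div_sub_gapKernel_le {T E : ℝ} (hT : 0 ≤ T) (hE : 0 < E) :
    1 / E - gapKernel T E ≤ 4 * T ^ 2 / E ^ 3 := by
  rcases hT.eq_or_lt with rfl | h
  · simp [gapKernel_zero_left]
  · rw [gapKernel_of_ne h.ne', ← sub_div, div_le_div_iff₀ hE (by positivity)]
    have := one_sub_tanh_le (z := E / (2 * T)) (by positivity)
    calc (1 - Real.tanh (E / (2 * T))) * E ^ 3 ≤ 1 / (E / (2 * T)) ^ 2 * E ^ 3 := by gcongr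
      _ = _ := by field_simp; ring

theorem measurable_gapKernel (T : ℝ) : Measurable (gapKernel T) := by
  rcases eq_or_ne T 0 with rfl | h
  · have e : gapKernel 0 = fun E => 1 / E := by funext E; simp [gapKernel_zero_left]
    rw [e]; fun_prop
  · have e : gapKernel T = fun E => Real.tanh (E / (2 * T)) / E := by
      funext E; exact gapKernel_of_ne h E
    rw [e]
    exact (continuous_tanh.measurable.comp (by fun_prop)).div measurable_id

/-! ### The kernel as a function of the order parameter -/

/-- The derivative of `x ↦ gapKernel T √(x² + ε²)`. -/
def gapKernelDeriv (T x ε : ℝ) : ℝ :=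
  -(x * gapSlope T (Real.sqrt (x ^ 2 + ε ^ 2))) / Real.sqrt (x ^ 2 + ε ^ 2) ^ 3

theorem sqrt_pos_of_pos_right (x : ℝ) {ε : ℝ} (hε : 0 < ε) : 0 < Real.sqrt (x ^ 2 + ε ^ 2) :=
  Real.sqrt_pos.2 (by positivity)

theorem hasDerivAt_sqrt_add_sq (x : ℝ) {ε : ℝ} (hε : 0 < ε) :
    HasDerivAt (fun x => Real.sqrt (x ^ 2 + ε ^ 2)) (x / Real.sqrt (x ^ 2 + ε ^ 2)) x := by
  have h : HasDerivAt (fun x : ℝ => x ^ 2 + ε ^ 2) (2 * x) x := by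
    simpa using (hasDerivAt_pow 2 x).add_const (ε ^ 2)
  refine (h.sqrt (by positivity)).congr_deriv ?_
  have := sqrt_pos_of_pos_right x hε
  field_simp

theorem hasDerivAt_gapKernel_sqrt {T : ℝ} (hT : 0 ≤ T) (x : ℝ) {ε : ℝ} (hε : 0 < ε) :
    HasDerivAt (fun x => gapKernel T (Real.sqrt (x ^ 2 + ε ^ 2))) (gapKernelDeriv T x ε) x := by
  have hE := sqrt_pos_of_pos_right x hε
  have := (hasDerivAt_gapKernel hT hE).comp x (hasDerivAt_sqrt_add_sq x hε)
  refine this.congr_deriv ?_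
  unfold gapKernelDeriv
  field_simp

theorem abs_gapKernelDeriv_le {T : ℝ} (hT : 0 ≤ T) (x : ℝ) {ε : ℝ} (hε : 0 < ε) :
    |gapKernelDeriv T x ε| ≤ |x| / Real.sqrt (x ^ 2 + ε ^ 2) ^ 3 := by
  have hE := sqrt_pos_of_pos_right x hε
  have h1 := gapSlope_pos hT hE
  have h2 := gapSlope_le_one hT hE.le
  unfold gapKernelDeriv
  rw [abs_div, abs_neg, abs_mul, abs_of_pos h1, abs_of_pos (pow_pos hE 3)]
  gcongr
  calc _ ≤ |x| * 1 := by gcongr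
    _ = _ := mul_one _

theorem hasDerivAt_gapKernelDeriv {T : ℝ} (hT : 0 ≤ T) (x : ℝ) {ε : ℝ} (hε : 0 < ε) :
    ∃ d, HasDerivAt (fun x => gapKernelDeriv T x ε) d x ∧
      |d| ≤ 6 / Real.sqrt (x ^ 2 + ε ^ 2) ^ 3 := by
  have hE := sqrt_pos_of_pos_right x hε
  obtain ⟨q', hq', hq'b⟩ := hasDerivAt_gapSlope hT hE
  have hs := hasDerivAt_sqrt_add_sq x hε
  have h := (((hasDerivAt_id x).mul (hq'.comp x hs)).neg).div (hs.pow 3) (pow_pos hE 3).ne'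
  refine ⟨_, h, ?_⟩
  have h1 := gapSlope_pos hT hE
  have h2 := gapSlope_le_one hT hE.le
  simp only [Function.comp, id, one_mul]
  set E := Real.sqrt (x ^ 2 + ε ^ 2) with hEdef
  set q := gapSlope T E
  have hx : x ^ 2 ≤ E ^ 2 := by
    rw [hEdef, Real.sq_sqrt (by positivity)]; nlinarith [sq_nonneg ε]
  have e : (-(q + x * (q' * (x / E))) * E ^ 3
        - (-(fun x => x * (gapSlope T (Real.sqrt (x ^ 2 + ε ^ 2)))) x) * (3 * E ^ 2 * (x / E))) / (E ^ 3) ^ 2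
      = (-q - q' * E * (x ^ 2 / E ^ 2) + 3 * q * (x ^ 2 / E ^ 2)) / E ^ 3 := by
    simp only [← hEdef]
    field_simp
    ring
  have hr : x ^ 2 / E ^ 2 ≤ 1 := (div_le_one (by positivity)).2 hx
  have hr0 : 0 ≤ x ^ 2 / E ^ 2 := by positivity
  have key : |(-q - q' * E * (x ^ 2 / E ^ 2) + 3 * q * (x ^ 2 / E ^ 2)) / E ^ 3| ≤ 6 / E ^ 3 := by
    rw [abs_div, abs_of_pos (pow_pos hE 3)]
    gcongr
    have h3 : |q' * E| ≤ 2 := by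
      rw [abs_mul, abs_of_pos hE]
      calc _ ≤ 2 / E * E := by gcongr
        _ = 2 := by field_simp
    rw [abs_le] at h3 ⊢
    set r := x ^ 2 / E ^ 2
    constructor <;> nlinarith
  refine le_trans (le_of_eq ?_) key
  rw [← e]
  simp [← hEdef, q]

/-- Second-order Taylor estimate for the kernel, uniform in the temperature. -/
theorem abs_gapKernel_taylor_le {T : ℝ} (hT : 0 ≤ T) {a x₀ x ε : ℝ} (ha : 0 ≤ a) (hx₀ : a ≤ x₀)
    (hx : a ≤ x) (hε : 0 < ε) :
    |gapKernel T (Real.sqrt (x ^ 2 + ε ^ 2)) - gapKernel T (Real.sqrt (x₀ ^ 2 + ε ^ 2))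
      - gapKernelDeriv T x₀ ε * (x - x₀)|
      ≤ 6 * (x - x₀) ^ 2 / Real.sqrt (a ^ 2 + ε ^ 2) ^ 3 := by
  have hE := sqrt_pos_of_pos_right a hε
  set C := 6 / Real.sqrt (a ^ 2 + ε ^ 2) ^ 3 with hC
  have hC0 : 0 ≤ C := by positivity
  have lip : ∀ s ∈ Ici a, ∀ t ∈ Ici a,
      ‖gapKernelDeriv T t ε - gapKernelDeriv T s ε‖ ≤ C * ‖t - s‖ := by
    intro s hs t ht
    choose d hd hdb using fun x => hasDerivAt_gapKernelDeriv hT x hε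
    apply Convex.norm_image_sub_le_of_norm_hasDerivWithin_le (f' := d)
      (fun x _ => (hd x).hasDerivWithinAt) _ (convex_Ici a) hs ht
    intro x hx
    have hx' : a ≤ x := hx
    refine (hdb x).trans ?_
    rw [hC]
    gcongr
  -- the derivative of the remainder is at most `C * |x - x₀|` on the segment
  have hsub : uIcc x₀ x ⊆ Ici a := by
    intro t ht
    exact le_trans (le_inf hx₀ hx) ht.1
  have h := Convex.norm_image_sub_le_of_norm_hasDerivWithin_le
    (f := fun t => gapKernel T (Real.sqrt (t ^ 2 + ε ^ 2)) - gapKernelDeriv T x₀ ε * t)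
    (f' := fun t => gapKernelDeriv T t ε - gapKernelDeriv T x₀ ε) (s := uIcc x₀ x)
    (C := C * |x - x₀|) (x := x₀) (y := x)
    (fun t _ => by
      have h2 : HasDerivAt (fun t => gapKernelDeriv T x₀ ε * t) (gapKernelDeriv T x₀ ε) t := by
        simpa using (hasDerivAt_id t).const_mul (gapKernelDeriv T x₀ ε)
      exact ((hasDerivAt_gapKernel_sqrt hT t hε).sub h2).hasDerivWithinAt)
    (fun t ht => by
      refine (lip x₀ hx₀ t (hsub ht)).trans ?_
      gcongr
      exact abs_sub_left_of_mem_uIcc ht)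
    (convex_uIcc _ _) left_mem_uIcc right_mem_uIcc
  rw [Real.norm_eq_abs, Real.norm_eq_abs] at h
  calc _ = |gapKernel T (Real.sqrt (x ^ 2 + ε ^ 2)) - gapKernelDeriv T x₀ ε * x
      - (gapKernel T (Real.sqrt (x₀ ^ 2 + ε ^ 2)) - gapKernelDeriv T x₀ ε * x₀)| := by
        congr 1; ring
    _ ≤ _ := h
    _ = _ := by rw [mul_assoc, abs_mul_abs_self, hC]; ring

/-! ### Integrable majorants on the half-line -/

/-- The majorant `min(1, ε⁻³)` of the integrands below. -/
def decay (ε : ℝ) : ℝ := min 1 (1 / ε ^ 3)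

/-- `decay` times a weight that dominates `√ε` and, up to constants, `1`, `|log ε|` and
`(log ε)²`. -/
def decayWeight (ε : ℝ) : ℝ := (1 / Real.sqrt ε + Real.sqrt ε) * decay ε

theorem decay_nonneg {ε : ℝ} (hε : 0 < ε) : 0 ≤ decay ε := by
  unfold decay; positivity

theorem one_le_weight {ε : ℝ} (hε : 0 < ε) : 1 ≤ 1 / Real.sqrt ε + Real.sqrt ε := by
  have h := Real.sqrt_pos.2 hε
  rcases le_total 1 (Real.sqrt ε) with h1 | h1
  · have : 0 < 1 / Real.sqrt ε := by positivity
    linarith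
  · have : 1 ≤ 1 / Real.sqrt ε := by rw [le_div_iff₀ h]; linarith
    linarith

theorem abs_log_le_weight {ε : ℝ} (hε : 0 < ε) :
    |Real.log ε| ≤ 2 * (1 / Real.sqrt ε + Real.sqrt ε) := by
  have key : ∀ t : ℝ, 0 < t → Real.log t ≤ 2 * Real.sqrt t := by
    intro t ht
    have := Real.log_le_sub_one_of_pos (Real.sqrt_pos.2 ht)
    rw [Real.log_sqrt ht.le] at this
    linarith
  have h := Real.sqrt_pos.2 hε
  have h1 := key ε hε
  have h2 := key ε⁻¹ (inv_pos.2 hε)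
  rw [Real.log_inv, Real.sqrt_inv, ← one_div] at h2
  have : 0 < 1 / Real.sqrt ε := by positivity
  rw [abs_le]; constructor <;> linarith

theorem abs_log_sixteen_div_le {ε : ℝ} (hε : 0 < ε) :
    |Real.log (16 / ε)| ≤ 18 * (1 / Real.sqrt ε + Real.sqrt ε) := by
  rw [Real.log_div (by norm_num) hε.ne']
  have h1 := abs_log_le_weight hε
  have h2 := one_le_weight hε
  have h3 : Real.log 16 ≤ 15 := by
    have := Real.log_le_sub_one_of_pos (x := 16) (by norm_num); linarith
  have h4 : 0 ≤ Real.log 16 := Real.log_nonneg (by norm_num)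
  rw [abs_le] at h1 ⊢
  constructor <;> linarith

theorem measurable_decay : Measurable decay := by unfold decay; fun_prop

theorem measurable_decayWeight : Measurable decayWeight := by
  unfold decayWeight; exact Measurable.mul (by fun_prop) measurable_decay

theorem integrableOn_decayWeight : IntegrableOn decayWeight (Ioi 0) := by
  rw [← Ioc_union_Ioi_eq_Ioi (zero_le_one (α := ℝ))]
  apply IntegrableOn.union
  · have h : IntegrableOn (fun ε : ℝ => 2 * ε ^ (-1 / 2 : ℝ)) (Ioc 0 1) := by
      apply Integrable.const_mul
      have := intervalIntegral.intervalIntegrable_rpow' (a := 0) (b := 1) (r := -1 / 2)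
        (by norm_num)
      exact (intervalIntegrable_iff_integrableOn_Ioc_of_le zero_le_one).1 this
    refine h.mono' measurable_decayWeight.aestronglyMeasurable ?_
    filter_upwards [ae_restrict_mem measurableSet_Ioc] with ε hε
    have h0 : 0 < ε := hε.1
    have hs := Real.sqrt_pos.2 h0
    have hs1 : Real.sqrt ε ≤ 1 := Real.sqrt_le_one.2 hε.2
    have e : ε ^ (-1 / 2 : ℝ) = 1 / Real.sqrt ε := by
      rw [Real.sqrt_eq_rpow, one_div (ε ^ (1 / 2 : ℝ)), ← Real.rpow_neg h0.le]
      norm_num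
    have hw := one_le_weight h0
    have hd := decay_nonneg h0
    rw [e, Real.norm_of_nonneg (by unfold decayWeight; positivity)]
    unfold decayWeight
    have h1 : decay ε ≤ 1 := min_le_left _ _
    have h2 : Real.sqrt ε ≤ 1 / Real.sqrt ε := by rw [le_div_iff₀ hs]; nlinarith
    calc _ ≤ (1 / Real.sqrt ε + 1 / Real.sqrt ε) * 1 := by gcongr
      _ = _ := by ring
  · have h : IntegrableOn (fun ε : ℝ => 2 * ε ^ (-5 / 2 : ℝ)) (Ioi 1) :=
      Integrable.const_mul (integrableOn_Ioi_rpow_of_lt (by norm_num) one_pos) 2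
    refine h.mono' measurable_decayWeight.aestronglyMeasurable ?_
    filter_upwards [ae_restrict_mem measurableSet_Ioi] with ε hε
    have h1 : 1 < ε := hε
    have h0 : 0 < ε := one_pos.trans h1
    have hs := Real.sqrt_pos.2 h0
    have hs1 : 1 ≤ Real.sqrt ε := Real.one_le_sqrt.2 h1.le
    have e : ε ^ (-5 / 2 : ℝ) = Real.sqrt ε * (1 / ε ^ 3) := by
      rw [Real.sqrt_eq_rpow, one_div (ε ^ 3), ← Real.rpow_natCast ε 3, ← Real.rpow_neg h0.le,
        ← Real.rpow_add h0]
      norm_num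
    have hw := one_le_weight h0
    have hd := decay_nonneg h0
    rw [e, Real.norm_of_nonneg (by unfold decayWeight; positivity)]
    unfold decayWeight
    have h3 : decay ε ≤ 1 / ε ^ 3 := min_le_right _ _
    have h2 : 1 / Real.sqrt ε ≤ Real.sqrt ε := by rw [div_le_iff₀ hs]; nlinarith
    calc _ ≤ (Real.sqrt ε + Real.sqrt ε) * (1 / ε ^ 3) := by gcongr
      _ = _ := by ring

theorem decay_le_decayWeight {ε : ℝ} (hε : 0 < ε) : decay ε ≤ decayWeight ε := by
  have := decay_nonneg hε
  have := one_le_weight hε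
  unfold decayWeight; nlinarith

theorem integrableOn_decay : IntegrableOn decay (Ioi 0) := by
  refine integrableOn_decayWeight.mono' measurable_decay.aestronglyMeasurable ?_
  filter_upwards [ae_restrict_mem measurableSet_Ioi] with ε hε
  rw [Real.norm_of_nonneg (decay_nonneg hε)]
  exact decay_le_decayWeight hε

theorem integrableOn_of_abs_le_decay {f : ℝ → ℝ} (hf : Measurable f) {C : ℝ}
    (h : ∀ ε, 0 < ε → |f ε| ≤ C * decay ε) : IntegrableOn f (Ioi 0) := by
  refine (integrableOn_decay.const_mul C).mono' hf.aestronglyMeasurable ?_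
  filter_upwards [ae_restrict_mem measurableSet_Ioi] with ε hε
  exact h ε hε

theorem abs_log_mul_le_decayWeight {f : ℝ → ℝ} {C ε : ℝ} (hε : 0 < ε) (h : |f ε| ≤ C * decay ε) :
    |Real.log (16 / ε) * f ε| ≤ 18 * C * decayWeight ε := by
  have := one_le_weight hε
  rw [abs_mul]
  calc _ ≤ 18 * (1 / Real.sqrt ε + Real.sqrt ε) * (C * decay ε) :=
        mul_le_mul (abs_log_sixteen_div_le hε) h (abs_nonneg _) (by positivity)
    _ = _ := by unfold decayWeight; ring

theorem integrableOn_log_mul {f : ℝ → ℝ} (hf : Measurable f) {C : ℝ}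
    (h : ∀ ε, 0 < ε → |f ε| ≤ C * decay ε) :
    IntegrableOn (fun ε => Real.log (16 / ε) * f ε) (Ioi 0) := by
  have hm : Measurable fun ε : ℝ => Real.log (16 / ε) * f ε :=
    (Real.measurable_log.comp (by fun_prop)).mul hf
  refine (integrableOn_decayWeight.const_mul (18 * C)).mono' hm.aestronglyMeasurable ?_
  filter_upwards [ae_restrict_mem measurableSet_Ioi] with ε hε
  exact abs_log_mul_le_decayWeight hε (h ε hε)

theorem one_div_sqrt_pow_le_decay {a ε : ℝ} (ha : 0 < a) (hε : 0 < ε) :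
    1 / Real.sqrt (a ^ 2 + ε ^ 2) ^ 3 ≤ (1 + 1 / a ^ 3) * decay ε := by
  have hE := sqrt_pos_of_pos_right a hε
  have h1 : a ≤ Real.sqrt (a ^ 2 + ε ^ 2) := Real.le_sqrt_of_sq_le (by nlinarith [sq_nonneg ε])
  have h2 : ε ≤ Real.sqrt (a ^ 2 + ε ^ 2) := Real.le_sqrt_of_sq_le (by nlinarith [sq_nonneg a])
  have h3 : 1 / Real.sqrt (a ^ 2 + ε ^ 2) ^ 3 ≤ 1 / a ^ 3 := by gcongr
  have h4 : 1 / Real.sqrt (a ^ 2 + ε ^ 2) ^ 3 ≤ 1 / ε ^ 3 := by gcongr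
  have h5 : 0 < 1 / a ^ 3 := by positivity
  have h6 : 0 < 1 / ε ^ 3 := by positivity
  unfold decay
  rcases le_total 1 (1 / ε ^ 3) with h | h
  · rw [min_eq_left h]; linarith
  · rw [min_eq_right h]; nlinarith

/-! ### The BCS integral -/

theorem bcsIntegrand_eq (x y ε : ℝ) :
    bcsIntegrand x y ε = gapKernel y (Real.sqrt (x ^ 2 + ε ^ 2)) - Real.tanh (ε / 2) / ε := rfl

theorem gapKernel_one (ε : ℝ) : gapKernel 1 ε = Real.tanh (ε / 2) / ε := by
  rw [gapKernel_of_ne one_ne_zero, mul_one]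

theorem measurable_gapKernel_sqrt (T x : ℝ) :
    Measurable fun ε => gapKernel T (Real.sqrt (x ^ 2 + ε ^ 2)) :=
  (measurable_gapKernel T).comp (by fun_prop)

theorem measurable_bcsIntegrand (x y : ℝ) : Measurable (bcsIntegrand x y) := by
  have h : bcsIntegrand x y = fun ε => gapKernel y (Real.sqrt (x ^ 2 + ε ^ 2)) - gapKernel 1 ε := by
    funext ε; rw [bcsIntegrand_eq, gapKernel_one]
  rw [h]
  exact (measurable_gapKernel_sqrt y x).sub (measurable_gapKernel 1)

theorem one_div_sub_one_div_sqrt_le (x : ℝ) {ε : ℝ} (hε : 0 < ε) :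
    1 / ε - 1 / Real.sqrt (x ^ 2 + ε ^ 2) ≤ x ^ 2 / ε ^ 3 := by
  have hE := sqrt_pos_of_pos_right x hε
  have h2 : ε ≤ Real.sqrt (x ^ 2 + ε ^ 2) := Real.le_sqrt_of_sq_le (by nlinarith [sq_nonneg x])
  have h3 : Real.sqrt (x ^ 2 + ε ^ 2) ^ 2 = x ^ 2 + ε ^ 2 := Real.sq_sqrt (by positivity)
  set E := Real.sqrt (x ^ 2 + ε ^ 2)
  rw [div_sub_div _ _ hε.ne' hE.ne', div_le_div_iff₀ (by positivity) (by positivity)]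
  have h4 : (E - ε) * (E + ε) = x ^ 2 := by rw [← sub_eq_zero]; linear_combination h3
  rw [← h4]
  have h5 : 0 ≤ E - ε := by linarith
  have : ε ^ 3 ≤ (E + ε) * (ε * E) := by
    have : ε * ε ≤ (E + ε) * E := by nlinarith
    calc ε ^ 3 = (ε * ε) * ε := by ring
      _ ≤ ((E + ε) * E) * ε := by gcongr
      _ = _ := by ring
  calc (1 * E - ε * 1) * ε ^ 3 = (E - ε) * ε ^ 3 := by ring
    _ ≤ (E - ε) * ((E + ε) * (ε * E)) := by gcongr
    _ = _ := by ring

theorem one_div_sub_gapKernel_sqrt_le {x y ε : ℝ} (hy : 0 ≤ y) (hε : 0 < ε) :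
    1 / Real.sqrt (x ^ 2 + ε ^ 2) - gapKernel y (Real.sqrt (x ^ 2 + ε ^ 2))
      ≤ 4 * y ^ 2 / ε ^ 3 := by
  have h2 : ε ≤ Real.sqrt (x ^ 2 + ε ^ 2) := Real.le_sqrt_of_sq_le (by nlinarith [sq_nonneg x])
  refine (one_div_sub_gapKernel_le hy (sqrt_pos_of_pos_right x hε)).trans ?_
  gcongr

theorem abs_bcsIntegrand_le {x y ε M b : ℝ} (hy : 0 ≤ y) (hy1 : y ≤ 1) (hb : |x| ≤ b) (hε : 0 < ε)
    (hM : gapKernel y (Real.sqrt (x ^ 2 + ε ^ 2)) ≤ M) :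
    |bcsIntegrand x y ε| ≤ (M + 8 + b ^ 2) * decay ε := by
  have hE := sqrt_pos_of_pos_right x hε
  have h0 := gapKernel_nonneg hy hE.le
  have k0 := gapKernel_nonneg zero_le_one hε.le
  have k1 := gapKernel_le one_pos hε.le
  have hx : x ^ 2 ≤ b ^ 2 := sq_le_sq' (by linarith [neg_abs_le x]) ((le_abs_self x).trans hb)
  have e1 : |bcsIntegrand x y ε| ≤ M + 8 + b ^ 2 := by
    rw [bcsIntegrand_eq, ← gapKernel_one, abs_le]
    constructor <;> nlinarith [sq_nonneg b]
  have e2 : |bcsIntegrand x y ε| ≤ (8 + b ^ 2) * (1 / ε ^ 3) := by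
    have a1 := one_div_sub_gapKernel_sqrt_le (x := x) hy hε
    have a2 := one_div_sub_gapKernel_le zero_le_one hε
    have a3 := one_div_sub_one_div_sqrt_le x hε
    have a4 := gapKernel_le_inv (T := y) hE.le
    have a5 := gapKernel_le_inv (T := 1) hε.le
    have a6 : 1 / Real.sqrt (x ^ 2 + ε ^ 2) ≤ 1 / ε := by
      gcongr; exact Real.le_sqrt_of_sq_le (by nlinarith [sq_nonneg x])
    have hp : 0 < 1 / ε ^ 3 := by positivity
    have a7 : x ^ 2 / ε ^ 3 ≤ b ^ 2 * (1 / ε ^ 3) := by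
      rw [div_eq_mul_one_div]; gcongr
    have a8 : 4 * y ^ 2 / ε ^ 3 ≤ 4 * (1 / ε ^ 3) := by
      rw [div_eq_mul_one_div]; gcongr; nlinarith
    have a9 : 4 * (1 : ℝ) ^ 2 / ε ^ 3 = 4 * (1 / ε ^ 3) := by ring
    rw [a9] at a2
    rw [bcsIntegrand_eq, ← gapKernel_one, abs_le]
    constructor <;> nlinarith [mul_nonneg (sq_nonneg b) hp.le]
  have hM0 : 0 ≤ M := h0.trans hM
  unfold decay
  rcases le_total 1 (1 / ε ^ 3) with h | h
  · rw [min_eq_left h]; linarith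
  · rw [min_eq_right h]
    have : 0 ≤ M * (1 / ε ^ 3) := by positivity
    linarith

theorem gapKernel_sqrt_le_one_div {T a x ε : ℝ} (ha : 0 < a) (hx : a ≤ x) :
    gapKernel T (Real.sqrt (x ^ 2 + ε ^ 2)) ≤ 1 / a := by
  refine (gapKernel_le_inv (Real.sqrt_nonneg _)).trans ?_
  gcongr
  exact hx.trans (Real.le_sqrt_of_sq_le (by nlinarith [sq_nonneg ε]))

/-- The integral `J(x, y)` whose zero set is the graph of `fBCS`. -/
def bcsIntegral (x y : ℝ) : ℝ := ∫ ε in Ioi (0 : ℝ), bcsIntegrand x y ε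

/-- The logarithmically weighted companion of `bcsIntegral`. -/
def bcsLogIntegral (x y : ℝ) : ℝ := ∫ ε in Ioi (0 : ℝ), Real.log (16 / ε) * bcsIntegrand x y ε

/-- The partial derivative of `bcsIntegral` in its first variable. -/
def bcsSlope (x y : ℝ) : ℝ := ∫ ε in Ioi (0 : ℝ), gapKernelDeriv y x ε

theorem exists_abs_bcsIntegrand_le {x y : ℝ} (hy : 0 ≤ y) (hy1 : y ≤ 1) (h : 0 < x ∨ 0 < y) :
    ∃ C, ∀ ε, 0 < ε → |bcsIntegrand x y ε| ≤ C * decay ε := by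
  rcases h with h | h
  · exact ⟨_, fun ε hε => abs_bcsIntegrand_le hy hy1 le_rfl hε (gapKernel_sqrt_le_one_div h le_rfl)⟩
  · exact ⟨_, fun ε hε => abs_bcsIntegrand_le hy hy1 le_rfl hε (gapKernel_le h (Real.sqrt_nonneg _))⟩

theorem integrableOn_bcsIntegrand {x y : ℝ} (hy : 0 ≤ y) (hy1 : y ≤ 1) (h : 0 < x ∨ 0 < y) :
    IntegrableOn (bcsIntegrand x y) (Ioi 0) := by
  obtain ⟨C, hC⟩ := exists_abs_bcsIntegrand_le hy hy1 h
  exact integrableOn_of_abs_le_decay (measurable_bcsIntegrand x y) hC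

theorem integrableOn_log_mul_bcsIntegrand {x y : ℝ} (hy : 0 ≤ y) (hy1 : y ≤ 1)
    (h : 0 < x ∨ 0 < y) :
    IntegrableOn (fun ε => Real.log (16 / ε) * bcsIntegrand x y ε) (Ioi 0) := by
  obtain ⟨C, hC⟩ := exists_abs_bcsIntegrand_le hy hy1 h
  exact integrableOn_log_mul (measurable_bcsIntegrand x y) hC

theorem setIntegral_Ioi_lt {f g : ℝ → ℝ} (hf : IntegrableOn f (Ioi 0)) (hg : IntegrableOn g (Ioi 0))
    (h : ∀ ε, 0 < ε → f ε < g ε) : ∫ ε in Ioi (0 : ℝ), f ε < ∫ ε in Ioi (0 : ℝ), g ε := by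
  rw [← sub_pos, ← integral_sub hg hf]
  rw [setIntegral_pos_iff_support_of_nonneg_ae]
  · have : Ioi (0 : ℝ) ⊆ Function.support (fun ε => g ε - f ε) ∩ Ioi 0 := fun ε hε =>
      ⟨(sub_pos.2 (h ε hε)).ne', hε⟩
    exact lt_of_lt_of_le (by simp) (measure_mono this)
  · filter_upwards [ae_restrict_mem measurableSet_Ioi] with ε hε
    exact (sub_pos.2 (h ε hε)).le
  · exact hg.sub hf

theorem gapKernel_sqrt_lt {T x₁ x₂ ε : ℝ} (hT : 0 ≤ T) (h1 : 0 ≤ x₁) (h12 : x₁ < x₂) (hε : 0 < ε) :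
    gapKernel T (Real.sqrt (x₂ ^ 2 + ε ^ 2)) < gapKernel T (Real.sqrt (x₁ ^ 2 + ε ^ 2)) := by
  apply strictAntiOn_gapKernel hT (sqrt_pos_of_pos_right _ hε) (sqrt_pos_of_pos_right _ hε)
  exact Real.sqrt_lt_sqrt (by positivity) (by nlinarith)

theorem bcsIntegral_lt {x₁ x₂ y : ℝ} (hy : 0 ≤ y) (h1 : 0 ≤ x₁) (h12 : x₁ < x₂)
    (hi₁ : IntegrableOn (bcsIntegrand x₁ y) (Ioi 0))
    (hi₂ : IntegrableOn (bcsIntegrand x₂ y) (Ioi 0)) :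
    bcsIntegral x₂ y < bcsIntegral x₁ y :=
  setIntegral_Ioi_lt hi₂ hi₁ fun ε hε => by
    rw [bcsIntegrand_eq, bcsIntegrand_eq]
    linarith [gapKernel_sqrt_lt (T := y) hy h1 h12 hε]

/-- The antiderivative is `ε / (a² √(a² + ε²))`. -/
theorem integral_one_div_sqrt_pow {a : ℝ} (ha : 0 < a) :
    IntegrableOn (fun ε => 1 / Real.sqrt (a ^ 2 + ε ^ 2) ^ 3) (Ioi 0) ∧
      ∫ ε in Ioi (0 : ℝ), 1 / Real.sqrt (a ^ 2 + ε ^ 2) ^ 3 = 1 / a ^ 2 := by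
  have hpos : ∀ ε : ℝ, 0 < a ^ 2 + ε ^ 2 := fun ε => by positivity
  have hd : ∀ ε : ℝ, HasDerivAt (fun ε => ε / (a ^ 2 * Real.sqrt (a ^ 2 + ε ^ 2)))
      (1 / Real.sqrt (a ^ 2 + ε ^ 2) ^ 3) ε := by
    intro ε
    have hs := Real.sqrt_pos.2 (hpos ε)
    have h : HasDerivAt (fun ε : ℝ => a ^ 2 + ε ^ 2) (2 * ε) ε := by
      simpa using (hasDerivAt_pow 2 ε).const_add (a ^ 2)
    refine ((hasDerivAt_id ε).div ((h.sqrt (hpos ε).ne').const_mul (a ^ 2))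
      (by positivity)).congr_deriv ?_
    have h3 : Real.sqrt (a ^ 2 + ε ^ 2) ^ 2 = a ^ 2 + ε ^ 2 := Real.sq_sqrt (hpos ε).le
    simp only [id]
    set E := Real.sqrt (a ^ 2 + ε ^ 2)
    field_simp
    linear_combination h3
  have hlim : Tendsto (fun ε => ε / (a ^ 2 * Real.sqrt (a ^ 2 + ε ^ 2))) atTop (𝓝 (1 / a ^ 2)) := by
    have h1 : Tendsto (fun ε : ℝ => 1 / (a ^ 2 * Real.sqrt (a ^ 2 * (ε⁻¹) ^ 2 + 1))) atTop
        (𝓝 (1 / (a ^ 2 * Real.sqrt (a ^ 2 * 0 ^ 2 + 1)))) := by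
      apply Tendsto.div tendsto_const_nhds
      · apply Tendsto.const_mul
        exact (Real.continuous_sqrt.tendsto _).comp
          (((tendsto_inv_atTop_zero.pow 2).const_mul _).add_const 1)
      · simp; exact ha.ne'
    simp only [ne_eq, OfNat.ofNat_ne_zero, not_false_eq_true, zero_pow, mul_zero, zero_add,
      Real.sqrt_one, mul_one] at h1
    refine h1.congr' ?_
    filter_upwards [eventually_gt_atTop 0] with ε hε
    have : a ^ 2 + ε ^ 2 = (a ^ 2 * (ε⁻¹) ^ 2 + 1) * ε ^ 2 := by field_simp
    rw [this, Real.sqrt_mul (by positivity), Real.sqrt_sq hε.le]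
    have : 0 < Real.sqrt (a ^ 2 * (ε⁻¹) ^ 2 + 1) := Real.sqrt_pos.2 (by positivity)
    field_simp
  have hnn : ∀ ε ∈ Ioi (0 : ℝ), 0 ≤ 1 / Real.sqrt (a ^ 2 + ε ^ 2) ^ 3 := fun ε _ => by positivity
  refine ⟨integrableOn_Ioi_deriv_of_nonneg' (fun ε _ => hd ε) hnn hlim, ?_⟩
  rw [integral_Ioi_of_hasDerivAt_of_nonneg' (fun ε _ => hd ε) hnn hlim]
  simp

theorem measurable_gapSlope (T : ℝ) : Measurable (gapSlope T) := by
  rcases eq_or_ne T 0 with rfl | h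
  · have e : gapSlope 0 = fun _ => 1 := by funext E; simp [gapSlope]
    rw [e]; exact measurable_const
  · have e : gapSlope T = fun E => tanhSlope (E / (2 * T)) := by
      funext E; simp [gapSlope, h]
    rw [e]
    exact continuous_tanhSlope.measurable.comp (by fun_prop)

theorem measurable_gapKernelDeriv (T x : ℝ) : Measurable (gapKernelDeriv T x) := by
  unfold gapKernelDeriv
  have : Measurable fun ε : ℝ => gapSlope T (Real.sqrt (x ^ 2 + ε ^ 2)) :=
    (measurable_gapSlope T).comp (by fun_prop)
  exact ((this.const_mul x).neg).div (by fun_prop)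

theorem integrableOn_gapKernelDeriv {x y : ℝ} (hx : 0 < x) (hy : 0 ≤ y) :
    IntegrableOn (gapKernelDeriv y x) (Ioi 0) := by
  refine ((integral_one_div_sqrt_pow hx).1.const_mul |x|).mono'
    (measurable_gapKernelDeriv y x).aestronglyMeasurable ?_
  filter_upwards [ae_restrict_mem measurableSet_Ioi] with ε hε
  exact (abs_gapKernelDeriv_le hy x hε).trans (le_of_eq (by ring))

/-- A quantitative form of the monotonicity of `bcsIntegral`: the factor `q` of the kernel derivative
is at least its value at `ε = 0` and temperature `1`. -/
theorem bcsSlope_le {x y : ℝ} (hx : 0 < x) (hy : 0 ≤ y) (hy1 : y ≤ 1) :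
    bcsSlope x y ≤ -(tanhSlope (x / 2) / x) := by
  obtain ⟨hi, he⟩ := integral_one_div_sqrt_pow hx
  have : -(tanhSlope (x / 2) / x)
      = ∫ ε in Ioi (0 : ℝ), -(x * tanhSlope (x / 2)) * (1 / Real.sqrt (x ^ 2 + ε ^ 2) ^ 3) := by
    rw [integral_const_mul, he]; field_simp
  rw [this]
  apply setIntegral_mono_on (integrableOn_gapKernelDeriv hx hy) (hi.const_mul _) measurableSet_Ioi
  intro ε hε
  have hE := sqrt_pos_of_pos_right x hε
  have := le_gapSlope (E := Real.sqrt (x ^ 2 + ε ^ 2)) hy hy1 hx.le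
    (Real.le_sqrt_of_sq_le (by nlinarith [sq_nonneg ε]))
  unfold gapKernelDeriv
  rw [mul_one_div]
  gcongr

theorem bcsSlope_neg {x y : ℝ} (hx : 0 < x) (hy : 0 ≤ y) (hy1 : y ≤ 1) : bcsSlope x y < 0 := by
  refine (bcsSlope_le hx hy hy1).trans_lt ?_
  have := tanhSlope_pos (half_pos hx)
  have : 0 < tanhSlope (x / 2) / x := by positivity
  linarith

theorem abs_bcsIntegral_taylor_le {a x₀ x y : ℝ} (ha : 0 < a) (hx₀ : a ≤ x₀) (hx : a ≤ x)
    (hy : 0 ≤ y) (hy1 : y ≤ 1) :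
    |bcsIntegral x y - bcsIntegral x₀ y - bcsSlope x₀ y * (x - x₀)| ≤ 6 / a ^ 2 * (x - x₀) ^ 2 := by
  obtain ⟨hi, he⟩ := integral_one_div_sqrt_pow ha
  have i1 := integrableOn_bcsIntegrand hy hy1 (Or.inl (ha.trans_le hx))
  have i0 := integrableOn_bcsIntegrand hy hy1 (Or.inl (ha.trans_le hx₀))
  have i2 := (integrableOn_gapKernelDeriv (ha.trans_le hx₀) hy).mul_const (x - x₀)
  unfold bcsIntegral bcsSlope
  rw [← integral_mul_const, ← integral_sub i1 i0]
  have i10 : Integrable (fun ε => bcsIntegrand x y ε - bcsIntegrand x₀ y ε)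
    (volume.restrict (Ioi 0)) := i1.sub i0
  rw [← integral_sub i10 i2]
  have : 6 / a ^ 2 * (x - x₀) ^ 2
      = ∫ ε in Ioi (0 : ℝ), 6 * (x - x₀) ^ 2 * (1 / Real.sqrt (a ^ 2 + ε ^ 2) ^ 3) := by
    rw [integral_const_mul, he]; field_simp
  rw [this, ← Real.norm_eq_abs]
  apply norm_integral_le_of_norm_le (hi.const_mul _)
  filter_upwards [ae_restrict_mem measurableSet_Ioi] with ε hε
  have := abs_gapKernel_taylor_le hy ha.le hx₀ hx hε
  rw [Real.norm_eq_abs, bcsIntegrand_eq, bcsIntegrand_eq, mul_one_div]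
  convert this using 2
  ring

theorem hasDerivAt_bcsIntegral {x y : ℝ} (hx : 0 < x) (hy : 0 ≤ y) (hy1 : y ≤ 1) :
    HasDerivAt (fun x => bcsIntegral x y) (bcsSlope x y) x := by
  rw [hasDerivAt_iff_isLittleO]
  have h1 : (fun x' => bcsIntegral x' y - bcsIntegral x y - (x' - x) • bcsSlope x y)
      =O[𝓝 x] fun x' => (x' - x) ^ 2 := by
    apply IsBigO.of_bound (6 / (x / 2) ^ 2)
    filter_upwards [lt_mem_nhds (half_lt_self hx)] with x' hx'
    have := abs_bcsIntegral_taylor_le (half_pos hx) (half_lt_self hx).le hx'.le hy hy1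
    rw [Real.norm_eq_abs, Real.norm_eq_abs, abs_of_nonneg (sq_nonneg (x' - x)), smul_eq_mul,
      mul_comm (x' - x)]
    exact this
  refine h1.trans_isLittleO ?_
  have h2 : (fun x' => (x' - x)) =o[𝓝 x] fun _ => (1 : ℝ) := by
    rw [isLittleO_one_iff]
    have : Tendsto (fun x' => x' - x) (𝓝 x) (𝓝 (x - x)) := tendsto_id.sub_const x
    simpa using this
  have := h2.mul_isBigO (isBigO_refl (fun x' => x' - x) (𝓝 x))
  simpa [sq] using this

theorem abs_gapKernel_sub_le {T a b x₀ x ε : ℝ} (hT : 0 ≤ T) (ha : 0 < a) (hx₀ : x₀ ∈ Icc a b)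
    (hx : x ∈ Icc a b) (hε : 0 < ε) :
    |gapKernel T (Real.sqrt (x ^ 2 + ε ^ 2)) - gapKernel T (Real.sqrt (x₀ ^ 2 + ε ^ 2))|
      ≤ b * (1 + 1 / a ^ 3) * |x - x₀| * decay ε := by
  have h := Convex.norm_image_sub_le_of_norm_hasDerivWithin_le
    (f := fun t => gapKernel T (Real.sqrt (t ^ 2 + ε ^ 2))) (f' := fun t => gapKernelDeriv T t ε)
    (s := Icc a b) (C := b * ((1 + 1 / a ^ 3) * decay ε))
    (fun t _ => (hasDerivAt_gapKernel_sqrt hT t hε).hasDerivWithinAt)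
    (fun t ht => by
      have hta : 0 < t := ha.trans_le ht.1
      refine (abs_gapKernelDeriv_le hT t hε).trans ?_
      have hE := sqrt_pos_of_pos_right a hε
      rw [div_eq_mul_one_div, abs_of_pos hta]
      refine mul_le_mul ht.2 ?_ (by positivity) (hta.le.trans ht.2)
      refine le_trans ?_ (one_div_sqrt_pow_le_decay ha hε)
      have := ht.1
      gcongr)
    (convex_Icc a b) hx₀ hx
  rw [Real.norm_eq_abs, Real.norm_eq_abs] at h
  exact h.trans (le_of_eq (by ring))

/-- Bounds on `bcsLogIntegral` that are uniform for the order parameter in a compact subset of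
`(0, ∞)` and the temperature in `[0, 1]`. -/
theorem exists_bcsLogIntegral_bound {a b : ℝ} (ha : 0 < a) :
    ∃ C, 0 ≤ C ∧ (∀ x ∈ Icc a b, ∀ y ∈ Icc (0 : ℝ) 1, |bcsLogIntegral x y| ≤ C) ∧
      (∀ x ∈ Icc a b, ∀ y ∈ Icc (0 : ℝ) 1,
        ∫ ε in Ioi (0 : ℝ), Real.sqrt ε * |bcsIntegrand x y ε| ≤ C) ∧
      ∀ x ∈ Icc a b, ∀ x₀ ∈ Icc a b, ∀ y ∈ Icc (0 : ℝ) 1,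
        |bcsLogIntegral x y - bcsLogIntegral x₀ y| ≤ C * |x - x₀| := by
  set W := ∫ ε in Ioi (0 : ℝ), decayWeight ε with hW
  have hdw : ∀ ε ∈ Ioi (0 : ℝ), 0 ≤ decayWeight ε := fun ε hε =>
    (decay_nonneg hε).trans (decay_le_decayWeight hε)
  have hW0 : 0 ≤ W := setIntegral_nonneg measurableSet_Ioi hdw
  set M := 1 / a + 8 + b ^ 2 with hM
  have hM0 : 0 ≤ M := by positivity
  set N := |b| * (1 + 1 / a ^ 3) with hN
  have hN0 : 0 ≤ N := by positivity
  have hb : ∀ x ∈ Icc a b, ∀ y ∈ Icc (0 : ℝ) 1, ∀ ε, 0 < ε → |bcsIntegrand x y ε| ≤ M * decay ε := by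
    intro x hx y hy ε hε
    refine abs_bcsIntegrand_le hy.1 hy.2 ?_ hε (gapKernel_sqrt_le_one_div ha hx.1)
    rw [abs_of_pos (ha.trans_le hx.1)]; exact hx.2
  refine ⟨18 * (M + N) * W, by positivity, ?_, ?_, ?_⟩
  · intro x hx y hy
    have : |bcsLogIntegral x y| ≤ ∫ ε in Ioi (0 : ℝ), 18 * M * decayWeight ε := by
      rw [← Real.norm_eq_abs]
      apply norm_integral_le_of_norm_le (integrableOn_decayWeight.const_mul _)
      filter_upwards [ae_restrict_mem measurableSet_Ioi] with ε hε
      exact abs_log_mul_le_decayWeight hε (hb x hx y hy ε hε)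
    rw [integral_const_mul, ← hW] at this
    nlinarith [mul_nonneg hN0 hW0]
  · intro x hx y hy
    have hp : ∀ ε ∈ Ioi (0 : ℝ), Real.sqrt ε * |bcsIntegrand x y ε| ≤ M * decayWeight ε := by
      intro ε hε
      have h0 : 0 < ε := hε
      have hs := Real.sqrt_pos.2 h0
      have hd := decay_nonneg h0
      have h1 : 0 < 1 / Real.sqrt ε := by positivity
      calc Real.sqrt ε * |bcsIntegrand x y ε| ≤ Real.sqrt ε * (M * decay ε) := by
            gcongr; exact hb x hx y hy ε h0
        _ = M * (Real.sqrt ε * decay ε) := by ring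
        _ ≤ M * ((1 / Real.sqrt ε + Real.sqrt ε) * decay ε) := by gcongr; linarith
    have : ∫ ε in Ioi (0 : ℝ), Real.sqrt ε * |bcsIntegrand x y ε|
        ≤ ∫ ε in Ioi (0 : ℝ), M * decayWeight ε := by
      apply setIntegral_mono_on _ (integrableOn_decayWeight.const_mul _) measurableSet_Ioi hp
      refine (integrableOn_decayWeight.const_mul M).mono'
        ((by fun_prop : Measurable Real.sqrt).mul
          (measurable_bcsIntegrand x y).abs).aestronglyMeasurable ?_
      filter_upwards [ae_restrict_mem measurableSet_Ioi] with ε hε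
      rw [Real.norm_of_nonneg (by positivity)]
      exact hp ε hε
    rw [integral_const_mul, ← hW] at this
    nlinarith [mul_nonneg hN0 hW0, mul_nonneg hM0 hW0]
  · intro x hx x₀ hx₀ y hy
    have i1 := integrableOn_log_mul_bcsIntegrand (x := x) hy.1 hy.2 (Or.inl (ha.trans_le hx.1))
    have i0 := integrableOn_log_mul_bcsIntegrand (x := x₀) hy.1 hy.2 (Or.inl (ha.trans_le hx₀.1))
    have : |bcsLogIntegral x y - bcsLogIntegral x₀ y|
        ≤ ∫ ε in Ioi (0 : ℝ), 18 * (N * |x - x₀|) * decayWeight ε := by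
      unfold bcsLogIntegral
      rw [← integral_sub i1 i0, ← Real.norm_eq_abs]
      apply norm_integral_le_of_norm_le (integrableOn_decayWeight.const_mul _)
      filter_upwards [ae_restrict_mem measurableSet_Ioi] with ε hε
      rw [Real.norm_eq_abs, ← mul_sub]
      apply abs_log_mul_le_decayWeight (f := fun ε => bcsIntegrand x y ε - bcsIntegrand x₀ y ε) hε
      have := abs_gapKernel_sub_le hy.1 ha hx₀ hx hε
      have e : bcsIntegrand x y ε - bcsIntegrand x₀ y ε
        = gapKernel y (Real.sqrt (x ^ 2 + ε ^ 2)) - gapKernel y (Real.sqrt (x₀ ^ 2 + ε ^ 2)) := by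
        rw [bcsIntegrand_eq, bcsIntegrand_eq]; ring
      have hd := decay_nonneg hε
      simp only [e]
      refine this.trans ?_
      rw [hN]
      gcongr
      exact le_abs_self b
    rw [integral_const_mul, ← hW] at this
    refine this.trans ?_
    have : 0 ≤ M * W * |x - x₀| := by positivity
    nlinarith

theorem continuous_bcsIntegral {y : ℝ} (hy : 0 < y) (hy1 : y ≤ 1) :
    Continuous fun x => bcsIntegral x y := by
  rw [continuous_iff_continuousAt]
  intro x₀
  apply continuousAt_of_dominated (bound := fun ε => (1 / (2 * y) + 8 + (|x₀| + 1) ^ 2) * decay ε)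
  · exact Eventually.of_forall fun x => (measurable_bcsIntegrand x y).aestronglyMeasurable
  · have : ∀ᶠ x in 𝓝 x₀, |x| < |x₀| + 1 :=
      continuous_abs.continuousAt.eventually_lt continuousAt_const (by linarith)
    filter_upwards [this] with x hx
    filter_upwards [ae_restrict_mem measurableSet_Ioi] with ε hε
    exact abs_bcsIntegrand_le hy.le hy1 hx.le hε (gapKernel_le hy (Real.sqrt_nonneg _))
  · exact integrableOn_decay.const_mul _
  · filter_upwards [ae_restrict_mem measurableSet_Ioi] with ε hε
    exact (hasDerivAt_gapKernel_sqrt hy.le x₀ hε).continuousAt.sub continuousAt_const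

/-! ### The density of states of the two-dimensional band -/

theorem lintegral_Ioc_periodic {f : ℝ → ℝ≥0∞} {T : ℝ} (hf : Function.Periodic f T) (hT : 0 < T)
    (s t : ℝ) : ∫⁻ x in Ioc t (t + T), f x = ∫⁻ x in Ioc s (s + T), f x := by
  have : VAddInvariantMeasure (AddSubgroup.zmultiples T) ℝ volume :=
    ⟨fun c s _ => measure_preimage_add _ _ _⟩
  apply IsAddFundamentalDomain.setLIntegral_eq (G := AddSubgroup.zmultiples T)
  exacts [isAddFundamentalDomain_Ioc hT t, isAddFundamentalDomain_Ioc hT s, hf.map_vadd_zmultiples]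

theorem lintegral_Ioc_comp_add (f : ℝ → ℝ≥0∞) (a b c : ℝ) :
    ∫⁻ x in Ioc a b, f (x + c) = ∫⁻ x in Ioc (a + c) (b + c), f x := by
  have h := (measurePreserving_add_right volume c).setLIntegral_comp_preimage_emb
    (MeasurableEquiv.addRight c).measurableEmbedding f (Ioc (a + c) (b + c))
  simpa using h

theorem lintegral_Ioc_periodic_comp_add {f : ℝ → ℝ≥0∞} {a b : ℝ}
    (hf : Function.Periodic f (b - a)) (hab : a < b) (c : ℝ) :
    ∫⁻ x in Ioc a b, f (x + c) = ∫⁻ x in Ioc a b, f x := by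
  rw [lintegral_Ioc_comp_add]
  have := lintegral_Ioc_periodic hf (sub_pos.2 hab) a (a + c)
  have e : a + c + (b - a) = b + c := by ring
  simpa [e] using this

/-- A function of `cos k₁ + cos k₂` on the torus has the same integral as the function with
`2 cos k cos (c / 2)` in place of `cos k₁ + cos k₂`: put `k₁ = k₂ + c`. -/
theorem lintegral_cos_add_cos {Φ : ℝ → ℝ≥0∞} (hΦ : Measurable Φ) :
    ∫⁻ a in Ioc (-Real.pi) Real.pi, ∫⁻ b in Ioc (-Real.pi) Real.pi, Φ (Real.cos a + Real.cos b)
      = ∫⁻ c in Ioc (-Real.pi) Real.pi, ∫⁻ k in Ioc (-Real.pi) Real.pi,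
          Φ (2 * Real.cos k * Real.cos (c / 2)) := by
  have hpi := Real.pi_pos
  have h2 : Real.pi - -Real.pi = 2 * Real.pi := by ring
  rw [lintegral_lintegral_swap (by fun_prop)]
  have h : ∀ b, ∫⁻ a in Ioc (-Real.pi) Real.pi, Φ (Real.cos a + Real.cos b)
      = ∫⁻ c in Ioc (-Real.pi) Real.pi, Φ (Real.cos (c + b) + Real.cos b) := by
    intro b
    have hper : Function.Periodic (fun a => Φ (Real.cos a + Real.cos b)) (Real.pi - -Real.pi) := by
      intro a; simp only [h2, Real.cos_add_two_pi]
    exact (lintegral_Ioc_periodic_comp_add hper (by linarith) b).symm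
  simp_rw [h]
  rw [lintegral_lintegral_swap (by fun_prop)]
  refine lintegral_congr fun c => ?_
  have hper : Function.Periodic (fun k => Φ (2 * Real.cos k * Real.cos (c / 2)))
      (Real.pi - -Real.pi) := by
    intro a; simp only [h2, Real.cos_add_two_pi]
  rw [← lintegral_Ioc_periodic_comp_add hper (by linarith) (c / 2)]
  refine lintegral_congr fun b => ?_
  rw [Real.cos_add_cos]
  ring_nf

theorem lintegral_Ioc_neg (f : ℝ → ℝ≥0∞) (a : ℝ) :
    ∫⁻ x in Ioc (-a) 0, f x = ∫⁻ x in Ioo 0 a, f (-x) := by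
  rw [← restrict_Ioo_eq_restrict_Ioc]
  have h := (Measure.measurePreserving_neg (volume : Measure ℝ)).setLIntegral_comp_preimage_emb
    (MeasurableEquiv.neg ℝ).measurableEmbedding f (Ioo (-a) 0)
  simpa using h.symm

theorem lintegral_cos_half {G : ℝ → ℝ≥0∞} :
    ∫⁻ k in Ioc (-(Real.pi / 2)) (Real.pi / 2), G (Real.cos k)
      = 2 * ∫⁻ a in Ioo 0 (Real.pi / 2), G (Real.sin a) := by
  have hpi := Real.pi_pos
  have e1 : ∫⁻ k in Ioo 0 (Real.pi / 2), G (Real.cos k) = ∫⁻ a in Ioo 0 (Real.pi / 2), G (Real.sin a) := by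
    have h := (Measure.measurePreserving_sub_left (volume : Measure ℝ) (Real.pi / 2)).setLIntegral_comp_preimage_emb
      (MeasurableEquiv.subLeft (Real.pi / 2)).measurableEmbedding (fun k => G (Real.cos k)) (Ioo 0 (Real.pi / 2))
    simp only [Real.cos_pi_div_two_sub, preimage_const_sub_Ioo, sub_zero, sub_self] at h
    exact h.symm
  have hs : Ioc (-(Real.pi / 2)) (Real.pi / 2) = Ioc (-(Real.pi / 2)) 0 ∪ Ioc 0 (Real.pi / 2) :=
    (Ioc_union_Ioc_eq_Ioc (by linarith) (by linarith)).symm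
  rw [hs, lintegral_union measurableSet_Ioc (Ioc_disjoint_Ioc_of_le le_rfl), lintegral_Ioc_neg,
    ← restrict_Ioo_eq_restrict_Ioc]
  simp only [Real.cos_neg]
  rw [e1, two_mul]

/-- Reduction of the integral of an even function of the cosine over a period to a quarter
period. -/
theorem lintegral_cos_even {G : ℝ → ℝ≥0∞} (hG : ∀ x, G (-x) = G x) :
    ∫⁻ k in Ioc (-Real.pi) Real.pi, G (Real.cos k)
      = 4 * ∫⁻ a in Ioo 0 (Real.pi / 2), G (Real.sin a) := by
  have hpi := Real.pi_pos
  have hper : Function.Periodic (fun k => G (Real.cos k)) Real.pi := by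
    intro k; simp only [Real.cos_add_pi, hG]
  have h := lintegral_Ioc_periodic hper hpi
  have h1 := h (-(Real.pi / 2)) (-Real.pi)
  have h2 := h (-(Real.pi / 2)) 0
  have e : -(Real.pi / 2) + Real.pi = Real.pi / 2 := by ring
  rw [e, lintegral_cos_half] at h1 h2
  rw [neg_add_cancel] at h1
  rw [zero_add] at h2
  have hs : Ioc (-Real.pi) Real.pi = Ioc (-Real.pi) 0 ∪ Ioc 0 Real.pi :=
    (Ioc_union_Ioc_eq_Ioc (by linarith) (by linarith)).symm
  rw [hs, lintegral_union measurableSet_Ioc (Ioc_disjoint_Ioc_of_le le_rfl), h1, h2, ← add_mul]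
  norm_num

theorem lintegral_comp_sin (φ : ℝ → ℝ≥0∞) :
    ∫⁻ a in Ioo 0 (Real.pi / 2), φ (Real.sin a)
      = ∫⁻ s in Ioo (0 : ℝ) 1, ENNReal.ofReal (1 / Real.sqrt (1 - s ^ 2)) * φ s := by
  have hpi := Real.pi_pos
  have himg : Real.sin '' Ioo 0 (Real.pi / 2) = Ioo 0 1 := by
    apply Subset.antisymm
    · rintro _ ⟨a, ha, rfl⟩
      have h1 := Real.sin_lt_sin_of_lt_of_le_pi_div_two (x := 0) (by linarith) ha.2.le ha.1
      have h2 := Real.sin_lt_sin_of_lt_of_le_pi_div_two (by linarith [ha.1]) le_rfl ha.2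
      rw [Real.sin_zero] at h1
      rw [Real.sin_pi_div_two] at h2
      exact ⟨h1, h2⟩
    · intro s hs
      exact ⟨Real.arcsin s, ⟨Real.arcsin_pos.2 hs.1, Real.arcsin_lt_pi_div_two.2 hs.2⟩,
        Real.sin_arcsin (by linarith [hs.1]) hs.2.le⟩
  have hinj : InjOn Real.sin (Ioo 0 (Real.pi / 2)) :=
    fun x hx y hy h => Real.strictMonoOn_sin.injOn ⟨by linarith [hx.1], hx.2.le⟩
      ⟨by linarith [hy.1], hy.2.le⟩ h
  have h := lintegral_image_eq_lintegral_abs_deriv_mul measurableSet_Ioo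
    (fun x _ => (Real.hasDerivAt_sin x).hasDerivWithinAt) hinj
    (fun s => ENNReal.ofReal (1 / Real.sqrt (1 - s ^ 2)) * φ s)
  rw [himg] at h
  rw [h]
  refine setLIntegral_congr_fun measurableSet_Ioo fun a ha => ?_
  have hc : 0 < Real.cos a := Real.cos_pos_of_mem_Ioo ⟨by linarith [ha.1], ha.2⟩
  have : 1 - Real.sin a ^ 2 = Real.cos a ^ 2 := by rw [← Real.sin_sq_add_cos_sq a]; ring
  rw [this, Real.sqrt_sq hc.le, abs_of_pos hc, ← mul_assoc, ← ENNReal.ofReal_mul hc.le,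
    mul_one_div, div_self hc.ne', ENNReal.ofReal_one, one_mul]

/-- The complete elliptic integral `K(√(1 - κ²))`, as an extended nonnegative real. Up to constants
it is the density of states of the two-dimensional band at the energy `4 κ`. -/
def ellipticLIntegral (κ : ℝ) : ℝ≥0∞ :=
  ∫⁻ s in Ioo κ 1, ENNReal.ofReal (1 / (Real.sqrt (1 - s ^ 2) * Real.sqrt (s ^ 2 - κ ^ 2)))

/-- The distribution of a product of two sines, by the substitutions `s = sin a`, `κ = s sin b`. -/
theorem lintegral_sin_mul_sin {F : ℝ → ℝ≥0∞} (hF : Measurable F) :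
    ∫⁻ a in Ioo 0 (Real.pi / 2), ∫⁻ b in Ioo 0 (Real.pi / 2), F (Real.sin a * Real.sin b)
      = ∫⁻ κ in Ioo (0 : ℝ) 1, ellipticLIntegral κ * F κ := by
  set w : ℝ → ℝ≥0∞ := fun s => ENNReal.ofReal (1 / Real.sqrt (1 - s ^ 2)) with hw
  have hwm : Measurable w := by fun_prop
  rw [lintegral_comp_sin (fun s => ∫⁻ b in Ioo 0 (Real.pi / 2), F (s * Real.sin b))]
  -- substitute `κ = s t` in the inner integral
  have inner : ∀ s ∈ Ioo (0 : ℝ) 1,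
      w s * ∫⁻ b in Ioo 0 (Real.pi / 2), F (s * Real.sin b)
      = ∫⁻ κ in Ioo (0 : ℝ) 1, (Ioo κ 1).indicator (fun s => ENNReal.ofReal
          (1 / (Real.sqrt (1 - s ^ 2) * Real.sqrt (s ^ 2 - κ ^ 2)))) s * F κ := by
    intro s hs
    rw [lintegral_comp_sin (fun t => F (s * t))]
    have himg : (fun t => s * t) '' Ioo 0 1 = Ioo 0 s := by
      rw [image_mul_left_Ioo hs.1]; simp
    have h := lintegral_image_eq_lintegral_abs_deriv_mul (s := Ioo (0 : ℝ) 1) (f := fun t => s * t)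
      (f' := fun _ => s) measurableSet_Ioo
      (fun t _ => by simpa using ((hasDerivAt_id t).const_mul s).hasDerivWithinAt)
      (fun x _ y _ hxy => mul_left_cancel₀ hs.1.ne' hxy)
      (fun κ => ENNReal.ofReal (1 / (Real.sqrt (s ^ 2 - κ ^ 2))) * F κ)
    rw [himg] at h
    have e1 : ∫⁻ t in Ioo (0 : ℝ) 1, ENNReal.ofReal (1 / Real.sqrt (1 - t ^ 2)) * F (s * t)
        = ∫⁻ κ in Ioo (0 : ℝ) s, ENNReal.ofReal (1 / (Real.sqrt (s ^ 2 - κ ^ 2))) * F κ := by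
      rw [h]
      refine setLIntegral_congr_fun measurableSet_Ioo fun t ht => ?_
      have : s ^ 2 - (s * t) ^ 2 = s ^ 2 * (1 - t ^ 2) := by ring
      rw [this, Real.sqrt_mul (sq_nonneg s), Real.sqrt_sq hs.1.le, abs_of_pos hs.1, ← mul_assoc,
        ← ENNReal.ofReal_mul hs.1.le]
      congr 2
      have hs0 := hs.1.ne'
      rw [one_div, one_div, mul_inv, mul_inv_cancel_left₀ hs0]
    rw [e1, ← lintegral_const_mul' _ _ ENNReal.ofReal_ne_top]
    have hsub : Ioo 0 s ⊆ Ioo (0 : ℝ) 1 := Ioo_subset_Ioo_right hs.2.le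
    rw [← inter_eq_self_of_subset_left hsub, ← Measure.restrict_restrict measurableSet_Ioo,
      ← lintegral_indicator measurableSet_Ioo]
    refine setLIntegral_congr_fun measurableSet_Ioo fun κ hκ => ?_
    by_cases hκs : κ < s
    · rw [indicator_of_mem (show κ ∈ Ioo 0 s from ⟨hκ.1, hκs⟩),
        indicator_of_mem (show s ∈ Ioo κ 1 from ⟨hκs, hs.2⟩), ← mul_assoc,
        ← ENNReal.ofReal_mul (by positivity)]
      congr 2
      rw [one_div_mul_one_div]
    · rw [indicator_of_notMem (fun h => hκs h.2), indicator_of_notMem (fun h => hκs h.1), zero_mul]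
  rw [setLIntegral_congr_fun measurableSet_Ioo inner, lintegral_lintegral_swap]
  · refine setLIntegral_congr_fun measurableSet_Ioo fun κ hκ => ?_
    have hsub : Ioo κ 1 ⊆ Ioo (0 : ℝ) 1 := Ioo_subset_Ioo_left hκ.1.le
    rw [lintegral_mul_const, lintegral_indicator measurableSet_Ioo,
      Measure.restrict_restrict measurableSet_Ioo, inter_eq_self_of_subset_left hsub,
      ellipticLIntegral]
    exact Measurable.indicator (by fun_prop) measurableSet_Ioo
  · apply Measurable.aemeasurable
    apply Measurable.mul _ (by fun_prop)
    have : (fun a : ℝ × ℝ => (Ioo a.2 1).indicator (fun s => ENNReal.ofReal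
          (1 / (Real.sqrt (1 - s ^ 2) * Real.sqrt (s ^ 2 - a.2 ^ 2)))) a.1)
        = {p : ℝ × ℝ | p.2 < p.1 ∧ p.1 < 1}.indicator (fun p => ENNReal.ofReal
          (1 / (Real.sqrt (1 - p.1 ^ 2) * Real.sqrt (p.1 ^ 2 - p.2 ^ 2)))) := by
      funext p
      simp [indicator, Ioo]
    rw [this]
    apply Measurable.indicator (by fun_prop)
    exact (measurableSet_lt measurable_snd measurable_fst).inter
      (measurableSet_lt measurable_fst measurable_const)

theorem measurable_ellipticLIntegral : Measurable ellipticLIntegral := by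
  have h : ellipticLIntegral = fun κ => ∫⁻ s, {p : ℝ × ℝ | p.1 < p.2 ∧ p.2 < 1}.indicator
      (fun p => ENNReal.ofReal
        (1 / (Real.sqrt (1 - p.2 ^ 2) * Real.sqrt (p.2 ^ 2 - p.1 ^ 2)))) (κ, s) := by
    funext κ
    rw [ellipticLIntegral, ← lintegral_indicator measurableSet_Ioo]
    rfl
  rw [h]
  apply Measurable.lintegral_prod_right'
  apply Measurable.indicator (by fun_prop)
  exact (measurableSet_lt measurable_fst measurable_snd).inter
    (measurableSet_lt measurable_snd measurable_const)

theorem lintegral_cube (g : ℝ → ℝ → ℝ≥0∞) (hg : Measurable (Function.uncurry g)) :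
    ∫⁻ k in cube, g (k 0) (k 1) = ENNReal.ofReal (2 * Real.pi) *
      ∫⁻ a in Ioc (-Real.pi) Real.pi, ∫⁻ b in Ioc (-Real.pi) Real.pi, g a b := by
  set μ : Measure ℝ := volume.restrict (Icc (-Real.pi) Real.pi) with hμ
  have h1 : (volume.restrict cube : Measure (Fin 3 → ℝ)) = Measure.pi fun _ => μ := by
    rw [cube, ← pi_univ_Icc, volume_pi, Measure.restrict_pi_pi]
  have h2 := (measurePreserving_piFinSuccAbove (fun _ : Fin 3 => μ) 2).lintegral_comp
    (f := fun z => g (z.2 0) (z.2 1))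
    (hg.comp (f := fun z : ℝ × (Fin 2 → ℝ) => (z.2 0, z.2 1)) (by fun_prop))
  have h3 := (measurePreserving_piFinTwo (fun _ : Fin 2 => μ)).lintegral_comp
    (f := fun z : ℝ × ℝ => g z.1 z.2) hg
  have hm : μ univ = ENNReal.ofReal (2 * Real.pi) := by
    simp only [hμ, Measure.restrict_apply_univ, Real.volume_Icc]; congr 1; ring
  rw [h1]
  refine h2.trans ?_
  rw [lintegral_prod (fun z : ℝ × (Fin 2 → ℝ) => g (z.2 0) (z.2 1)) (Measurable.aemeasurable
    (hg.comp (f := fun z : ℝ × (Fin 2 → ℝ) => (z.2 0, z.2 1)) (by fun_prop)))]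
  dsimp only
  rw [lintegral_const, hm, mul_comm]
  congr 1
  refine h3.trans ?_
  rw [lintegral_prod (fun z : ℝ × ℝ => g z.1 z.2) hg.aemeasurable, hμ]
  simp only [restrict_Ioc_eq_restrict_Icc]

theorem lintegral_even_band {F : ℝ → ℝ≥0∞} (hF : Measurable F) (he : ∀ x, F (-x) = F x) :
    ∫⁻ k in cube, F (band 0 k) = ENNReal.ofReal (8 * Real.pi) *
      ∫⁻ ε in Ioo (0 : ℝ) 4, ellipticLIntegral (ε / 4) * F ε := by
  have hpi := Real.pi_pos
  have h1 : ∀ k, F (band 0 k) = F (2 * (Real.cos (k 0) + Real.cos (k 1))) := by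
    intro k
    rw [← he]; congr 1; unfold band; ring
  simp_rw [h1]
  rw [lintegral_cube (fun a b => F (2 * (Real.cos a + Real.cos b)))
    (by unfold Function.uncurry; fun_prop),
    lintegral_cos_add_cos (Φ := fun x => F (2 * x)) (by fun_prop)]
  have h2 : ∀ c, ∫⁻ k in Ioc (-Real.pi) Real.pi, F (2 * (2 * Real.cos k * Real.cos (c / 2)))
      = 4 * ∫⁻ a in Ioo 0 (Real.pi / 2), F (4 * (Real.sin a * Real.cos (c / 2))) := by
    intro c
    rw [lintegral_cos_even (G := fun x => F (2 * (2 * x * Real.cos (c / 2))))]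
    · congr 2; funext a; congr 1; ring
    · intro x; rw [← he]; congr 1; ring
  simp_rw [h2]
  -- substitute `c = 2 b`
  have h3 : ∫⁻ c in Ioc (-Real.pi) Real.pi,
        4 * ∫⁻ a in Ioo 0 (Real.pi / 2), F (4 * (Real.sin a * Real.cos (c / 2)))
      = 8 * ∫⁻ b in Ioc (-(Real.pi / 2)) (Real.pi / 2),
          ∫⁻ a in Ioo 0 (Real.pi / 2), F (4 * (Real.sin a * Real.cos b)) := by
    have himg : (fun b : ℝ => 2 * b) '' Ioc (-(Real.pi / 2)) (Real.pi / 2)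
        = Ioc (-Real.pi) Real.pi := by
      rw [image_mul_left_Ioc two_pos]; congr 1 <;> ring
    have h := lintegral_image_eq_lintegral_abs_deriv_mul
      (s := Ioc (-(Real.pi / 2)) (Real.pi / 2)) (f := fun t => 2 * t)
      (f' := fun _ => 2) measurableSet_Ioc
      (fun t _ => by simpa using ((hasDerivAt_id t).const_mul (2 : ℝ)).hasDerivWithinAt)
      (fun x _ y _ hxy => mul_left_cancel₀ two_ne_zero hxy)
      (fun c => 4 * ∫⁻ a in Ioo 0 (Real.pi / 2), F (4 * (Real.sin a * Real.cos (c / 2))))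
    rw [himg] at h
    rw [h, ← lintegral_const_mul' _ _ (by norm_num)]
    refine lintegral_congr fun b => ?_
    rw [← mul_assoc, mul_div_cancel_left₀ _ (two_ne_zero (α := ℝ))]
    congr 1
    simp; norm_num
  rw [h3, lintegral_cos_half (G := fun x => ∫⁻ a in Ioo 0 (Real.pi / 2), F (4 * (Real.sin a * x)))]
  have h4 := lintegral_sin_mul_sin (F := fun x => F (4 * x)) (by fun_prop)
  have h5 : ∫⁻ a in Ioo 0 (Real.pi / 2), ∫⁻ a_1 in Ioo 0 (Real.pi / 2),
      F (4 * (Real.sin a_1 * Real.sin a)) = ∫⁻ κ in Ioo (0 : ℝ) 1, ellipticLIntegral κ * F (4 * κ) := by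
    rw [← h4]
    refine lintegral_congr fun a => lintegral_congr fun b => ?_
    rw [mul_comm (Real.sin b)]
  have h6 : ∫⁻ ε in Ioo (0 : ℝ) 4, ellipticLIntegral (ε / 4) * F ε
      = 4 * ∫⁻ κ in Ioo (0 : ℝ) 1, ellipticLIntegral κ * F (4 * κ) := by
    have himg : (fun b : ℝ => 4 * b) '' Ioo 0 1 = Ioo 0 4 := by
      rw [image_mul_left_Ioo (by norm_num)]; norm_num
    have h := lintegral_image_eq_lintegral_abs_deriv_mul
      (s := Ioo (0 : ℝ) 1) (f := fun t => 4 * t)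
      (f' := fun _ => 4) measurableSet_Ioo
      (fun t _ => by simpa using ((hasDerivAt_id t).const_mul (4 : ℝ)).hasDerivWithinAt)
      (fun x _ y _ hxy => mul_left_cancel₀ four_ne_zero hxy)
      (fun ε => ellipticLIntegral (ε / 4) * F ε)
    rw [himg] at h
    rw [h, ← lintegral_const_mul' _ _ (by norm_num)]
    refine lintegral_congr fun b => ?_
    rw [mul_div_cancel_left₀ _ (four_ne_zero (α := ℝ))]
    simp
  rw [h5, h6, ← mul_assoc, ← mul_assoc, ← mul_assoc]
  congr 1
  have e4 : (4 : ℝ≥0∞) = ENNReal.ofReal 4 := by simp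
  have e8 : (8 : ℝ≥0∞) = ENNReal.ofReal 8 := by simp
  have e2 : (2 : ℝ≥0∞) = ENNReal.ofReal 2 := by simp
  rw [e4, e8, e2, ← ENNReal.ofReal_mul (by positivity), ← ENNReal.ofReal_mul (by positivity),
    ← ENNReal.ofReal_mul (by positivity)]
  congr 1; ring

/-! ### Logarithmic singularity of the density of states -/

/-- The symmetry `s ↦ κ / s` of the elliptic integrand exchanges `(κ, √κ)` and `(√κ, 1)`. -/
theorem ellipticLIntegral_eq_two_mul {κ : ℝ} (h0 : 0 < κ) (h1 : κ < 1) :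
    ellipticLIntegral κ = 2 * ∫⁻ s in Ioo (Real.sqrt κ) 1,
      ENNReal.ofReal (1 / (Real.sqrt (1 - s ^ 2) * Real.sqrt (s ^ 2 - κ ^ 2))) := by
  have hs := Real.sqrt_pos.2 h0
  have hsq := Real.sq_sqrt h0.le
  set r := Real.sqrt κ with hr
  have hr1 : r < 1 := by nlinarith
  have hκr : κ < r := by nlinarith
  have himg : (fun s => κ / s) '' Ioo r 1 = Ioo κ r := by
    ext u
    constructor
    · rintro ⟨s, hsr, rfl⟩
      have : 0 < s := hs.trans hsr.1
      refine ⟨?_, ?_⟩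
      · show κ < κ / s
        rw [lt_div_iff₀ this]; nlinarith [hsr.2]
      · show κ / s < r
        rw [div_lt_iff₀ this]; nlinarith [hsr.1]
    · intro hu
      have : 0 < u := h0.trans hu.1
      refine ⟨κ / u, ⟨?_, ?_⟩, ?_⟩
      · rw [lt_div_iff₀ this]; nlinarith [hu.2]
      · rw [div_lt_one this]; exact hu.1
      · show κ / (κ / u) = u
        field_simp
  have h := lintegral_image_eq_lintegral_abs_deriv_mul (s := Ioo r 1) (f := fun s => κ / s)
    (f' := fun s => -κ / s ^ 2) measurableSet_Ioo
    (fun s hs' => by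
      have : s ≠ 0 := (hs.trans hs'.1).ne'
      have h := (hasDerivAt_inv this).const_mul κ
      simp only [← div_eq_mul_inv] at h
      exact (h.congr_deriv (by field_simp)).hasDerivWithinAt)
    (fun x hx y hy hxy => by
      have h1 : x ≠ 0 := (hs.trans hx.1).ne'
      have h2 : y ≠ 0 := (hs.trans hy.1).ne'
      have h3 : κ / x = κ / y := hxy
      field_simp at h3
      exact h3.symm)
    (fun s => ENNReal.ofReal (1 / (Real.sqrt (1 - s ^ 2) * Real.sqrt (s ^ 2 - κ ^ 2))))
  rw [himg] at h
  have hsplit : Ioo κ 1 = Ioc κ r ∪ Ioo r 1 := (Ioc_union_Ioo_eq_Ioo hκr.le hr1).symm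
  have hdisj : Disjoint (Ioc κ r) (Ioo r 1) := by
    rw [disjoint_left]; intro x hx hx'; exact absurd hx.2 (not_le.2 hx'.1)
  rw [ellipticLIntegral, hsplit, lintegral_union measurableSet_Ioo hdisj,
    ← restrict_Ioo_eq_restrict_Ioc, h, two_mul]
  congr 1
  refine setLIntegral_congr_fun measurableSet_Ioo fun s hs' => ?_
  have hs0 : 0 < s := hs.trans hs'.1
  have hs2 : κ < s ^ 2 := by nlinarith [hs'.1]
  have e1 : 1 - (κ / s) ^ 2 = (s ^ 2 - κ ^ 2) / s ^ 2 := by field_simp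
  have e2 : (κ / s) ^ 2 - κ ^ 2 = κ ^ 2 * (1 - s ^ 2) / s ^ 2 := by field_simp
  have p1 : 0 < s ^ 2 - κ ^ 2 := by nlinarith
  have p2 : 0 < 1 - s ^ 2 := by nlinarith [hs'.2]
  have q1 := Real.sqrt_pos.2 p1
  have q2 := Real.sqrt_pos.2 p2
  rw [← ENNReal.ofReal_mul (abs_nonneg _)]
  congr 1
  rw [e1, e2, Real.sqrt_div' _ (sq_nonneg s), Real.sqrt_div' _ (sq_nonneg s),
    Real.sqrt_mul (sq_nonneg κ), Real.sqrt_sq hs0.le, Real.sqrt_sq h0.le, neg_div, abs_neg,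
    abs_of_pos (by positivity)]
  field_simp

theorem lintegral_one_div_mul_sqrt {r : ℝ} (h0 : 0 < r) (h1 : r < 1) :
    ∫⁻ s in Ioo r 1, ENNReal.ofReal (1 / (s * Real.sqrt (1 - s ^ 2)))
      = ENNReal.ofReal (Real.log (1 + Real.sqrt (1 - r ^ 2)) - Real.log r) := by
  have hpos : ∀ s ∈ Ioo r 1, 0 < 1 - s ^ 2 := fun s hs => by nlinarith [hs.1, hs.2]
  have hd : ∀ s ∈ Ioo r 1, HasDerivAt (fun s => Real.log s - Real.log (1 + Real.sqrt (1 - s ^ 2)))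
      (1 / (s * Real.sqrt (1 - s ^ 2))) s := by
    intro s hs
    have p := hpos s hs
    have q := Real.sqrt_pos.2 p
    have hs0 : 0 < s := h0.trans hs.1
    have e : Real.sqrt (1 - s ^ 2) ^ 2 = 1 - s ^ 2 := Real.sq_sqrt p.le
    have h : HasDerivAt (fun s : ℝ => 1 - s ^ 2) (-(2 * s)) s := by
      simpa using (hasDerivAt_pow 2 s).const_sub 1
    refine ((Real.hasDerivAt_log hs0.ne').sub
      (((h.sqrt p.ne').const_add 1).log (by positivity))).congr_deriv ?_
    set R := Real.sqrt (1 - s ^ 2)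
    field_simp
    linear_combination e
  have hc : ContinuousOn (fun s => Real.log s - Real.log (1 + Real.sqrt (1 - s ^ 2))) (Icc r 1) := by
    intro s hs
    have hs0 : 0 < s := h0.trans_le hs.1
    apply ContinuousAt.continuousWithinAt
    apply (Real.continuousAt_log hs0.ne').sub
    apply ContinuousAt.log (by fun_prop)
    have := Real.sqrt_nonneg (1 - s ^ 2)
    positivity
  have hnn : ∀ s ∈ Ioo r 1, 0 ≤ 1 / (s * Real.sqrt (1 - s ^ 2)) := fun s hs => by
    have : 0 < s := h0.trans hs.1
    positivity
  have hi : IntegrableOn (fun s => 1 / (s * Real.sqrt (1 - s ^ 2))) (Ioc r 1) :=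
    intervalIntegral.integrableOn_deriv_of_nonneg hc hd hnn
  have hv := intervalIntegral.integral_eq_sub_of_hasDerivAt_of_le h1.le hc hd
    ((intervalIntegrable_iff_integrableOn_Ioc_of_le h1.le).2 hi)
  rw [intervalIntegral.integral_of_le h1.le, integral_Ioc_eq_integral_Ioo] at hv
  rw [← ofReal_integral_eq_lintegral_ofReal (hi.mono_set Ioo_subset_Ioc_self), hv]
  · congr 1; simp
  · filter_upwards [ae_restrict_mem measurableSet_Ioo] with s hs using hnn s hs

theorem ellipticLIntegral_bounds {κ : ℝ} (h0 : 0 < κ) (h1 : κ < 1) :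
    ENNReal.ofReal (2 * Real.log (1 + Real.sqrt (1 - κ)) - Real.log κ) ≤ ellipticLIntegral κ ∧
    ellipticLIntegral κ ≤ ENNReal.ofReal
      ((2 * Real.log (1 + Real.sqrt (1 - κ)) - Real.log κ) / Real.sqrt (1 - κ)) := by
  have hs := Real.sqrt_pos.2 h0
  have hsq := Real.sq_sqrt h0.le
  have hr1 : Real.sqrt κ < 1 := by nlinarith
  have hv := lintegral_one_div_mul_sqrt hs hr1
  rw [hsq, Real.log_sqrt h0.le] at hv
  have ht : 0 < Real.sqrt (1 - κ) := Real.sqrt_pos.2 (by linarith)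
  have e2 : (2 : ℝ≥0∞) = ENNReal.ofReal 2 := by simp
  have ev : ENNReal.ofReal (2 * Real.log (1 + Real.sqrt (1 - κ)) - Real.log κ)
      = 2 * ∫⁻ s in Ioo (Real.sqrt κ) 1, ENNReal.ofReal (1 / (s * Real.sqrt (1 - s ^ 2))) := by
    rw [hv, e2, ← ENNReal.ofReal_mul two_pos.le]; congr 1; ring
  have hfac : ∀ s ∈ Ioo (Real.sqrt κ) 1, 0 < s ∧ κ < s ^ 2 ∧ 0 < 1 - s ^ 2 := by
    intro s hs'
    have := hs.trans hs'.1
    exact ⟨this, by nlinarith [hs'.1], by nlinarith [hs'.2]⟩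
  rw [ellipticLIntegral_eq_two_mul h0 h1]
  constructor
  · rw [ev]
    gcongr 2 * ?_
    refine setLIntegral_mono' measurableSet_Ioo fun s hs' => ENNReal.ofReal_le_ofReal ?_
    obtain ⟨a1, a2, a3⟩ := hfac s hs'
    have q1 : 0 < Real.sqrt (1 - s ^ 2) := Real.sqrt_pos.2 a3
    have q2 : 0 < Real.sqrt (s ^ 2 - κ ^ 2) := Real.sqrt_pos.2 (by nlinarith)
    rw [mul_comm s]
    gcongr
    rw [Real.sqrt_le_left a1.le]; nlinarith
  · rw [div_eq_inv_mul, ENNReal.ofReal_mul (by positivity), ev, ← mul_assoc, mul_comm _ (2 : ℝ≥0∞),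
      mul_assoc, ← lintegral_const_mul' _ _ ENNReal.ofReal_ne_top]
    gcongr 2 * ?_
    refine setLIntegral_mono' measurableSet_Ioo fun s hs' => ?_
    obtain ⟨a1, a2, a3⟩ := hfac s hs'
    have q1 : 0 < Real.sqrt (1 - s ^ 2) := Real.sqrt_pos.2 a3
    rw [← ENNReal.ofReal_mul (by positivity)]
    apply ENNReal.ofReal_le_ofReal
    rw [← one_div, one_div_mul_one_div]
    have : Real.sqrt (1 - κ) * s ≤ Real.sqrt (s ^ 2 - κ ^ 2) := by
      apply Real.le_sqrt_of_sq_le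
      rw [mul_pow, Real.sq_sqrt (by linarith)]
      nlinarith
    apply one_div_le_one_div_of_le (by positivity)
    calc Real.sqrt (1 - κ) * (s * Real.sqrt (1 - s ^ 2))
        = Real.sqrt (1 - s ^ 2) * (Real.sqrt (1 - κ) * s) := by ring
      _ ≤ _ := by gcongr

/-- The density of states of the two-dimensional band at the energy `ε ∈ (0, 4)`, normalized so
that its singularity at `0` is `log (16 / ε)`. -/
def bandDensity (ε : ℝ) : ℝ := (ellipticLIntegral (ε / 4)).toReal

theorem ellipticLIntegral_lt_top {κ : ℝ} (h0 : 0 < κ) (h1 : κ < 1) : ellipticLIntegral κ < ∞ :=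
  (ellipticLIntegral_bounds h0 h1).2.trans_lt ENNReal.ofReal_lt_top

theorem abs_ellipticLIntegral_sub_log_le {κ : ℝ} (h0 : 0 < κ) (h1 : κ < 1) :
    |(ellipticLIntegral κ).toReal - Real.log (4 / κ)| ≤ 16 * Real.sqrt κ := by
  obtain ⟨hl, hu⟩ := ellipticLIntegral_bounds h0 h1
  have ht : 0 < Real.sqrt (1 - κ) := Real.sqrt_pos.2 (by linarith)
  have hts : Real.sqrt (1 - κ) ^ 2 = 1 - κ := Real.sq_sqrt (by linarith)
  set t := Real.sqrt (1 - κ) with ht_def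
  have ht1 : t < 1 := by nlinarith
  have hs := Real.sqrt_pos.2 h0
  have hsq := Real.sq_sqrt h0.le
  have hr1 : Real.sqrt κ < 1 := by nlinarith
  have hlog4 : Real.log (4 / κ) = 2 * Real.log 2 - Real.log κ := by
    rw [Real.log_div (by norm_num) h0.ne', show (4 : ℝ) = 2 ^ 2 by norm_num, Real.log_pow]; simp
  have hA : 0 ≤ 2 * Real.log (1 + t) - Real.log κ := by
    have := Real.log_nonneg (show 1 ≤ 1 + t by linarith)
    have := Real.log_nonpos h0.le h1.le
    linarith
  have hl' : 2 * Real.log (1 + t) - Real.log κ ≤ (ellipticLIntegral κ).toReal := by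
    rwa [← ENNReal.ofReal_le_iff_le_toReal (ellipticLIntegral_lt_top h0 h1).ne]
  have hu' : (ellipticLIntegral κ).toReal ≤ (2 * Real.log (1 + t) - Real.log κ) / t :=
    ENNReal.toReal_le_of_le_ofReal (by positivity) hu
  have hlog2 : Real.log (1 + t) ≤ Real.log 2 := Real.log_le_log (by linarith) (by linarith)
  rw [abs_le]
  constructor
  · have h3 := Real.one_sub_inv_le_log_of_pos (x := (1 + t) / 2) (by linarith)
    rw [Real.log_div (by linarith) two_ne_zero] at h3
    have h4 : 1 - ((1 + t) / 2)⁻¹ ≥ -κ := by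
      have : 1 - ((1 + t) / 2)⁻¹ = -((1 - t) / (1 + t)) := by field_simp; ring
      rw [this]
      have : (1 - t) / (1 + t) ≤ κ := by
        rw [div_le_iff₀ (by linarith)]; nlinarith
      linarith
    have : κ ≤ Real.sqrt κ := by nlinarith
    rw [hlog4]; linarith
  · rcases le_total κ (1 / 2) with hκ | hκ
    · have h5 : 1 / t ≤ 1 + 2 * κ := by
        rw [div_le_iff₀ ht]; nlinarith
      have h6 : Real.log (4 / κ) ≤ 2 * (2 / Real.sqrt κ) := by
        have := Real.log_le_sub_one_of_pos (x := Real.sqrt (4 / κ)) (by positivity)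
        rw [Real.log_sqrt (by positivity), Real.sqrt_div (by norm_num),
          show (4 : ℝ) = 2 ^ 2 by norm_num, Real.sqrt_sq two_pos.le] at this
        rw [show (4 : ℝ) = 2 ^ 2 by norm_num]
        linarith
      have h7 : 0 ≤ Real.log (4 / κ) := Real.log_nonneg (by rw [le_div_iff₀ h0]; linarith)
      have h8 : (2 * Real.log (1 + t) - Real.log κ) / t ≤ Real.log (4 / κ) * (1 + 2 * κ) := by
        rw [div_eq_mul_one_div]
        apply mul_le_mul _ h5 (by positivity) h7
        rw [hlog4]; linarith
      have h9 : Real.log (4 / κ) * (2 * κ) ≤ 8 * Real.sqrt κ := by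
        calc _ ≤ 2 * (2 / Real.sqrt κ) * (2 * κ) := by gcongr
          _ = 2 * (2 / Real.sqrt κ) * (2 * Real.sqrt κ ^ 2) := by rw [hsq]
          _ = _ := by field_simp; ring
      nlinarith
    · have h7 : 0 ≤ Real.log (4 / κ) := Real.log_nonneg (by rw [le_div_iff₀ h0]; linarith)
      have h71 : t ≤ 3 / 4 := by nlinarith
      have h8 : 2 * Real.log (1 + t) - Real.log κ ≤ 8 * t := by
        have h9 : κ = (1 + t) * (1 - t) := by linear_combination hts
        rw [h9, Real.log_mul (by linarith) (by linarith)]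
        have h10 := Real.log_le_sub_one_of_pos (x := 1 + t) (by linarith)
        have h11 := Real.log_le_sub_one_of_pos (x := (1 - t)⁻¹) (inv_pos.2 (by linarith))
        rw [Real.log_inv] at h11
        have h12 : (1 - t)⁻¹ - 1 ≤ 4 * t := by
          rw [inv_eq_one_div, sub_le_iff_le_add, div_le_iff₀ (by linarith)]; nlinarith
        linarith
      have h13 : (2 * Real.log (1 + t) - Real.log κ) / t ≤ 8 := by
        rw [div_le_iff₀ ht]; exact h8
      have : 1 / 2 ≤ Real.sqrt κ := Real.le_sqrt_of_sq_le (by linarith)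
      linarith

theorem bandDensity_nonneg (ε : ℝ) : 0 ≤ bandDensity ε := ENNReal.toReal_nonneg

theorem measurable_bandDensity : Measurable bandDensity :=
  (measurable_ellipticLIntegral.comp (by fun_prop : Measurable fun ε : ℝ => ε / 4)).ennreal_toReal

theorem abs_bandDensity_sub_log_le {ε : ℝ} (h0 : 0 < ε) (h4 : ε < 4) :
    |bandDensity ε - Real.log (16 / ε)| ≤ 8 * Real.sqrt ε := by
  have h := abs_ellipticLIntegral_sub_log_le (κ := ε / 4) (by linarith) (by linarith)
  have e1 : 4 / (ε / 4) = 16 / ε := by field_simp; norm_num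
  have e2 : Real.sqrt (ε / 4) = Real.sqrt ε / 2 := by
    rw [Real.sqrt_div h0.le, show (4 : ℝ) = 2 ^ 2 by norm_num, Real.sqrt_sq two_pos.le]
  rw [e1, e2] at h
  unfold bandDensity
  linarith

theorem integrableOn_bandDensity : IntegrableOn bandDensity (Ioo 0 4) := by
  have h := lintegral_even_band (F := fun _ => 1) measurable_const (fun _ => rfl)
  simp only [lintegral_const, mul_one, one_mul, Measure.restrict_apply_univ] at h
  have hc : volume cube < ∞ := by
    unfold cube; exact isCompact_Icc.measure_lt_top
  apply integrable_toReal_of_lintegral_ne_top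
  · exact (measurable_ellipticLIntegral.comp
      (by fun_prop : Measurable fun ε : ℝ => ε / 4)).aemeasurable
  · intro htop
    rw [htop, ENNReal.mul_top (by simp [Real.pi_pos])] at h
    exact hc.ne h

/-- Integrals of even functions of the band energy over the Brillouin zone, in terms of the density
of states. -/
theorem integral_even_band {φ : ℝ → ℝ} (hφ : Measurable φ) (he : ∀ x, φ (-x) = φ x) :
    ∫ k in cube, φ (band 0 k) = 8 * Real.pi * ∫ ε in Ioo (0 : ℝ) 4, bandDensity ε * φ ε := by
  have hpi := Real.pi_pos
  have hm : Measurable fun ε : ℝ => ellipticLIntegral (ε / 4) :=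
    measurable_ellipticLIntegral.comp (by fun_prop)
  have hb : Measurable fun k : Fin 3 → ℝ => |band 0 k| := by unfold band; fun_prop
  have hmap : Measure.map (fun k => |band 0 k|) (volume.restrict cube)
      = ENNReal.ofReal (8 * Real.pi) •
        (volume.restrict (Ioo (0 : ℝ) 4)).withDensity fun ε => ellipticLIntegral (ε / 4) := by
    apply Measure.ext_of_lintegral
    intro f hf
    rw [lintegral_map hf hb, lintegral_even_band (F := fun x => f |x|) (by fun_prop)
      (fun x => by rw [abs_neg]), lintegral_smul_measure,
      lintegral_withDensity_eq_lintegral_mul _ hm hf, smul_eq_mul]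
    congr 1
    refine setLIntegral_congr_fun measurableSet_Ioo fun ε hε => ?_
    simp [abs_of_pos hε.1]
  have habs : ∀ x, φ |x| = φ x := by
    intro x
    rcases abs_choice x with h | h <;> rw [h]
    exact he x
  calc ∫ k in cube, φ (band 0 k) = ∫ k in cube, φ |band 0 k| := by simp_rw [habs]
    _ = ∫ ε, φ ε ∂(Measure.map (fun k => |band 0 k|) (volume.restrict cube)) :=
        (integral_map hb.aemeasurable hφ.aestronglyMeasurable).symm
    _ = _ := by
        rw [hmap, integral_smul_measure, integral_withDensity_eq_integral_toReal_smul hm]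
        · rw [ENNReal.toReal_ofReal (by positivity)]; rfl
        · filter_upwards [ae_restrict_mem measurableSet_Ioo] with ε hε
          exact ellipticLIntegral_lt_top (by linarith [hε.1]) (by linarith [hε.2])

/-! ### The gap equations -/

/-- The integral `∫ N(ε) tanh (E / 2T) / E dε` with `E = √(x² + ε²)` and density of states `N`.
The Néel temperature and the order parameter are determined by its value being `2 π² / U`. -/
def bandGap (x T : ℝ) : ℝ :=
  ∫ ε in Ioo (0 : ℝ) 4, bandDensity ε * gapKernel T (Real.sqrt (x ^ 2 + ε ^ 2))

theorem neelEquation_iff {U T : ℝ} (hU : 0 < U) (hT : 0 < T) :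
    NeelEquation U 0 T ↔ bandGap 0 T = 2 * Real.pi ^ 2 / U := by
  have hpi := Real.pi_pos
  have h := integral_even_band
    (φ := fun e => U * Real.tanh (e / (2 * T)) / (2 * e) / (2 * Real.pi) ^ 3)
    (by
      have := continuous_tanh.measurable
      fun_prop)
    (fun x => by
      rw [neg_div, Real.tanh_neg, mul_neg, mul_neg, neg_div_neg_eq])
  have h2 : ∫ ε in Ioo (0 : ℝ) 4,
      bandDensity ε * (U * Real.tanh (ε / (2 * T)) / (2 * ε) / (2 * Real.pi) ^ 3)
      = U / (2 * (2 * Real.pi) ^ 3) * bandGap 0 T := by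
    rw [bandGap, ← integral_const_mul]
    refine setIntegral_congr_fun measurableSet_Ioo fun ε hε => ?_
    rw [zero_pow two_ne_zero, zero_add, Real.sqrt_sq hε.1.le, gapKernel_of_ne hT.ne']
    have := hε.1.ne'
    field_simp
  rw [NeelEquation, h, h2, eq_div_iff hU.ne']
  have e : 8 * Real.pi * (U / (2 * (2 * Real.pi) ^ 3) * bandGap 0 T)
    = bandGap 0 T * U / (2 * Real.pi ^ 2) := by field_simp; norm_num
  rw [e, eq_div_iff (by positivity), one_mul, eq_comm]

theorem meanFieldEquation_iff {U T Δ : ℝ} (hU : 0 < U) (hΔ : 0 < Δ) :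
    MeanFieldEquation U 0 T Δ ↔ bandGap Δ T = 2 * Real.pi ^ 2 / U := by
  have hpi := Real.pi_pos
  have e0 : ∀ e : ℝ, U * tanhDiv (Real.sqrt (Δ ^ 2 + e ^ 2) / 2) T
      / (2 * Real.sqrt (Δ ^ 2 + e ^ 2)) / (2 * Real.pi) ^ 3
      = U / (2 * (2 * Real.pi) ^ 3) * gapKernel T (Real.sqrt (Δ ^ 2 + e ^ 2)) := by
    intro e
    have : 0 < Real.sqrt (Δ ^ 2 + e ^ 2) := Real.sqrt_pos.2 (by positivity)
    unfold gapKernel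
    field_simp
  have h := integral_even_band
    (φ := fun e => U / (2 * (2 * Real.pi) ^ 3) * gapKernel T (Real.sqrt (Δ ^ 2 + e ^ 2)))
    ((measurable_gapKernel_sqrt T Δ).const_mul _)
    (fun x => by rw [neg_sq])
  have h2 : ∫ ε in Ioo (0 : ℝ) 4,
      bandDensity ε * (U / (2 * (2 * Real.pi) ^ 3) * gapKernel T (Real.sqrt (Δ ^ 2 + ε ^ 2)))
      = U / (2 * (2 * Real.pi) ^ 3) * bandGap Δ T := by
    rw [bandGap, ← integral_const_mul]
    refine setIntegral_congr_fun measurableSet_Ioo fun ε _ => ?_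
    ring
  rw [MeanFieldEquation]
  simp_rw [e0]
  rw [h, h2, eq_div_iff hU.ne']
  have e : 8 * Real.pi * (U / (2 * (2 * Real.pi) ^ 3) * bandGap Δ T)
    = bandGap Δ T * U / (2 * Real.pi ^ 2) := by field_simp; norm_num
  rw [e, left_eq_mul₀ hΔ.ne', div_eq_one_iff_eq (by positivity)]

theorem integrableOn_bandDensity_mul {φ : ℝ → ℝ} (hφ : Measurable φ) {C : ℝ}
    (h : ∀ ε ∈ Ioo (0 : ℝ) 4, |φ ε| ≤ C) :
    IntegrableOn (fun ε => bandDensity ε * φ ε) (Ioo 0 4) := by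
  refine (integrableOn_bandDensity.mul_const C).mono'
    (measurable_bandDensity.mul hφ).aestronglyMeasurable ?_
  filter_upwards [ae_restrict_mem measurableSet_Ioo] with ε hε
  rw [Real.norm_eq_abs, abs_mul, abs_of_nonneg (bandDensity_nonneg ε)]
  exact mul_le_mul_of_nonneg_left (h ε hε) (bandDensity_nonneg ε)

theorem abs_gapKernel_le {T E C : ℝ} (hT : 0 ≤ T) (hE : 0 ≤ E) (h : gapKernel T E ≤ C) :
    |gapKernel T E| ≤ C := by
  rwa [abs_of_nonneg (gapKernel_nonneg hT hE)]

theorem integrableOn_bandGap {x T : ℝ} (hT : 0 ≤ T) (h : 0 < x ∨ 0 < T) :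
    IntegrableOn (fun ε => bandDensity ε * gapKernel T (Real.sqrt (x ^ 2 + ε ^ 2))) (Ioo 0 4) := by
  rcases h with h | h
  · exact integrableOn_bandDensity_mul (measurable_gapKernel_sqrt T x) fun ε _ =>
      abs_gapKernel_le hT (Real.sqrt_nonneg _) (gapKernel_sqrt_le_one_div h le_rfl)
  · exact integrableOn_bandDensity_mul (measurable_gapKernel_sqrt T x) fun ε _ =>
      abs_gapKernel_le hT (Real.sqrt_nonneg _) (gapKernel_le h (Real.sqrt_nonneg _))

theorem bandDensity_pos {ε : ℝ} (h0 : 0 < ε) (h4 : ε < 4) : 0 < bandDensity ε := by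
  have h1 : 0 < ε / 4 := by linarith
  have h2 : ε / 4 < 1 := by linarith
  apply ENNReal.toReal_pos _ (ellipticLIntegral_lt_top h1 h2).ne
  refine (lt_of_lt_of_le ?_ (ellipticLIntegral_bounds h1 h2).1).ne'
  rw [ENNReal.ofReal_pos]
  have := Real.log_nonneg (show 1 ≤ 1 + Real.sqrt (1 - ε / 4) by
    linarith [Real.sqrt_nonneg (1 - ε / 4)])
  have := Real.log_neg h1 h2
  linarith

theorem setIntegral_bandDensity_lt {φ ψ : ℝ → ℝ}
    (hφ : IntegrableOn (fun ε => bandDensity ε * φ ε) (Ioo 0 4))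
    (hψ : IntegrableOn (fun ε => bandDensity ε * ψ ε) (Ioo 0 4))
    (h : ∀ ε ∈ Ioo (0 : ℝ) 4, φ ε < ψ ε) :
    ∫ ε in Ioo (0 : ℝ) 4, bandDensity ε * φ ε < ∫ ε in Ioo (0 : ℝ) 4, bandDensity ε * ψ ε := by
  have hpos : ∀ ε ∈ Ioo (0 : ℝ) 4, 0 < bandDensity ε * ψ ε - bandDensity ε * φ ε := fun ε hε => by
    rw [← mul_sub]; exact mul_pos (bandDensity_pos hε.1 hε.2) (sub_pos.2 (h ε hε))
  rw [← sub_pos, ← integral_sub hψ hφ, setIntegral_pos_iff_support_of_nonneg_ae]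
  · have : Ioo (0 : ℝ) 4 ⊆
      Function.support (fun ε => bandDensity ε * ψ ε - bandDensity ε * φ ε) ∩ Ioo 0 4 :=
      fun ε hε => ⟨(hpos ε hε).ne', hε⟩
    exact lt_of_lt_of_le (by simp) (measure_mono this)
  · filter_upwards [ae_restrict_mem measurableSet_Ioo] with ε hε using (hpos ε hε).le
  · exact hψ.sub hφ

theorem bandGap_lt_of_lt {x₁ x₂ T : ℝ} (hT : 0 ≤ T) (h1 : 0 ≤ x₁) (h : 0 < x₁ ∨ 0 < T)
    (h12 : x₁ < x₂) : bandGap x₂ T < bandGap x₁ T :=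
  setIntegral_bandDensity_lt (integrableOn_bandGap hT (Or.inl (h1.trans_lt h12)))
    (integrableOn_bandGap hT h) fun _ hε => gapKernel_sqrt_lt hT h1 h12 hε.1

theorem bandGap_zero_lt_of_lt {T₁ T₂ : ℝ} (h1 : 0 < T₁) (h12 : T₁ < T₂) :
    bandGap 0 T₂ < bandGap 0 T₁ := by
  refine setIntegral_bandDensity_lt (integrableOn_bandGap (h1.trans h12).le (Or.inr (h1.trans h12)))
    (integrableOn_bandGap h1.le (Or.inr h1)) fun ε hε => ?_
  have h2 := h1.trans h12
  have hE := sqrt_pos_of_pos_right 0 hε.1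
  rw [gapKernel_of_ne h1.ne', gapKernel_of_ne h2.ne']
  apply div_lt_div_of_pos_right _ hE
  apply strictMono_tanh
  gcongr

theorem bandGap_le {x T : ℝ} (hT : 0 ≤ T) {C : ℝ} (h : 0 < x ∨ 0 < T)
    (hC : ∀ ε ∈ Ioo (0 : ℝ) 4, gapKernel T (Real.sqrt (x ^ 2 + ε ^ 2)) ≤ C) :
    bandGap x T ≤ (∫ ε in Ioo (0 : ℝ) 4, bandDensity ε) * C := by
  rw [← integral_mul_const]
  exact setIntegral_mono_on (integrableOn_bandGap hT h) (integrableOn_bandDensity.mul_const C)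
    measurableSet_Ioo fun ε hε => mul_le_mul_of_nonneg_left (hC ε hε) (bandDensity_nonneg ε)

theorem exists_bandGap_lt {A : ℝ} (hA : 0 < A) :
    (∃ X : ℝ, 0 < X ∧ ∀ x T, X ≤ x → 0 ≤ T → bandGap x T < A) ∧
      ∃ X : ℝ, 0 < X ∧ ∀ T, X ≤ T → bandGap 0 T < A := by
  set D := ∫ ε in Ioo (0 : ℝ) 4, bandDensity ε with hD
  have hD0 : 0 ≤ D := setIntegral_nonneg measurableSet_Ioo fun ε _ => bandDensity_nonneg ε
  have key : ∀ x, (D + 1) / A ≤ x → D * (1 / x) < A := by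
    intro x hx
    have hx0 : 0 < x := lt_of_lt_of_le (by positivity) hx
    rw [mul_one_div, div_lt_iff₀ hx0]
    rw [div_le_iff₀ hA] at hx
    linarith
  refine ⟨⟨(D + 1) / A, by positivity, fun x T hx hT => ?_⟩,
    ⟨(D + 1) / A, by positivity, fun T hT => ?_⟩⟩
  · have hx0 : 0 < x := lt_of_lt_of_le (by positivity) hx
    exact (bandGap_le hT (Or.inl hx0) fun ε _ => gapKernel_sqrt_le_one_div hx0 le_rfl).trans_lt
      (key x hx)
  · have hT0 : 0 < T := lt_of_lt_of_le (by positivity) hT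
    refine (bandGap_le hT0.le (Or.inr hT0) fun ε _ => (gapKernel_le hT0 (Real.sqrt_nonneg _)).trans
      ?_).trans_lt (key T hT)
    apply one_div_le_one_div_of_le hT0; linarith

theorem continuousAt_bandGap_left {x₀ T : ℝ} (hT : 0 ≤ T) (h : 0 < x₀ ∨ 0 < T) :
    ContinuousAt (fun x => bandGap x T) x₀ := by
  obtain ⟨C, hC⟩ : ∃ C, ∀ᶠ x in 𝓝 x₀, ∀ ε : ℝ, gapKernel T (Real.sqrt (x ^ 2 + ε ^ 2)) ≤ C := by
    rcases h with h | h
    · exact ⟨1 / (x₀ / 2), by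
        filter_upwards [lt_mem_nhds (half_lt_self h)] with x hx ε
        exact gapKernel_sqrt_le_one_div (half_pos h) hx.le⟩
    · exact ⟨1 / (2 * T), Eventually.of_forall fun x ε => gapKernel_le h (Real.sqrt_nonneg _)⟩
  apply continuousAt_of_dominated (bound := fun ε => bandDensity ε * C)
  · exact Eventually.of_forall fun x =>
      (measurable_bandDensity.mul (measurable_gapKernel_sqrt T x)).aestronglyMeasurable
  · filter_upwards [hC] with x hx
    refine Eventually.of_forall fun ε => ?_
    rw [Real.norm_eq_abs, abs_mul, abs_of_nonneg (bandDensity_nonneg ε)]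
    exact mul_le_mul_of_nonneg_left (abs_gapKernel_le hT (Real.sqrt_nonneg _) (hx ε))
      (bandDensity_nonneg ε)
  · exact integrableOn_bandDensity.mul_const C
  · filter_upwards [ae_restrict_mem measurableSet_Ioo] with ε hε
    exact continuousAt_const.mul (hasDerivAt_gapKernel_sqrt hT x₀ hε.1).continuousAt

theorem continuousAt_bandGap_zero {T₀ : ℝ} (hT : 0 < T₀) :
    ContinuousAt (fun T => bandGap 0 T) T₀ := by
  apply continuousAt_of_dominated (bound := fun ε => bandDensity ε * (1 / T₀))
  · exact Eventually.of_forall fun x =>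
      (measurable_bandDensity.mul (measurable_gapKernel_sqrt _ _)).aestronglyMeasurable
  · filter_upwards [lt_mem_nhds (half_lt_self hT)] with T hT'
    have hT0 : 0 < T := (half_pos hT).trans hT'
    refine Eventually.of_forall fun ε => ?_
    rw [Real.norm_eq_abs, abs_mul, abs_of_nonneg (bandDensity_nonneg ε)]
    refine mul_le_mul_of_nonneg_left (abs_gapKernel_le hT0.le (Real.sqrt_nonneg _)
      ((gapKernel_le hT0 (Real.sqrt_nonneg _)).trans ?_)) (bandDensity_nonneg ε)
    exact one_div_le_one_div_of_le hT (by linarith)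
  · exact integrableOn_bandDensity.mul_const _
  · filter_upwards [ae_restrict_mem measurableSet_Ioo] with ε hε
    apply continuousAt_const.mul
    have h : ContinuousAt (fun T => Real.tanh (Real.sqrt (0 ^ 2 + ε ^ 2) / (2 * T))
        / Real.sqrt (0 ^ 2 + ε ^ 2)) T₀ := by
      apply ContinuousAt.div_const
      exact continuous_tanh.continuousAt.comp
        (continuousAt_const.div (by fun_prop) (by positivity))
    refine h.congr ?_
    filter_upwards [lt_mem_nhds hT] with T hT'
    rw [gapKernel_of_ne hT'.ne']

theorem gapKernel_mul {c : ℝ} (hc : 0 < c) (T E : ℝ) :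
    gapKernel (T * c) (E * c) = gapKernel T E / c := by
  unfold gapKernel tanhDiv
  have h1 : E * c / 2 / (T * c) = E / 2 / T := by
    rw [mul_div_right_comm, mul_div_mul_right _ _ hc.ne']
  have h2 : T * c = 0 ↔ T = 0 := by simp [hc.ne']
  simp only [h1, h2]
  rw [div_mul_eq_div_div]

/-- The gap integral in units of the temperature `τ`. -/
theorem bandGap_mul {τ : ℝ} (hτ : 0 < τ) (x y : ℝ) :
    bandGap (x * τ) (y * τ) = ∫ u in Ioo (0 : ℝ) (4 / τ),
      bandDensity (τ * u) * gapKernel y (Real.sqrt (x ^ 2 + u ^ 2)) := by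
  have himg : (fun b : ℝ => τ * b) '' Ioo 0 (4 / τ) = Ioo 0 4 := by
    rw [image_mul_left_Ioo hτ, mul_zero, mul_div_cancel₀ _ hτ.ne']
  have h := integral_image_eq_integral_abs_deriv_smul
    (s := Ioo (0 : ℝ) (4 / τ)) (f := fun t => τ * t)
    (f' := fun _ => τ) measurableSet_Ioo
    (fun t _ => by simpa using ((hasDerivAt_id t).const_mul τ).hasDerivWithinAt)
    (fun x _ y _ hxy => mul_left_cancel₀ hτ.ne' hxy)
    (fun ε => bandDensity ε * gapKernel (y * τ) (Real.sqrt ((x * τ) ^ 2 + ε ^ 2)))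
  rw [himg] at h
  rw [bandGap, h]
  refine setIntegral_congr_fun measurableSet_Ioo fun u _ => ?_
  have e : Real.sqrt ((x * τ) ^ 2 + (τ * u) ^ 2) = Real.sqrt (x ^ 2 + u ^ 2) * τ := by
    rw [show (x * τ) ^ 2 + (τ * u) ^ 2 = (x ^ 2 + u ^ 2) * τ ^ 2 by ring,
      Real.sqrt_mul (by positivity), Real.sqrt_sq hτ.le]
  simp only [smul_eq_mul]
  rw [e, gapKernel_mul hτ, abs_of_pos hτ]
  field_simp

theorem abs_indicator_bandDensity_sub_log_le {v : ℝ} (hv : 0 < v) :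
    |(Ioo (0 : ℝ) 4).indicator bandDensity v - Real.log (16 / v)| ≤ 8 * Real.sqrt v := by
  rcases lt_or_ge v 4 with h | h
  · have hm : v ∈ Ioo (0 : ℝ) 4 := ⟨hv, h⟩
    rw [indicator_of_mem hm]
    exact abs_bandDensity_sub_log_le hv h
  · rw [indicator_of_notMem (fun h' => absurd h'.2 (not_lt.2 h)), zero_sub, abs_neg,
      Real.log_div (by norm_num) hv.ne']
    have h2 : 2 ≤ Real.sqrt v := Real.le_sqrt_of_sq_le (by linarith)
    have h3 := Real.log_le_sub_one_of_pos (Real.sqrt_pos.2 hv)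
    rw [Real.log_sqrt hv.le] at h3
    have h4 : Real.log 16 ≤ 15 := by
      have := Real.log_le_sub_one_of_pos (x := 16) (by norm_num); linarith
    have h5 : 0 ≤ Real.log v := Real.log_nonneg (by linarith)
    have h6 : 0 ≤ Real.log 16 := Real.log_nonneg (by norm_num)
    rw [abs_le]; constructor <;> linarith

/-- Replacing the density of states at low energies by its logarithmic singularity. -/
theorem abs_integral_bandDensity_sub_le {f : ℝ → ℝ} (hf : Measurable f) {C : ℝ}
    (hC : ∀ u, 0 < u → |f u| ≤ C * decay u) {τ : ℝ} (hτ : 0 < τ) :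
    |(∫ u in Ioo (0 : ℝ) (4 / τ), bandDensity (τ * u) * f u)
      - (-Real.log τ * (∫ u in Ioi (0 : ℝ), f u) + ∫ u in Ioi (0 : ℝ), Real.log (16 / u) * f u)|
      ≤ 8 * Real.sqrt τ * ∫ u in Ioi (0 : ℝ), Real.sqrt u * |f u| := by
  have i1 := integrableOn_of_abs_le_decay hf hC
  have i2 := integrableOn_log_mul hf hC
  have i3 : IntegrableOn (fun u => Real.sqrt u * |f u|) (Ioi 0) := by
    refine (integrableOn_decayWeight.const_mul C).mono'
      ((by fun_prop : Measurable Real.sqrt).mul hf.abs).aestronglyMeasurable ?_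
    filter_upwards [ae_restrict_mem measurableSet_Ioi] with u hu
    have h0 : 0 < u := hu
    have hs := Real.sqrt_pos.2 h0
    have h1 : 0 < 1 / Real.sqrt u := by positivity
    have h2 := hC u h0
    have h3 := (abs_nonneg _).trans h2
    rw [Real.norm_of_nonneg (by positivity), decayWeight]
    calc Real.sqrt u * |f u| ≤ Real.sqrt u * (C * decay u) := by gcongr
      _ ≤ (1 / Real.sqrt u + Real.sqrt u) * (C * decay u) := by gcongr; linarith
      _ = _ := by ring
  have i4 : IntegrableOn (fun u => -Real.log τ * f u + Real.log (16 / u) * f u) (Ioi 0) :=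
    (i1.const_mul _).add i2
  set g : ℝ → ℝ := fun u => (Ioo (0 : ℝ) 4).indicator bandDensity (τ * u) * f u with hg
  have hgm : Measurable g :=
    ((measurable_bandDensity.indicator measurableSet_Ioo).comp (by fun_prop)).mul hf
  have hb : ∀ u ∈ Ioi (0 : ℝ), |g u - (-Real.log τ * f u + Real.log (16 / u) * f u)|
      ≤ 8 * Real.sqrt τ * (Real.sqrt u * |f u|) := by
    intro u hu
    have h0 : 0 < u := hu
    have h := abs_indicator_bandDensity_sub_log_le (mul_pos hτ h0)
    have e : Real.log (16 / (τ * u)) = -Real.log τ + Real.log (16 / u) := by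
      rw [Real.log_div (by norm_num) (by positivity), Real.log_div (by norm_num) h0.ne',
        Real.log_mul hτ.ne' h0.ne']; ring
    rw [e, Real.sqrt_mul hτ.le] at h
    have : g u - (-Real.log τ * f u + Real.log (16 / u) * f u)
        = ((Ioo (0 : ℝ) 4).indicator bandDensity (τ * u) - (-Real.log τ + Real.log (16 / u))) * f u := by
      rw [hg]; ring
    rw [this, abs_mul]
    calc _ ≤ 8 * (Real.sqrt τ * Real.sqrt u) * |f u| := by gcongr
      _ = _ := by ring
  have i6 : IntegrableOn (fun u => g u - (-Real.log τ * f u + Real.log (16 / u) * f u)) (Ioi 0) := by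
    refine (i3.const_mul (8 * Real.sqrt τ)).mono'
      (hgm.aestronglyMeasurable.sub i4.aestronglyMeasurable) ?_
    filter_upwards [ae_restrict_mem measurableSet_Ioi] with u hu using hb u hu
  have i5 : IntegrableOn g (Ioi 0) := by
    have := i6.add i4
    refine this.congr (Eventually.of_forall fun u => ?_)
    simp
  have hset : ∫ u in Ioo (0 : ℝ) (4 / τ), bandDensity (τ * u) * f u = ∫ u in Ioi (0 : ℝ), g u := by
    have hsub : Ioo (0 : ℝ) (4 / τ) ⊆ Ioi 0 := fun u hu => hu.1
    have e : ∀ u ∈ Ioi (0 : ℝ),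
        g u = (Ioo (0 : ℝ) (4 / τ)).indicator (fun u => bandDensity (τ * u) * f u) u := by
      intro u hu
      have h0 : 0 < u := hu
      by_cases h : u < 4 / τ
      · have h' : τ * u < 4 := by rw [lt_div_iff₀ hτ] at h; linarith
        have hm : u ∈ Ioo (0 : ℝ) (4 / τ) := ⟨h0, h⟩
        have hm' : τ * u ∈ Ioo (0 : ℝ) 4 := ⟨by positivity, h'⟩
        rw [indicator_of_mem hm, hg]
        simp only
        rw [indicator_of_mem hm']
      · have h' : ¬ τ * u < 4 := by rw [lt_div_iff₀ hτ] at h; linarith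
        rw [indicator_of_notMem (fun k => h k.2), hg]
        simp only
        rw [indicator_of_notMem (fun k => h' k.2), zero_mul]
    rw [setIntegral_congr_fun measurableSet_Ioi e, setIntegral_indicator measurableSet_Ioo,
      inter_eq_self_of_subset_right hsub]
  rw [hset, ← integral_const_mul, ← integral_add (i1.const_mul _) i2, ← integral_sub i5 i4,
    ← integral_const_mul, ← Real.norm_eq_abs]
  apply norm_integral_le_of_norm_le (i3.const_mul _)
  filter_upwards [ae_restrict_mem measurableSet_Ioi] with u hu using hb u hu

/-! ### Existence of solutions and asymptotics of the Néel temperature -/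

theorem integrableOn_bandDensity_comp_mul {τ : ℝ} (hτ : 0 < τ) :
    IntegrableOn (fun u => bandDensity (τ * u)) (Ioo 0 (4 / τ)) := by
  have himg : (fun b : ℝ => τ * b) '' Ioo 0 (4 / τ) = Ioo 0 4 := by
    rw [image_mul_left_Ioo hτ, mul_zero, mul_div_cancel₀ _ hτ.ne']
  have h := integrableOn_image_iff_integrableOn_abs_deriv_smul
    (s := Ioo (0 : ℝ) (4 / τ)) (f := fun t => τ * t)
    (f' := fun _ => τ) measurableSet_Ioo
    (fun t _ => by simpa using ((hasDerivAt_id t).const_mul τ).hasDerivWithinAt)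
    (fun x _ y _ hxy => mul_left_cancel₀ hτ.ne' hxy) bandDensity
  rw [himg] at h
  have h2 := (h.1 integrableOn_bandDensity).const_mul τ⁻¹
  refine IntegrableOn.congr_fun h2 (fun u _ => ?_) measurableSet_Ioo
  simp only [smul_eq_mul, abs_of_pos hτ]
  field_simp

theorem integrableOn_bandDensity_comp_mul_mul {φ : ℝ → ℝ} {C τ : ℝ} (hτ : 0 < τ) (hφ : Measurable φ)
    (hb : ∀ u, 0 < u → |φ u| ≤ C) :
    IntegrableOn (fun u => bandDensity (τ * u) * φ u) (Ioo 0 (4 / τ)) := by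
  refine ((integrableOn_bandDensity_comp_mul hτ).mul_const C).mono'
    ((measurable_bandDensity.comp (by fun_prop : Measurable fun u : ℝ => τ * u)).mul
      hφ).aestronglyMeasurable ?_
  filter_upwards [ae_restrict_mem measurableSet_Ioo] with u hu
  rw [Real.norm_eq_abs, abs_mul, abs_of_nonneg (bandDensity_nonneg _)]
  exact mul_le_mul_of_nonneg_left (hb u hu.1) (bandDensity_nonneg _)

/-- `tanh (u / 2) / u`, with its tail `1 / u` removed. -/
def tanhCore (u : ℝ) : ℝ := gapKernel 1 u - (Ioi (1 : ℝ)).indicator (fun u => 1 / u) u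

theorem measurable_indicator_inv : Measurable ((Ioi (1 : ℝ)).indicator fun u : ℝ => 1 / u) :=
  Measurable.indicator (by fun_prop) measurableSet_Ioi

theorem measurable_tanhCore : Measurable tanhCore :=
  (measurable_gapKernel 1).sub measurable_indicator_inv

theorem abs_tanhCore_le {u : ℝ} (hu : 0 < u) : |tanhCore u| ≤ 4 * decay u := by
  have k0 := gapKernel_nonneg zero_le_one hu.le
  unfold tanhCore decay
  rcases le_or_gt u 1 with h | h
  · have k1 := gapKernel_le one_pos hu.le
    have hu1 : 1 ≤ 1 / u ^ 3 := by
      rw [le_div_iff₀ (by positivity), one_mul]; exact pow_le_one₀ hu.le h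
    have hm : u ∉ Ioi (1 : ℝ) := not_lt.2 h
    rw [indicator_of_notMem hm, min_eq_left hu1, sub_zero, abs_of_nonneg k0]
    linarith
  · have k1 := gapKernel_le_inv (T := 1) hu.le
    have k2 := one_div_sub_gapKernel_le zero_le_one hu
    have hm : u ∈ Ioi (1 : ℝ) := h
    have hu1 : 1 / u ^ 3 ≤ 1 := by
      rw [div_le_one (by positivity)]; exact one_le_pow₀ h.le
    rw [indicator_of_mem hm, min_eq_right hu1, abs_sub_comm, abs_of_nonneg (by linarith)]
    refine k2.trans (le_of_eq (by ring))

theorem integral_log_div {τ : ℝ} (h0 : 0 < τ) (h1 : τ ≤ 1) :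
    ∫ u in Ioo 1 (4 / τ), Real.log (16 / (τ * u)) / u
      = Real.log (16 / τ) ^ 2 / 2 - Real.log 4 ^ 2 / 2 := by
  have h4 : 1 ≤ 4 / τ := by rw [le_div_iff₀ h0]; linarith
  have hd : ∀ u : ℝ, 0 < u → HasDerivAt (fun u => -(Real.log (16 / (τ * u)) ^ 2 / 2))
      (Real.log (16 / (τ * u)) / u) u := by
    intro u hu
    have ha : HasDerivAt (fun u => 16 / (τ * u)) (-(16 / (τ * u ^ 2))) u := by
      refine (((hasDerivAt_id u).const_mul τ).inv (by simp; exact ⟨h0.ne', hu.ne'⟩)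
        |>.const_mul 16).congr_deriv ?_
      simp; field_simp
    have hb := ((ha.log (by positivity)).pow 2).div_const 2 |>.neg
    refine hb.congr_deriv ?_
    field_simp; simp
  have hc : ContinuousOn (fun u => Real.log (16 / (τ * u)) / u) (uIcc 1 (4 / τ)) := by
    rw [uIcc_of_le h4]
    intro u hu
    have hu0 : 0 < u := one_pos.trans_le hu.1
    apply ContinuousAt.continuousWithinAt
    apply ContinuousAt.div _ continuousAt_id hu0.ne'
    apply ContinuousAt.log _ (by positivity)
    exact continuousAt_const.div (by fun_prop) (by positivity)
  have hv := intervalIntegral.integral_eq_sub_of_hasDerivAt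
    (fun u hu => hd u (one_pos.trans_le (by rw [uIcc_of_le h4] at hu; exact hu.1)))
    hc.intervalIntegrable
  rw [intervalIntegral.integral_of_le h4, integral_Ioc_eq_integral_Ioo] at hv
  rw [hv, mul_div_cancel₀ _ h0.ne', mul_one]
  norm_num
  ring

theorem integral_one_div_sqrt_Ioo {b : ℝ} (hb : 1 ≤ b) :
    IntegrableOn (fun u => 1 / Real.sqrt u) (Ioo 1 b) ∧
      ∫ u in Ioo 1 b, 1 / Real.sqrt u = 2 * Real.sqrt b - 2 := by
  have hc : ContinuousOn (fun u => 1 / Real.sqrt u) (uIcc 1 b) := by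
    rw [uIcc_of_le hb]
    intro u hu
    apply ContinuousAt.continuousWithinAt
    exact continuousAt_const.div (by fun_prop) (Real.sqrt_pos.2 (one_pos.trans_le hu.1)).ne'
  have hv := intervalIntegral.integral_eq_sub_of_hasDerivAt (f := fun u => 2 * Real.sqrt u)
    (fun u hu => by
      rw [uIcc_of_le hb] at hu
      exact ((Real.hasDerivAt_sqrt (one_pos.trans_le hu.1).ne').const_mul 2).congr_deriv
        (by field_simp))
    hc.intervalIntegrable
  have hi := hc.intervalIntegrable (μ := volume)
  rw [intervalIntegral.integral_of_le hb, integral_Ioc_eq_integral_Ioo] at hv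
  rw [intervalIntegrable_iff_integrableOn_Ioo_of_le hb] at hi
  exact ⟨hi, by simpa using hv⟩

/-- The leading behaviour `(log T)² / 2` of the gap integral as `T ↓ 0`. -/
theorem exists_abs_bandGap_zero_sub_le : ∃ C, 0 ≤ C ∧ ∀ τ : ℝ, 0 < τ → τ ≤ 1 →
    |bandGap 0 τ - Real.log τ ^ 2 / 2| ≤ C * (1 + -Real.log τ) := by
  set A₀ := ∫ u in Ioi (0 : ℝ), tanhCore u with hA₀
  set A₁ := ∫ u in Ioi (0 : ℝ), Real.log (16 / u) * tanhCore u with hA₁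
  set A₂ := ∫ u in Ioi (0 : ℝ), Real.sqrt u * |tanhCore u| with hA₂
  have hA₂0 : 0 ≤ A₂ := setIntegral_nonneg measurableSet_Ioi fun u _ => by positivity
  have h16 : 0 ≤ Real.log 16 := Real.log_nonneg (by norm_num)
  refine ⟨|A₀| + |A₁| + 8 * A₂ + Real.log 16 + Real.log 16 ^ 2 + Real.log 4 ^ 2 + 32,
    by positivity, fun τ h0 h1 => ?_⟩
  have h4 : 1 ≤ 4 / τ := by rw [le_div_iff₀ h0]; linarith
  have hL : 0 ≤ -Real.log τ := by have := Real.log_nonpos h0.le h1; linarith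
  have hdm : Measurable fun u => bandDensity (τ * u) :=
    measurable_bandDensity.comp (by fun_prop)
  have i1 := integrableOn_bandDensity_comp_mul_mul (C := 4) h0 measurable_tanhCore fun u hu => (abs_tanhCore_le hu).trans (by
    have : decay u ≤ 1 := min_le_left _ _
    linarith)
  have i2 := integrableOn_bandDensity_comp_mul_mul (C := 1) h0 measurable_indicator_inv
    fun u hu => by
      by_cases h : u ∈ Ioi (1 : ℝ)
      · have h' : 1 < u := h
        rw [indicator_of_mem h, abs_of_pos (by positivity), div_le_one hu]
        exact h'.le
      · rw [indicator_of_notMem h]; simp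
  -- separate the tail `1 / u` of the kernel
  have e1 : bandGap 0 τ = (∫ u in Ioo (0 : ℝ) (4 / τ), bandDensity (τ * u) * tanhCore u)
      + ∫ u in Ioo 1 (4 / τ), bandDensity (τ * u) / u := by
    have h := bandGap_mul h0 0 1
    rw [zero_mul, one_mul] at h
    have hsub : Ioo 0 (4 / τ) ∩ Ioi 1 = Ioo 1 (4 / τ) := by
      ext u
      simp only [mem_inter_iff, mem_Ioo, mem_Ioi]
      constructor
      · rintro ⟨⟨_, b⟩, c⟩; exact ⟨c, b⟩
      · rintro ⟨c, b⟩; exact ⟨⟨by linarith, b⟩, c⟩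
    have h3 : ∫ u in Ioo 1 (4 / τ), bandDensity (τ * u) / u = ∫ u in Ioo 0 (4 / τ),
        bandDensity (τ * u) * (Ioi (1 : ℝ)).indicator (fun u : ℝ => 1 / u) u := by
      rw [← hsub, ← setIntegral_indicator measurableSet_Ioi]
      refine setIntegral_congr_fun measurableSet_Ioo fun u _ => ?_
      by_cases hu : u ∈ Ioi (1 : ℝ)
      · simp only [indicator_of_mem hu]; ring
      · simp only [indicator_of_notMem hu]; ring
    rw [h, h3, ← integral_add i1 i2]
    refine setIntegral_congr_fun measurableSet_Ioo fun u hu => ?_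
    simp only [tanhCore]
    rw [zero_pow two_ne_zero, zero_add, Real.sqrt_sq hu.1.le]
    ring
  have e2 := abs_integral_bandDensity_sub_le measurable_tanhCore (fun u hu => abs_tanhCore_le hu) h0
  rw [← hA₀, ← hA₁, ← hA₂] at e2
  -- the tail
  obtain ⟨hsi, hsv⟩ := integral_one_div_sqrt_Ioo h4
  have hlogc : IntegrableOn (fun u => Real.log (16 / (τ * u)) / u) (Ioo 1 (4 / τ)) := by
    have hc : ContinuousOn (fun u => Real.log (16 / (τ * u)) / u) (Icc 1 (4 / τ)) := by
      intro u hu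
      have hu0 : 0 < u := one_pos.trans_le hu.1
      apply ContinuousAt.continuousWithinAt
      apply ContinuousAt.div _ continuousAt_id hu0.ne'
      apply ContinuousAt.log _ (by positivity)
      exact continuousAt_const.div (by fun_prop) (by positivity)
    exact hc.integrableOn_Icc.mono_set Ioo_subset_Icc_self
  have hb : ∀ u ∈ Ioo 1 (4 / τ), |bandDensity (τ * u) / u - Real.log (16 / (τ * u)) / u|
      ≤ 8 * Real.sqrt τ * (1 / Real.sqrt u) := by
    intro u hu
    have hu0 : 0 < u := one_pos.trans hu.1
    have h := abs_bandDensity_sub_log_le (mul_pos h0 hu0)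
      (by have := hu.2; rw [lt_div_iff₀ h0] at this; linarith)
    rw [Real.sqrt_mul h0.le] at h
    have hs := Real.sqrt_pos.2 hu0
    rw [← sub_div, abs_div, abs_of_pos hu0, div_le_iff₀ hu0]
    refine h.trans (le_of_eq ?_)
    conv_rhs => rw [← Real.sq_sqrt hu0.le]
    rw [Real.sqrt_sq hs.le]
    field_simp
  have hdiv : IntegrableOn (fun u => bandDensity (τ * u) / u) (Ioo 1 (4 / τ)) := by
    have : IntegrableOn (fun u => bandDensity (τ * u) / u - Real.log (16 / (τ * u)) / u)
        (Ioo 1 (4 / τ)) := by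
      refine (hsi.const_mul (8 * Real.sqrt τ)).mono'
        ((hdm.div measurable_id).aestronglyMeasurable.sub hlogc.aestronglyMeasurable) ?_
      filter_upwards [ae_restrict_mem measurableSet_Ioo] with u hu using hb u hu
    refine (this.add hlogc).congr (Eventually.of_forall fun u => ?_)
    simp
  have e3 : |(∫ u in Ioo 1 (4 / τ), bandDensity (τ * u) / u)
      - (Real.log (16 / τ) ^ 2 / 2 - Real.log 4 ^ 2 / 2)| ≤ 32 := by
    rw [← integral_log_div h0 h1, ← integral_sub hdiv hlogc]
    have : ∫ u in Ioo 1 (4 / τ), 8 * Real.sqrt τ * (1 / Real.sqrt u) ≤ 32 := by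
      rw [integral_const_mul, hsv]
      have : Real.sqrt τ * Real.sqrt (4 / τ) = 2 := by
        rw [← Real.sqrt_mul h0.le, mul_div_cancel₀ _ h0.ne', show (4 : ℝ) = 2 ^ 2 by norm_num,
          Real.sqrt_sq two_pos.le]
      nlinarith [Real.sqrt_nonneg τ]
    refine le_trans ?_ this
    rw [← Real.norm_eq_abs]
    apply norm_integral_le_of_norm_le (hsi.const_mul _)
    filter_upwards [ae_restrict_mem measurableSet_Ioo] with u hu using hb u hu
  rw [Real.log_div (by norm_num) h0.ne'] at e3
  have e4 : Real.sqrt τ ≤ 1 := Real.sqrt_le_one.2 h1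
  have e5 : 8 * Real.sqrt τ * A₂ ≤ 8 * A₂ := by nlinarith
  rw [e1]
  set L := -Real.log τ with hLdef
  have hLt : Real.log τ = -L := by rw [hLdef]; ring
  rw [hLt] at e3 ⊢
  have a0 := abs_le.1 (le_refl |A₀|)
  have a1 := abs_le.1 (le_refl |A₁|)
  have b0 : L * A₀ ≤ |A₀| * L := by nlinarith
  have b1 : -(|A₀| * L) ≤ L * A₀ := by nlinarith
  have c1 : 0 ≤ |A₁| * L := by positivity
  have c2 : 0 ≤ A₂ * L := by positivity
  have c3 : 0 ≤ Real.log 16 ^ 2 * L := by positivity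
  have c4 : 0 ≤ Real.log 4 ^ 2 * L := by positivity
  have c5 : 0 ≤ Real.log 16 * L := by positivity
  have c6 := abs_nonneg A₀
  have c7 := sq_nonneg (Real.log 16)
  have c8 := sq_nonneg (Real.log 4)
  rw [abs_le] at e2 e3 ⊢
  constructor <;> nlinarith

/-- The gap integral with order parameter zero diverges as the temperature tends to zero. -/
theorem exists_lt_bandGap (A : ℝ) : ∃ δ : ℝ, 0 < δ ∧ ∀ τ, 0 < τ → τ ≤ δ → A < bandGap 0 τ := by
  obtain ⟨C, hC0, hC⟩ := exists_abs_bandGap_zero_sub_le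
  set M := 4 * (C + |A| + 1) with hM
  have hM0 : 0 < M := by positivity
  refine ⟨Real.exp (-M), Real.exp_pos _, fun τ h0 h1 => ?_⟩
  have hL : M ≤ -Real.log τ := by
    have := Real.log_le_log h0 h1
    rw [Real.log_exp] at this; linarith
  have h := (abs_le.1 (hC τ h0 (h1.trans (Real.exp_le_one_iff.2 (by linarith))))).1
  set L := -Real.log τ with hLd
  have e : Real.log τ ^ 2 = L ^ 2 := by rw [hLd]; ring
  rw [e] at h
  have := le_abs_self A
  have hA := abs_nonneg A
  nlinarith

/-- An order parameter `x` cuts off the integral at zero temperature as a temperature `x` does at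
order parameter zero, up to a factor of `2`. -/
theorem half_bandGap_le_bandGap_zero_right {x : ℝ} (hx : 0 < x) :
    bandGap 0 x / 2 ≤ bandGap x 0 := by
  rw [bandGap, bandGap, ← integral_div]
  apply setIntegral_mono_on ((integrableOn_bandGap hx.le (Or.inr hx)).div_const 2)
    (integrableOn_bandGap le_rfl (Or.inl hx)) measurableSet_Ioo
  intro ε hε
  have h0 := hε.1
  have hE := sqrt_pos_of_pos_right x h0
  rw [mul_div_assoc]
  apply mul_le_mul_of_nonneg_left _ (bandDensity_nonneg ε)
  rw [zero_pow two_ne_zero, zero_add, Real.sqrt_sq h0.le, gapKernel_zero_left, div_le_iff₀ two_pos]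
  have k1 := gapKernel_le (T := x) hx h0.le
  have k2 := gapKernel_le_inv (T := x) h0.le
  rcases le_total x ε with h | h
  · refine k2.trans ?_
    rw [one_div_mul_eq_div, div_le_div_iff₀ h0 hE, one_mul]
    rw [Real.sqrt_le_left (by positivity)]
    nlinarith
  · refine k1.trans ?_
    rw [one_div_mul_eq_div, div_le_div_iff₀ (by positivity) hE, one_mul]
    rw [Real.sqrt_le_left (by positivity)]
    nlinarith

theorem existsUnique_neel {U : ℝ} (hU : 0 < U) : ∃! T : ℝ, 0 < T ∧ NeelEquation U 0 T := by
  have hA : 0 < 2 * Real.pi ^ 2 / U := by have := Real.pi_pos; positivity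
  obtain ⟨δ, hδ, hlow⟩ := exists_lt_bandGap (2 * Real.pi ^ 2 / U)
  obtain ⟨X, hX, hhigh⟩ := (exists_bandGap_lt hA).2
  have hm : 0 < max δ X := lt_max_of_lt_left hδ
  have hcont : ContinuousOn (fun T => bandGap 0 T) (Icc δ (max δ X)) := fun T hT =>
    (continuousAt_bandGap_zero (hδ.trans_le hT.1)).continuousWithinAt
  obtain ⟨T, hT, hTe⟩ := intermediate_value_Icc' (le_max_left δ X) hcont
    ⟨(hhigh _ (le_max_right δ X)).le, (hlow δ hδ le_rfl).le⟩
  have hT0 := hδ.trans_le hT.1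
  refine ⟨T, ⟨hT0, (neelEquation_iff hU hT0).2 hTe⟩, ?_⟩
  rintro T' ⟨hT'0, hT'⟩
  rw [neelEquation_iff hU hT'0] at hT'
  have hTe' : bandGap 0 T = 2 * Real.pi ^ 2 / U := hTe
  rcases lt_trichotomy T T' with h | h | h
  · have := bandGap_zero_lt_of_lt hT0 h; linarith
  · exact h.symm
  · have := bandGap_zero_lt_of_lt hT'0 h; linarith

theorem neelTemperature_spec {U : ℝ} (hU : 0 < U) :
    0 < neelTemperature U 0 ∧ bandGap 0 (neelTemperature U 0) = 2 * Real.pi ^ 2 / U := by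
  have h := (existsUnique_neel hU).exists
  have hs := h.choose_spec
  have e : neelTemperature U 0 = h.choose := by rw [neelTemperature, dif_pos h]
  rw [e]
  exact ⟨hs.1, (neelEquation_iff hU hs.1).1 hs.2⟩

theorem existsUnique_orderParameter {U T : ℝ} (hU : 0 < U) (hT : 0 ≤ T)
    (hTN : T < neelTemperature U 0) : ∃! Δ : ℝ, 0 < Δ ∧ MeanFieldEquation U 0 T Δ := by
  have hA : 0 < 2 * Real.pi ^ 2 / U := by have := Real.pi_pos; positivity
  obtain ⟨hN0, hN⟩ := neelTemperature_spec hU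
  obtain ⟨X, hX, hhigh⟩ := (exists_bandGap_lt hA).1
  have hlow : ∃ δ, 0 ≤ δ ∧ (0 < δ ∨ 0 < T) ∧ 2 * Real.pi ^ 2 / U < bandGap δ T := by
    rcases hT.eq_or_lt with rfl | hT'
    · obtain ⟨δ, hδ, h⟩ := exists_lt_bandGap (2 * (2 * Real.pi ^ 2 / U))
      refine ⟨δ, hδ.le, Or.inl hδ, ?_⟩
      have h1 := h δ hδ le_rfl
      have h2 := half_bandGap_le_bandGap_zero_right hδ
      linarith
    · exact ⟨0, le_rfl, Or.inr hT', by rw [← hN]; exact bandGap_zero_lt_of_lt hT' hTN⟩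
  obtain ⟨δ, hδ, hor, hδA⟩ := hlow
  have hcont : ContinuousOn (fun x => bandGap x T) (Icc δ (max δ X)) := fun x hx =>
    (continuousAt_bandGap_left hT (hor.imp_left fun h => h.trans_le hx.1)).continuousWithinAt
  obtain ⟨x, hx, hxe⟩ := intermediate_value_Icc' (le_max_left δ X) hcont
    ⟨(hhigh _ T (le_max_right δ X) hT).le, hδA.le⟩
  have hxe' : bandGap x T = 2 * Real.pi ^ 2 / U := hxe
  have hx0 : 0 < x := by
    refine lt_of_le_of_ne (hδ.trans hx.1) ?_
    rintro rfl
    have : δ = 0 := le_antisymm hx.1 hδ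
    rw [this] at hδA
    linarith
  refine ⟨x, ⟨hx0, (meanFieldEquation_iff hU hx0).2 hxe'⟩, ?_⟩
  rintro x' ⟨hx'0, hx'⟩
  rw [meanFieldEquation_iff hU hx'0] at hx'
  rcases lt_trichotomy x x' with h | h | h
  · have := bandGap_lt_of_lt hT hx0.le (Or.inl hx0) h; linarith
  · exact h.symm
  · have := bandGap_lt_of_lt hT hx'0.le (Or.inl hx'0) h; linarith

theorem orderParameter_spec {U T : ℝ} (hU : 0 < U) (hT : 0 ≤ T) (hTN : T < neelTemperature U 0) :
    0 < orderParameter U 0 T ∧ bandGap (orderParameter U 0 T) T = 2 * Real.pi ^ 2 / U := by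
  have h := (existsUnique_orderParameter hU hT hTN).exists
  have hs := h.choose_spec
  have e : orderParameter U 0 T = h.choose := by rw [orderParameter, dif_pos h]
  rw [e]
  exact ⟨hs.1, (meanFieldEquation_iff hU hs.1).1 hs.2⟩

/-- Asymptotics of the Néel temperature: `1 / log (1 / T_N) = √U / 2π + O(U)`. -/
theorem exists_neelTemperature_asymptotics : ∃ C U₀ : ℝ, 0 ≤ C ∧ 0 < U₀ ∧ ∀ U, 0 < U → U < U₀ →
    1 ≤ -Real.log (neelTemperature U 0) ∧
    |1 / -Real.log (neelTemperature U 0) - Real.sqrt U / (2 * Real.pi)| ≤ C * U := by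
  have hpi := Real.pi_pos
  obtain ⟨C, hC0, hC⟩ := exists_abs_bandGap_zero_sub_le
  set B := bandGap 0 (Real.exp (-1)) with hB
  refine ⟨8 * C, min (2 * Real.pi ^ 2 / (|B| + 1)) (4 * Real.pi ^ 2 / (8 * C + 1) ^ 2),
    by positivity, by positivity, fun U hU hU0 => ?_⟩
  have hU1 := hU0.trans_le (min_le_left _ _)
  have hU2 := hU0.trans_le (min_le_right _ _)
  obtain ⟨hN0, hN⟩ := neelTemperature_spec hU
  set τ := neelTemperature U 0 with hτ
  have hBU : B < 2 * Real.pi ^ 2 / U := by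
    rw [lt_div_iff₀ (by positivity)] at hU1
    rw [lt_div_iff₀ hU]
    nlinarith [le_abs_self B]
  have hτ1 : τ < Real.exp (-1) := by
    by_contra h
    rcases (not_lt.1 h).eq_or_lt with h | h
    · rw [← h, ← hB] at hN; linarith
    · have := bandGap_zero_lt_of_lt (Real.exp_pos _) h
      rw [hN, ← hB] at this; linarith
  have hL1 : 1 ≤ -Real.log τ := by
    have := Real.log_le_log hN0 hτ1.le
    rw [Real.log_exp] at this; linarith
  have h := hC τ hN0 (hτ1.le.trans (Real.exp_le_one_iff.2 (by norm_num)))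
  set L := -Real.log τ with hLd
  refine ⟨hL1, ?_⟩
  have e : Real.log τ ^ 2 = L ^ 2 := by rw [hLd]; ring
  have hsU := Real.sqrt_pos.2 hU
  have hsq := Real.sq_sqrt hU.le
  set s := 2 * Real.pi / Real.sqrt U with hs
  have hs0 : 0 < s := by positivity
  have hs2 : 2 * Real.pi ^ 2 / U = s ^ 2 / 2 := by
    rw [hs, div_pow, hsq]; ring
  rw [hN, e, hs2] at h
  have hsL : |s - L| ≤ 4 * C := by
    have h1 : |s - L| * (s + L) ≤ 4 * C * L := by
      rw [← abs_of_pos (show 0 < s + L by linarith), ← abs_mul]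
      calc _ = 2 * |s ^ 2 / 2 - L ^ 2 / 2| := by
            rw [← abs_of_pos (two_pos (α := ℝ)), ← abs_mul]; congr 1; simp; ring
        _ ≤ 2 * (C * (1 + L)) := by linarith
        _ ≤ _ := by nlinarith
    have h2 : |s - L| * (s + L) ≤ 4 * C * (s + L) := h1.trans (by nlinarith)
    exact le_of_mul_le_mul_right h2 (by linarith)
  have hs8 : 8 * C ≤ s := by
    rw [hs, le_div_iff₀ hsU]
    have : Real.sqrt U ≤ 2 * Real.pi / (8 * C + 1) := by
      apply Real.sqrt_le_iff.2
      refine ⟨by positivity, hU2.le.trans (le_of_eq ?_)⟩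
      rw [div_pow]; ring
    rw [le_div_iff₀ (by positivity)] at this
    nlinarith
  have hLs : s / 2 ≤ L := by
    have := (abs_le.1 hsL).2; linarith
  have e1 : Real.sqrt U / (2 * Real.pi) = 1 / s := by rw [hs]; field_simp
  have hL0 : 0 < L := by linarith
  rw [e1, div_sub_div _ _ hL0.ne' hs0.ne', abs_div, abs_of_pos (mul_pos hL0 hs0), one_mul, mul_one,
    div_le_iff₀ (by positivity)]
  refine hsL.trans ?_
  have hUs : U * s ^ 2 = 4 * Real.pi ^ 2 := by
    rw [hs, div_pow, hsq]; field_simp; norm_num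
  have hpi3 := Real.pi_gt_three
  have : 1 ≤ U * (L * s) := by
    have : U * (s / 2 * s) ≤ U * (L * s) := by gcongr
    nlinarith
  nlinarith

/-! ### Closed forms at zero temperature -/

theorem log_sq_le_weight {ε : ℝ} (hε : 0 < ε) :
    Real.log ε ^ 2 ≤ 32 * (1 / Real.sqrt ε + Real.sqrt ε) := by
  have hs := Real.sqrt_pos.2 hε
  have h := abs_log_le_weight hs
  have hq := Real.sqrt_pos.2 hs
  have hq2 := Real.sq_sqrt hs.le
  rw [Real.log_sqrt hε.le, abs_le] at h
  have h2 : Real.log ε ^ 2 ≤ 16 * (1 / Real.sqrt (Real.sqrt ε) + Real.sqrt (Real.sqrt ε)) ^ 2 := by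
    nlinarith
  refine h2.trans ?_
  have e : 1 / Real.sqrt ε + Real.sqrt ε
      = (1 / Real.sqrt (Real.sqrt ε)) ^ 2 + Real.sqrt (Real.sqrt ε) ^ 2 := by
    rw [hq2, div_pow, hq2, one_pow]
  rw [e]
  nlinarith [sq_nonneg (1 / Real.sqrt (Real.sqrt ε) - Real.sqrt (Real.sqrt ε))]

theorem integrableOn_log_sq_mul {f : ℝ → ℝ} (hf : Measurable f) {C : ℝ}
    (h : ∀ ε, 0 < ε → |f ε| ≤ C * decay ε) :
    IntegrableOn (fun ε => Real.log ε ^ 2 * f ε) (Ioi 0) := by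
  have hm : Measurable fun ε : ℝ => Real.log ε ^ 2 * f ε :=
    (Real.measurable_log.pow_const 2).mul hf
  refine (integrableOn_decayWeight.const_mul (32 * C)).mono' hm.aestronglyMeasurable ?_
  filter_upwards [ae_restrict_mem measurableSet_Ioi] with ε hε
  have h1 := log_sq_le_weight hε
  have h2 := h ε hε
  have h3 := one_le_weight hε
  rw [Real.norm_eq_abs, abs_mul, abs_of_nonneg (sq_nonneg _), decayWeight]
  calc _ ≤ 32 * (1 / Real.sqrt ε + Real.sqrt ε) * (C * decay ε) := by gcongr
    _ = _ := by ring

theorem integrableOn_log_mul' {f : ℝ → ℝ} (hf : Measurable f) {C : ℝ}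
    (h : ∀ ε, 0 < ε → |f ε| ≤ C * decay ε) :
    IntegrableOn (fun ε => Real.log ε * f ε) (Ioi 0) := by
  have h1 := (integrableOn_of_abs_le_decay hf h).const_mul (Real.log 16)
  refine IntegrableOn.congr_fun (h1.sub (integrableOn_log_mul hf h)) (fun ε hε => ?_)
    measurableSet_Ioi
  have : (0 : ℝ) < ε := hε
  simp only [Pi.sub_apply]
  rw [Real.log_div (by norm_num) this.ne']
  ring

/-- The tail `1 / ε` on `(1, ∞)`, which makes the integrals below converge. -/
def invTail (ε : ℝ) : ℝ := (Ioi (1 : ℝ)).indicator (fun u => 1 / u) ε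

theorem invTail_of_le {ε : ℝ} (h : ε ≤ 1) : invTail ε = 0 :=
  indicator_of_notMem (show ε ∉ Ioi (1 : ℝ) from not_lt.2 h) _

theorem invTail_of_lt {ε : ℝ} (h : 1 < ε) : invTail ε = 1 / ε :=
  indicator_of_mem (show ε ∈ Ioi (1 : ℝ) from h) _

theorem tanhCore_eq (ε : ℝ) : tanhCore ε = Real.tanh (ε / 2) / ε - invTail ε := by
  rw [tanhCore, gapKernel_one, invTail]

theorem measurable_sqrtCore (x : ℝ) :
    Measurable fun ε : ℝ => 1 / Real.sqrt (x ^ 2 + ε ^ 2) - invTail ε :=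
  (by fun_prop : Measurable fun ε : ℝ => 1 / Real.sqrt (x ^ 2 + ε ^ 2)).sub
    measurable_indicator_inv

theorem sqrtCore_eq (x ε : ℝ) :
    1 / Real.sqrt (x ^ 2 + ε ^ 2) - invTail ε = bcsIntegrand x 0 ε + tanhCore ε := by
  rw [bcsIntegrand_eq, gapKernel_zero_left, tanhCore_eq]; ring

theorem exists_abs_sqrtCore_le {x : ℝ} (hx : 0 < x) :
    ∃ C, ∀ ε, 0 < ε → |1 / Real.sqrt (x ^ 2 + ε ^ 2) - invTail ε| ≤ C * decay ε := by
  obtain ⟨C, hC⟩ := exists_abs_bcsIntegrand_le le_rfl zero_le_one (Or.inl hx : 0 < x ∨ (0 : ℝ) < 0)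
  refine ⟨C + 4, fun ε hε => ?_⟩
  rw [sqrtCore_eq, add_mul]
  exact (abs_add_le _ _).trans (add_le_add (hC ε hε) (abs_tanhCore_le hε))

/-- Fundamental theorem of calculus on `(0, ∞)` for a function with antiderivatives that differ on
`(0, 1)` and on `(1, ∞)`. -/
theorem integral_Ioi_eq_of_hasDerivAt {f F G : ℝ → ℝ} {l : ℝ} (hf : IntegrableOn f (Ioi 0))
    (hFc : ContinuousOn F (Icc 0 1)) (hF : ∀ ε ∈ Ioo (0 : ℝ) 1, HasDerivAt F (f ε) ε)
    (hGc : ContinuousWithinAt G (Ici 1) 1)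
    (hG : ∀ ε ∈ Ioi (1 : ℝ), HasDerivAt G (f ε) ε) (hl : Tendsto G atTop (𝓝 l)) :
    ∫ ε in Ioi (0 : ℝ), f ε = F 1 - F 0 + (l - G 1) := by
  have h1 : IntegrableOn f (Ioc 0 1) := hf.mono_set Ioc_subset_Ioi_self
  have h2 : IntegrableOn f (Ioi 1) := hf.mono_set (Ioi_subset_Ioi zero_le_one)
  rw [← Ioc_union_Ioi_eq_Ioi (zero_le_one (α := ℝ)),
    setIntegral_union Ioc_disjoint_Ioi_same measurableSet_Ioi h1 h2,
    integral_Ioi_of_hasDerivAt_of_tendsto hGc hG h2 hl, ← intervalIntegral.integral_of_le zero_le_one,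
    intervalIntegral.integral_eq_sub_of_hasDerivAt_of_le zero_le_one hFc hF
      ((intervalIntegrable_iff_integrableOn_Ioc_of_le zero_le_one).2 h1)]

theorem hasDerivAt_arsinh_div {x : ℝ} (hx : 0 < x) (ε : ℝ) :
    HasDerivAt (fun ε => Real.arsinh (ε / x)) (1 / Real.sqrt (x ^ 2 + ε ^ 2)) ε := by
  refine ((Real.hasDerivAt_arsinh (ε / x)).comp ε ((hasDerivAt_id ε).div_const x)).congr_deriv ?_
  have e : x ^ 2 + ε ^ 2 = x ^ 2 * (1 + (ε / x) ^ 2) := by field_simp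
  rw [e, Real.sqrt_mul (by positivity), Real.sqrt_sq hx.le]
  have : 0 < Real.sqrt (1 + (ε / x) ^ 2) := Real.sqrt_pos.2 (by positivity)
  field_simp

/-- `arsinh (ε / x) = log (2 ε / x) + O(ε⁻²)`. -/
theorem arsinh_div_bounds {x ε : ℝ} (hx : 0 < x) (hε : 0 < ε) :
    0 ≤ Real.arsinh (ε / x) - (Real.log ε - Real.log (x / 2)) ∧
      Real.arsinh (ε / x) - (Real.log ε - Real.log (x / 2)) ≤ x ^ 2 / ε ^ 2 := by
  have e1 : Real.log ε - Real.log (x / 2) = Real.log (2 * (ε / x)) := by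
    rw [← Real.log_div hε.ne' (by positivity)]; congr 1; field_simp
  have hv : 0 < ε / x := by positivity
  have e2 : x ^ 2 / ε ^ 2 = 1 / (ε / x) ^ 2 := by field_simp
  rw [e1, e2]
  set v := ε / x
  have h0 : 0 < v + Real.sqrt (1 + v ^ 2) := by positivity
  rw [Real.arsinh, ← Real.log_div h0.ne' (by positivity)]
  have h1 : v ≤ Real.sqrt (1 + v ^ 2) := Real.le_sqrt_of_sq_le (by linarith)
  have h2 : Real.sqrt (1 + v ^ 2) ≤ v + 1 / v := by
    rw [Real.sqrt_le_left (by positivity)]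
    have : (v + 1 / v) ^ 2 = v ^ 2 + 2 + 1 / v ^ 2 := by field_simp; ring
    have : 0 < 1 / v ^ 2 := by positivity
    linarith
  constructor
  · apply Real.log_nonneg
    rw [le_div_iff₀ (by positivity)]; linarith
  · refine (Real.log_le_sub_one_of_pos (by positivity)).trans ?_
    rw [sub_le_iff_le_add, div_le_iff₀ (by positivity)]
    have : (1 / v ^ 2 + 1) * (2 * v) = 2 * v + 2 * (1 / v) := by field_simp; ring
    rw [this]
    have : 0 < 1 / v := by positivity
    linarith

theorem tendsto_arsinh_div_sub_log {x : ℝ} (hx : 0 < x) :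
    Tendsto (fun ε => Real.arsinh (ε / x) - Real.log ε) atTop (𝓝 (-Real.log (x / 2))) := by
  have h : Tendsto (fun ε => Real.arsinh (ε / x) - (Real.log ε - Real.log (x / 2))) atTop (𝓝 0) := by
    have h2 : Tendsto (fun ε : ℝ => x ^ 2 / ε ^ 2) atTop (𝓝 0) :=
      tendsto_const_nhds.div_atTop (tendsto_pow_atTop two_ne_zero)
    apply tendsto_of_tendsto_of_tendsto_of_le_of_le' tendsto_const_nhds h2
    · filter_upwards [eventually_gt_atTop 0] with ε hε using (arsinh_div_bounds hx hε).1
    · filter_upwards [eventually_gt_atTop 0] with ε hε using (arsinh_div_bounds hx hε).2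
  have h3 := h.sub_const (Real.log (x / 2))
  rw [zero_sub] at h3
  refine h3.congr fun ε => by ring

theorem integral_sqrtCore {x : ℝ} (hx : 0 < x) :
    ∫ ε in Ioi (0 : ℝ), (1 / Real.sqrt (x ^ 2 + ε ^ 2) - invTail ε) = -Real.log (x / 2) := by
  obtain ⟨C, hC⟩ := exists_abs_sqrtCore_le hx
  have hcont : Continuous fun ε => Real.arsinh (ε / x) :=
    continuous_iff_continuousAt.2 fun ε => (hasDerivAt_arsinh_div hx ε).continuousAt
  rw [integral_Ioi_eq_of_hasDerivAt (integrableOn_of_abs_le_decay (measurable_sqrtCore x) hC)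
    hcont.continuousOn (fun ε hε => by
      rw [invTail_of_le hε.2.le, sub_zero]; exact hasDerivAt_arsinh_div hx ε)
    (G := fun ε => Real.arsinh (ε / x) - Real.log ε) _ _ (tendsto_arsinh_div_sub_log hx)]
  · simp
  · exact (hcont.continuousAt.sub (Real.continuousAt_log one_ne_zero)).continuousWithinAt
  · intro ε hε
    have h1 : 1 < ε := hε
    rw [invTail_of_lt h1]
    exact ((hasDerivAt_arsinh_div hx ε).sub (Real.hasDerivAt_log (by linarith))).congr_deriv
      (by rw [one_div ε])

/-- The function `½ Li₂(e^{-2t})`, with derivative `log (1 - e^{-2t})`. -/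
def halfDilog (t : ℝ) : ℝ := ∑' n : ℕ, Real.exp (-(2 * (n + 1) * t)) / (2 * ((n : ℝ) + 1) ^ 2)

theorem hasSum_half_zeta_two :
    HasSum (fun n : ℕ => 1 / (2 * ((n : ℝ) + 1) ^ 2)) (Real.pi ^ 2 / 12) := by
  have h := (hasSum_nat_add_iff' 1).2 hasSum_zeta_two
  have h2 := h.mul_left (1 / 2)
  simp only [Finset.range_one, Finset.sum_singleton, Nat.cast_zero] at h2
  convert! h2 using 1
  · funext n
    push_cast
    rw [one_div_mul_one_div]
  · norm_num; ring

theorem halfDilog_zero : halfDilog 0 = Real.pi ^ 2 / 12 := by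
  rw [← hasSum_half_zeta_two.tsum_eq, halfDilog]
  simp

theorem halfDilog_term_le {t : ℝ} (ht : 0 ≤ t) (n : ℕ) :
    Real.exp (-(2 * (n + 1) * t)) / (2 * ((n : ℝ) + 1) ^ 2)
      ≤ Real.exp (-(2 * t)) * (1 / (2 * ((n : ℝ) + 1) ^ 2)) := by
  rw [mul_one_div]
  gcongr
  have : 0 ≤ (n : ℝ) * t := by positivity
  linarith

theorem continuousOn_halfDilog : ContinuousOn halfDilog (Ici 0) := by
  apply continuousOn_tsum (u := fun n : ℕ => 1 / (2 * ((n : ℝ) + 1) ^ 2))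
  · intro n; fun_prop
  · exact hasSum_half_zeta_two.summable
  · intro n t ht
    have ht' : (0 : ℝ) ≤ t := ht
    rw [Real.norm_of_nonneg (by positivity)]
    refine (halfDilog_term_le ht' n).trans ?_
    have : Real.exp (-(2 * t)) ≤ 1 := Real.exp_le_one_iff.2 (by linarith)
    have : 0 ≤ 1 / (2 * ((n : ℝ) + 1) ^ 2) := by positivity
    nlinarith

theorem tendsto_halfDilog : Tendsto halfDilog atTop (𝓝 0) := by
  have h : Tendsto (fun t : ℝ => Real.exp (-(2 * t)) * (Real.pi ^ 2 / 12)) atTop (𝓝 0) := by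
    have h1 : Tendsto (fun t : ℝ => Real.exp (-(2 * t))) atTop (𝓝 0) :=
      Real.tendsto_exp_neg_atTop_nhds_zero.comp (tendsto_id.const_mul_atTop two_pos)
    simpa using h1.mul_const (Real.pi ^ 2 / 12)
  apply tendsto_of_tendsto_of_tendsto_of_le_of_le' tendsto_const_nhds h
  · exact Eventually.of_forall fun t => tsum_nonneg fun n => by positivity
  · filter_upwards [eventually_ge_atTop 0] with t ht
    have hs := hasSum_half_zeta_two.mul_left (Real.exp (-(2 * t)))
    rw [← hs.tsum_eq]
    exact (Summable.of_nonneg_of_le (fun n => by positivity) (halfDilog_term_le ht)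
      hs.summable).tsum_le_tsum (halfDilog_term_le ht) hs.summable

theorem hasDerivAt_halfDilog {t : ℝ} (ht : 0 < t) :
    HasDerivAt halfDilog (Real.log (1 - Real.exp (-(2 * t)))) t := by
  have hq : |Real.exp (-(2 * t))| < 1 := by
    rw [abs_of_pos (Real.exp_pos _)]; exact Real.exp_lt_one_iff.2 (by linarith)
  have hsum := Real.hasSum_pow_div_log_of_abs_lt_one hq
  have hd := hasDerivAt_tsum_of_isPreconnected
    (u := fun n : ℕ => Real.exp (-t) ^ n)
    (g := fun (n : ℕ) t => Real.exp (-(2 * (n + 1) * t)) / (2 * ((n : ℝ) + 1) ^ 2))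
    (g' := fun (n : ℕ) t => -(Real.exp (-(2 * (n + 1) * t)) / ((n : ℝ) + 1)))
    (t := Ioi (t / 2)) (y₀ := t) (y := t)
    (summable_geometric_of_lt_one (Real.exp_pos _).le (Real.exp_lt_one_iff.2 (by linarith)))
    isOpen_Ioi isPreconnected_Ioi
    (fun n s _ => by
      have h : HasDerivAt (fun s : ℝ => -(2 * ((n : ℝ) + 1) * s)) (-(2 * ((n : ℝ) + 1))) s := by
        exact ((hasDerivAt_id s).const_mul (2 * ((n : ℝ) + 1))).neg.congr_deriv (by ring)
      refine (h.exp.div_const _).congr_deriv ?_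
      field_simp)
    (fun n s hs => by
      have hs' : t / 2 < s := hs
      rw [norm_neg, Real.norm_of_nonneg (by positivity), ← Real.exp_nat_mul]
      refine (div_le_self (Real.exp_pos _).le (by linarith [n.cast_nonneg (α := ℝ)])).trans ?_
      apply Real.exp_le_exp.2
      have : (n : ℝ) * (t / 2) ≤ n * s := by gcongr
      nlinarith)
    (half_lt_self ht)
    (Summable.of_nonneg_of_le (fun n => by positivity) (halfDilog_term_le ht.le)
      (hasSum_half_zeta_two.mul_left _).summable)
    (half_lt_self ht)
  refine HasDerivAt.congr_deriv hd ?_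
  rw [← neg_neg (Real.log _), ← hsum.tsum_eq, ← tsum_neg]
  refine tsum_congr fun n => ?_
  rw [← Real.exp_nat_mul]
  congr 3
  push_cast; ring

/-- On `(0, 1)` the substitution `ε = x sinh t` gives `log ε = t + log (x / 2) + log (1 - e^{-2t})`, so
that an antiderivative in `t` is a quadratic polynomial plus `halfDilog`. -/
theorem integral_log_mul_sqrtCore {x : ℝ} (hx : 0 < x) :
    ∫ ε in Ioi (0 : ℝ), Real.log ε * (1 / Real.sqrt (x ^ 2 + ε ^ 2) - invTail ε)
      = -(Real.log (x / 2) ^ 2 / 2) - Real.pi ^ 2 / 12 := by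
  obtain ⟨C, hC⟩ := exists_abs_sqrtCore_le hx
  set c := Real.log (x / 2) with hc
  set F : ℝ → ℝ := fun ε => Real.arsinh (ε / x) ^ 2 / 2 + Real.arsinh (ε / x) * c
    + halfDilog (Real.arsinh (ε / x)) with hF
  have hcont : Continuous fun ε => Real.arsinh (ε / x) :=
    continuous_iff_continuousAt.2 fun ε => (hasDerivAt_arsinh_div hx ε).continuousAt
  have hFc : ContinuousOn F (Ici 0) := by
    apply ContinuousOn.add (by fun_prop)
    apply continuousOn_halfDilog.comp hcont.continuousOn
    intro ε hε
    have : (0 : ℝ) ≤ ε := hε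
    exact Real.arsinh_nonneg_iff.2 (by positivity)
  have hFd : ∀ ε, 0 < ε → HasDerivAt F (Real.log ε * (1 / Real.sqrt (x ^ 2 + ε ^ 2))) ε := by
    intro ε hε
    have ht : 0 < Real.arsinh (ε / x) := Real.arsinh_pos_iff.2 (by positivity)
    have h1 := hasDerivAt_arsinh_div hx ε
    have h2 := (hasDerivAt_halfDilog ht).comp ε h1
    refine ((((h1.pow 2).div_const 2).add (h1.mul_const c)).add h2).congr_deriv ?_
    have h3 : Real.log ε = Real.arsinh (ε / x) + c
        + Real.log (1 - Real.exp (-(2 * Real.arsinh (ε / x)))) := by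
      have e : Real.sinh (Real.arsinh (ε / x)) = ε / x := Real.sinh_arsinh _
      set t := Real.arsinh (ε / x)
      have hp : 0 < 1 - Real.exp (-(2 * t)) := by
        have := Real.exp_lt_one_iff.2 (show -(2 * t) < 0 by linarith); linarith
      have h4 : ε = Real.exp t * (x / 2) * (1 - Real.exp (-(2 * t))) := by
        have : Real.exp t * Real.exp (-(2 * t)) = Real.exp (-t) := by
          rw [← Real.exp_add]; congr 1; ring
        have e' : ε = Real.sinh t * x := by rw [e]; field_simp
        rw [e', Real.sinh_eq]
        linear_combination (x / 2) * this
      conv_lhs => rw [h4]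
      rw [Real.log_mul (by positivity) hp.ne', Real.log_mul (Real.exp_pos t).ne' (by positivity),
        Real.log_exp]
    rw [h3]
    simp
    ring
  have hlim : Tendsto (fun ε => F ε - Real.log ε ^ 2 / 2) atTop (𝓝 (-(c ^ 2 / 2))) := by
    have h1 := tendsto_arsinh_div_sub_log hx
    rw [← hc] at h1
    have h0 : Tendsto (fun ε => Real.arsinh (ε / x) - (Real.log ε - c)) atTop (𝓝 0) := by
      have := h1.add_const c
      rw [neg_add_cancel] at this
      exact this.congr fun ε => by ring
    have h2 : Tendsto (fun ε => (Real.arsinh (ε / x) - (Real.log ε - c)) * Real.log ε) atTop (𝓝 0) := by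
      have h3 : Tendsto (fun ε : ℝ => x ^ 2 / ε) atTop (𝓝 0) :=
        tendsto_const_nhds.div_atTop tendsto_id
      apply tendsto_of_tendsto_of_tendsto_of_le_of_le' tendsto_const_nhds h3
      · filter_upwards [eventually_ge_atTop 1] with ε hε
        exact mul_nonneg (arsinh_div_bounds hx (by linarith)).1 (Real.log_nonneg hε)
      · filter_upwards [eventually_ge_atTop 1] with ε hε
        have hε0 : 0 < ε := by linarith
        have a1 := (arsinh_div_bounds hx hε0).2
        have a2 := Real.log_le_sub_one_of_pos hε0
        calc _ ≤ x ^ 2 / ε ^ 2 * ε := by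
              apply mul_le_mul a1 (by linarith) (Real.log_nonneg hε) (by positivity)
          _ = _ := by field_simp
    have h5 : Tendsto (fun ε => Real.arsinh (ε / x)) atTop atTop := by
      have h51 : Tendsto (fun ε => (Real.arsinh (ε / x) - Real.log ε) + Real.log ε) atTop atTop :=
        h1.add_atTop Real.tendsto_log_atTop
      exact h51.congr fun ε => by ring
    have h6 := tendsto_halfDilog.comp h5
    have h7 := ((((h0.pow 2).div_const 2).add h2).sub_const (c ^ 2 / 2)).add h6
    simp only [ne_eq, OfNat.ofNat_ne_zero, not_false_eq_true, zero_pow, zero_div, add_zero,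
      zero_sub] at h7
    refine h7.congr fun ε => ?_
    simp only [hF, Function.comp]
    ring
  rw [integral_Ioi_eq_of_hasDerivAt (integrableOn_log_mul' (measurable_sqrtCore x) hC)
    (hFc.mono Icc_subset_Ici_self) (fun ε hε => by
      rw [invTail_of_le hε.2.le, sub_zero]; exact hFd ε hε.1)
    (G := fun ε => F ε - Real.log ε ^ 2 / 2) _ _ hlim]
  · simp only [hF]
    simp [halfDilog_zero]
  · apply ContinuousAt.continuousWithinAt
    exact (hFd 1 one_pos).continuousAt.sub (((Real.continuousAt_log one_ne_zero).pow 2).div_const 2)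
  · intro ε hε
    have h1 : 1 < ε := hε
    rw [invTail_of_lt h1]
    refine ((hFd ε (by linarith)).sub (((Real.hasDerivAt_log
      (by linarith)).pow 2).div_const 2)).congr_deriv ?_
    simp
    ring

/-! ### Logarithmic moments -/

theorem tendsto_log_pow_mul_nhdsGT_zero (n : ℕ) :
    Tendsto (fun ε : ℝ => Real.log ε ^ n * ε) (𝓝[>] 0) (𝓝 0) := by
  have h := (Real.tendsto_pow_log_div_mul_add_atTop 1 0 n one_ne_zero).comp
    (tendsto_inv_nhdsGT_zero (𝕜 := ℝ))
  have h2 := h.const_mul ((-1) ^ n)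
  rw [mul_zero] at h2
  refine h2.congr fun ε => ?_
  simp only [Function.comp, one_mul, add_zero, Real.log_inv, div_inv_eq_mul]
  rw [← mul_assoc, ← mul_pow, neg_one_mul, neg_neg]

/-- Integration by parts against a power of the logarithm, for a function `S` that increases from
`0` to `1`. -/
theorem integral_log_pow_mul_core {S S' : ℝ → ℝ} (k : ℕ) {C : ℝ}
    (hS : ∀ ε, HasDerivAt S (S' ε) ε) (hS0 : S 0 = 0) (hS1 : ∀ ε, 1 ≤ ε → |S ε - 1| ≤ C / ε)
    (hi₁ : IntegrableOn (fun ε => Real.log ε ^ k * (S ε / ε - invTail ε)) (Ioi 0))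
    (hi₂ : IntegrableOn (fun ε => Real.log ε ^ (k + 1) * S' ε) (Ioi 0)) :
    ((k : ℝ) + 1) * ∫ ε in Ioi (0 : ℝ), Real.log ε ^ k * (S ε / ε - invTail ε)
      = -∫ ε in Ioi (0 : ℝ), Real.log ε ^ (k + 1) * S' ε := by
  have hd : ∀ ε : ℝ, 0 < ε →
      HasDerivAt (fun ε => Real.log ε ^ (k + 1)) (((k : ℝ) + 1) * Real.log ε ^ k / ε) ε := by
    intro ε hε
    refine ((Real.hasDerivAt_log hε.ne').pow (k + 1)).congr_deriv ?_
    push_cast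
    ring
  have h := integral_Ioi_eq_of_hasDerivAt (l := 0)
    (f := fun ε => ((k : ℝ) + 1) * (Real.log ε ^ k * (S ε / ε - invTail ε))
      + Real.log ε ^ (k + 1) * S' ε)
    (F := fun ε => Real.log ε ^ (k + 1) * S ε) (G := fun ε => Real.log ε ^ (k + 1) * (S ε - 1))
    ((hi₁.const_mul _).add hi₂) ?_ ?_ ?_ ?_ ?_
  · rw [integral_add (hi₁.const_mul _) hi₂, integral_const_mul] at h
    simp at h
    linarith
  · intro ε hε
    rcases hε.1.eq_or_lt with h0 | h0
    · rw [← h0]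
      have h1 : Tendsto (fun ε => Real.log ε ^ (k + 1) * S ε) (𝓝[>] 0) (𝓝 0) := by
        have hO : S =O[𝓝[>] 0] fun ε => ε := by
          have := (hS 0).isBigO_sub
          simp only [hS0, sub_zero] at this
          exact this.mono nhdsWithin_le_nhds
        exact ((isBigO_refl (fun ε => Real.log ε ^ (k + 1)) _).mul hO).trans_tendsto
          (tendsto_log_pow_mul_nhdsGT_zero (k + 1))
      have h2 : ContinuousWithinAt (fun ε => Real.log ε ^ (k + 1) * S ε) (Ioi 0) 0 := by
        rw [ContinuousWithinAt]; simpa using h1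
      refine (continuousWithinAt_insert_self.2 h2).mono ?_
      intro x hx
      rcases hx.1.eq_or_lt with h | h
      · exact Or.inl h.symm
      · exact Or.inr h
    · exact ((hd ε h0).continuousAt.mul (hS ε).continuousAt).continuousWithinAt
  · intro ε hε
    simp only [invTail_of_le hε.2.le, sub_zero]
    exact ((hd ε hε.1).mul (hS ε)).congr_deriv (by ring)
  · exact ((hd 1 one_pos).continuousAt.mul ((hS 1).continuousAt.sub_const 1)).continuousWithinAt
  · intro ε hε
    have h1 : 1 < ε := hε
    simp only [invTail_of_lt h1]
    exact ((hd ε (by linarith)).mul ((hS ε).sub_const 1)).congr_deriv (by ring)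
  · have h1 := (Real.tendsto_pow_log_div_mul_add_atTop 1 0 (k + 1) one_ne_zero).const_mul C
    rw [mul_zero] at h1
    apply squeeze_zero_norm' _ h1
    filter_upwards [eventually_ge_atTop 1] with ε hε
    have h2 : 0 ≤ Real.log ε ^ (k + 1) := pow_nonneg (Real.log_nonneg hε) _
    rw [Real.norm_eq_abs, abs_mul, abs_of_nonneg h2]
    calc _ ≤ Real.log ε ^ (k + 1) * (C / ε) := by gcongr; exact hS1 ε hε
      _ = _ := by rw [one_mul, add_zero]; ring

theorem exp_neg_le_decay {ε : ℝ} (hε : 0 < ε) : Real.exp (-ε) ≤ 6 * decay ε := by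
  have h1 : Real.exp (-ε) ≤ 1 := Real.exp_le_one_iff.2 (by linarith)
  have h2 : Real.exp (-ε) ≤ 6 * (1 / ε ^ 3) := by
    rw [Real.exp_neg, inv_eq_one_div, mul_one_div, div_le_div_iff₀ (Real.exp_pos _) (by positivity)]
    have := Real.pow_div_factorial_le_exp ε hε.le 3
    have h6 : (Nat.factorial 3 : ℝ) = 6 := by norm_num [Nat.factorial]
    rw [h6, div_le_iff₀ (by norm_num)] at this
    linarith
  unfold decay
  rcases le_total 1 (1 / ε ^ 3) with h | h
  · rw [min_eq_left h]; linarith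
  · rw [min_eq_right h]; exact h2

theorem abs_exp_neg_le_decay {ε : ℝ} (hε : 0 < ε) : |Real.exp (-ε)| ≤ 6 * decay ε := by
  rw [abs_of_pos (Real.exp_pos _)]; exact exp_neg_le_decay hε

theorem measurable_exp_neg : Measurable fun ε : ℝ => Real.exp (-ε) := by fun_prop

/-- The first logarithmic moment of the exponential distribution. -/
theorem integral_log_mul_exp_neg :
    ∫ ε in Ioi (0 : ℝ), Real.log ε * Real.exp (-ε) = -Real.eulerMascheroniConstant := by
  have h1 := Complex.hasDerivAt_GammaIntegral (s := 1) (by simp)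
  have h2 : Complex.GammaIntegral =ᶠ[𝓝 1] Complex.Gamma := by
    have : {s : ℂ | 0 < s.re} ∈ 𝓝 (1 : ℂ) :=
      (isOpen_lt continuous_const Complex.continuous_re).mem_nhds (by simp)
    filter_upwards [this] with s hs
    exact (Complex.Gamma_eq_integral hs).symm
  have h3 := (h1.congr_of_eventuallyEq h2.symm).unique Complex.hasDerivAt_Gamma_one
  have h4 : ∫ t : ℝ in Ioi 0, (t : ℂ) ^ ((1 : ℂ) - 1) * (Real.log t * Real.exp (-t))
      = ((∫ ε in Ioi (0 : ℝ), Real.log ε * Real.exp (-ε) : ℝ) : ℂ) := by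
    rw [← integral_complex_ofReal]
    refine integral_congr_ae (Eventually.of_forall fun t => ?_)
    simp
  rw [h4] at h3
  exact_mod_cast h3

theorem integral_exp_core :
    ∫ ε in Ioi (0 : ℝ), ((1 - Real.exp (-ε)) / ε - invTail ε) = Real.eulerMascheroniConstant := by
  have hd : ∀ ε : ℝ, HasDerivAt (fun ε => 1 - Real.exp (-ε)) (Real.exp (-ε)) ε := by
    intro ε
    have h : HasDerivAt (fun ε : ℝ => Real.exp (-ε)) (Real.exp (-ε) * -1) ε :=
      (Real.hasDerivAt_exp (-ε)).comp ε (hasDerivAt_neg ε)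
    exact (h.const_sub 1).congr_deriv (by ring)
  have hb : ∀ ε, 0 < ε → |(1 - Real.exp (-ε)) / ε - invTail ε| ≤ 6 * decay ε := by
    intro ε hε
    have h0 := Real.exp_pos (-ε)
    have h1 : 1 - ε ≤ Real.exp (-ε) := by have := Real.add_one_le_exp (-ε); linarith
    have h2 : Real.exp (-ε) ≤ 1 := Real.exp_le_one_iff.2 (by linarith)
    rcases le_or_gt ε 1 with h | h
    · rw [invTail_of_le h, sub_zero, abs_of_nonneg (div_nonneg (by linarith) hε.le)]
      have hd1 : decay ε = 1 := min_eq_left (by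
        rw [le_div_iff₀ (by positivity), one_mul]; exact pow_le_one₀ hε.le h)
      rw [hd1, div_le_iff₀ hε]; nlinarith
    · rw [invTail_of_lt h, ← sub_div, abs_div, abs_of_pos hε,
        show 1 - Real.exp (-ε) - 1 = -Real.exp (-ε) by ring, abs_neg, abs_of_pos h0]
      exact (div_le_self h0.le h.le).trans (exp_neg_le_decay hε)
  have hm : Measurable fun ε : ℝ => (1 - Real.exp (-ε)) / ε - invTail ε :=
    (by fun_prop : Measurable fun ε : ℝ => (1 - Real.exp (-ε)) / ε).sub measurable_indicator_inv
  have h := integral_log_pow_mul_core (S := fun ε => 1 - Real.exp (-ε)) 0 (C := 1) hd (by simp)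
    (fun ε hε => by
      have hε0 : 0 < ε := by linarith
      rw [show 1 - Real.exp (-ε) - 1 = -Real.exp (-ε) by ring, abs_neg, abs_of_pos (Real.exp_pos _),
        Real.exp_neg, inv_eq_one_div]
      apply one_div_le_one_div_of_le hε0
      have := Real.add_one_le_exp ε; linarith)
    (by simpa using integrableOn_of_abs_le_decay hm hb)
    (by simpa using integrableOn_log_mul' measurable_exp_neg fun ε hε => abs_exp_neg_le_decay hε)
  simp only [pow_zero, one_mul, zero_add, pow_one, CharP.cast_eq_zero] at h
  rw [h, integral_log_mul_exp_neg, neg_neg]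

/-- The density `½ / cosh² (ε / 2)` of the half-logistic distribution, the derivative of
`tanh (ε / 2)`. -/
def logisticDensity (ε : ℝ) : ℝ := 1 / (2 * Real.cosh (ε / 2) ^ 2)

theorem logisticDensity_eq (ε : ℝ) :
    logisticDensity ε = 2 * Real.exp (-ε) / (1 + Real.exp (-ε)) ^ 2 := by
  unfold logisticDensity
  rw [Real.cosh_eq]
  have e1 : Real.exp (-ε) = Real.exp (-(ε / 2)) * Real.exp (-(ε / 2)) := by
    rw [← Real.exp_add]; congr 1; ring
  have e2 : Real.exp (ε / 2) * Real.exp (-(ε / 2)) = 1 := by rw [← Real.exp_add]; simp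
  have h1 := Real.exp_pos (ε / 2)
  have h2 := Real.exp_pos (-(ε / 2))
  rw [e1]
  set a := Real.exp (ε / 2)
  set b := Real.exp (-(ε / 2))
  have e3 : 1 + b * b = b * (a + b) := by linear_combination -e2
  rw [e3]
  field_simp

theorem logisticDensity_nonneg (ε : ℝ) : 0 ≤ logisticDensity ε := by
  unfold logisticDensity; positivity

theorem abs_logisticDensity_le {ε : ℝ} (hε : 0 < ε) : |logisticDensity ε| ≤ 12 * decay ε := by
  have h0 := Real.exp_pos (-ε)
  have h := exp_neg_le_decay hε
  rw [abs_of_nonneg (logisticDensity_nonneg ε), logisticDensity_eq]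
  have : 2 * Real.exp (-ε) / (1 + Real.exp (-ε)) ^ 2 ≤ 2 * Real.exp (-ε) :=
    div_le_self (by positivity) (by nlinarith)
  linarith

theorem measurable_logisticDensity : Measurable logisticDensity := by
  have : Continuous logisticDensity := by
    unfold logisticDensity
    exact continuous_const.div (by fun_prop) fun ε => by
      have := Real.cosh_pos (ε / 2); positivity
  exact this.measurable

theorem integral_log_mul_tanhCore :
    ∫ ε in Ioi (0 : ℝ), Real.log ε * tanhCore ε
      = -((∫ ε in Ioi (0 : ℝ), Real.log ε ^ 2 * logisticDensity ε) / 2) := by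
  have hd : ∀ ε : ℝ, HasDerivAt (fun ε => Real.tanh (ε / 2)) (logisticDensity ε) ε := by
    intro ε
    have h2 : HasDerivAt (fun ε : ℝ => ε / 2) (1 / 2) ε := (hasDerivAt_id ε).div_const 2
    refine (HasDerivAt.comp ε (hasDerivAt_tanh (ε / 2)) h2).congr_deriv ?_
    unfold logisticDensity
    have := Real.cosh_pos (ε / 2)
    field_simp
  have h := integral_log_pow_mul_core (S := fun ε => Real.tanh (ε / 2)) (S' := logisticDensity) 1
    (C := 4) hd (by simp)
    (fun ε hε => by
      have hε0 : 0 < ε := by linarith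
      have h1 := one_sub_tanh_le (half_pos hε0)
      have h2 := Real.tanh_lt_one (ε / 2)
      rw [abs_sub_comm, abs_of_pos (by linarith)]
      refine h1.trans ?_
      rw [div_le_div_iff₀ (by positivity) hε0]; nlinarith)
    (by
      simpa [← tanhCore_eq] using
        integrableOn_log_mul' measurable_tanhCore fun ε hε => abs_tanhCore_le hε)
    (by
      simpa using integrableOn_log_sq_mul measurable_logisticDensity
        fun ε hε => abs_logisticDensity_le hε)
  simp only [pow_one, ← tanhCore_eq, Nat.cast_one] at h
  norm_num at h
  linarith

/-! ### Wallis' product and the constant of the tanh integral -/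

theorem abs_exp_sub_exp_div_le {a b ε : ℝ} (hab : a ≤ b) (hε : 0 < ε) :
    |ε⁻¹ • (Real.exp (-(a * ε)) - Real.exp (-(b * ε)))| ≤ (b - a) * Real.exp (-(a * ε)) := by
  have h1 := Real.exp_pos (-(a * ε))
  have h2 := Real.add_one_le_exp (-((b - a) * ε))
  have e : Real.exp (-(b * ε)) = Real.exp (-(a * ε)) * Real.exp (-((b - a) * ε)) := by
    rw [← Real.exp_add]; congr 1; ring
  have h3 : Real.exp (-((b - a) * ε)) ≤ 1 :=
    Real.exp_le_one_iff.2 (by have := mul_nonneg (sub_nonneg.2 hab) hε.le; linarith)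
  have e2 : ε⁻¹ • (Real.exp (-(a * ε)) - Real.exp (-(b * ε)))
      = Real.exp (-(a * ε)) * ((1 - Real.exp (-((b - a) * ε))) / ε) := by
    rw [e, smul_eq_mul]; field_simp
  have h4 : 0 ≤ (1 - Real.exp (-((b - a) * ε))) / ε := div_nonneg (by linarith) hε.le
  rw [e2, abs_of_nonneg (by positivity), mul_comm]
  gcongr
  rw [div_le_iff₀ hε]; linarith

theorem integral_exp_sub_exp_div {a b : ℝ} (ha : 0 < a) (hab : a ≤ b) :
    IntegrableOn (fun ε => ε⁻¹ • (Real.exp (-(a * ε)) - Real.exp (-(b * ε)))) (Ioi 0) ∧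
      ∫ ε in Ioi (0 : ℝ), ε⁻¹ • (Real.exp (-(a * ε)) - Real.exp (-(b * ε))) = Real.log (b / a) := by
  have hi : IntegrableOn (fun ε => ε⁻¹ • (Real.exp (-(a * ε)) - Real.exp (-(b * ε)))) (Ioi 0) := by
    have h := (integrableOn_exp_mul_Ioi (neg_lt_zero.2 ha) 0).const_mul (b - a)
    refine h.mono' (by fun_prop) ?_
    filter_upwards [ae_restrict_mem measurableSet_Ioi] with ε hε
    rw [Real.norm_eq_abs, neg_mul]
    exact abs_exp_sub_exp_div_le hab hε
  refine ⟨hi, ?_⟩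
  have h := Frullani.integral_Ioi_eq (f := fun t : ℝ => Real.exp (-t)) (a := a) (b := b) (L := 1)
    (R := 0) ((by fun_prop : Continuous fun t : ℝ => Real.exp (-t)).locallyIntegrable.locallyIntegrableOn _)
    ha (ha.trans_le hab)
    (by
      have : Tendsto (fun t : ℝ => Real.exp (-t)) (𝓝 0) (𝓝 (Real.exp (-0))) :=
        (by fun_prop : Continuous fun t : ℝ => Real.exp (-t)).tendsto 0
      rw [neg_zero, Real.exp_zero] at this
      exact this.mono_left nhdsWithin_le_nhds)
    Real.tendsto_exp_neg_atTop_nhds_zero hi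
  simpa using h

/-- Expanding `1 - tanh (ε / 2) = 2 q / (1 + q)`, `q = e^{-ε}`, in powers of `q²` turns the integral into
a sum of Frullani integrals, whose partial sums are the logarithms of Wallis' products. -/
theorem integral_tanh_sub_exp :
    ∫ ε in Ioi (0 : ℝ), (1 - Real.tanh (ε / 2) - Real.exp (-ε)) / ε = Real.log (Real.pi / 2) := by
  set E : ℝ → ℝ → ℝ → ℝ := fun a b ε => ε⁻¹ • (Real.exp (-(a * ε)) - Real.exp (-(b * ε))) with hE
  set F : ℕ → ℝ → ℝ := fun k ε => E (2 * k + 1) (2 * k + 2) ε - E (2 * k + 2) (2 * k + 3) ε with hF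
  have hE1 : ∀ k : ℕ, IntegrableOn (E (2 * k + 1) (2 * k + 2)) (Ioi 0) ∧
      ∫ ε in Ioi (0 : ℝ), E (2 * k + 1) (2 * k + 2) ε = Real.log ((2 * k + 2) / (2 * k + 1)) :=
    fun k => integral_exp_sub_exp_div (by positivity) (by linarith)
  have hE2 : ∀ k : ℕ, IntegrableOn (E (2 * k + 2) (2 * k + 3)) (Ioi 0) ∧
      ∫ ε in Ioi (0 : ℝ), E (2 * k + 2) (2 * k + 3) ε = Real.log ((2 * k + 3) / (2 * k + 2)) :=
    fun k => integral_exp_sub_exp_div (by positivity) (by linarith)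
  have hFi : ∀ k, IntegrableOn (F k) (Ioi 0) := fun k => (hE1 k).1.sub (hE2 k).1
  have hFv : ∀ k : ℕ, ∫ ε in Ioi (0 : ℝ), F k ε
      = Real.log ((2 * k + 2) / (2 * k + 1) * ((2 * k + 2) / (2 * k + 3))) := by
    intro k
    rw [hF]
    simp only
    rw [integral_sub (hE1 k).1 (hE2 k).1, (hE1 k).2, (hE2 k).2, Real.log_mul (by positivity)
      (by positivity), sub_eq_add_neg, ← Real.log_inv, inv_div]
  have hFe : ∀ k : ℕ, ∀ ε, F k ε = Real.exp (-ε) * (1 - Real.exp (-ε)) ^ 2 / ε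
      * (Real.exp (-ε) ^ 2) ^ k := by
    intro k ε
    have e : ∀ m : ℕ, Real.exp (-((m : ℝ) * ε)) = Real.exp (-ε) ^ m := by
      intro m; rw [← Real.exp_nat_mul]; congr 1; ring
    have e1 := e (2 * k + 1)
    have e2 := e (2 * k + 2)
    have e3 := e (2 * k + 3)
    push_cast at e1 e2 e3
    simp only [hF, hE, e1, e2, e3, smul_eq_mul]
    ring
  have hFnn : ∀ k ε, 0 < ε → 0 ≤ F k ε := by
    intro k ε hε
    rw [hFe]; positivity
  have hsum : HasSum (fun k => ∫ ε in Ioi (0 : ℝ), F k ε) (Real.log (Real.pi / 2)) := by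
    rw [hasSum_iff_tendsto_nat_of_nonneg fun k =>
      setIntegral_nonneg measurableSet_Ioi fun ε hε => hFnn k ε hε]
    have hW := Real.tendsto_prod_pi_div_two.log (by have := Real.pi_pos; positivity)
    refine hW.congr fun n => ?_
    rw [Real.log_prod fun k _ => by positivity]
    exact Finset.sum_congr rfl fun k _ => (hFv k).symm
  have hnorm : ∀ k, ∫ ε in Ioi (0 : ℝ), ‖F k ε‖ = ∫ ε in Ioi (0 : ℝ), F k ε := fun k =>
    setIntegral_congr_fun measurableSet_Ioi fun ε hε => Real.norm_of_nonneg (hFnn k ε hε)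
  have h := hasSum_integral_of_summable_integral_norm hFi (by simpa only [hnorm] using hsum.summable)
  rw [← h.unique hsum]
  refine setIntegral_congr_fun measurableSet_Ioi fun ε hε => ?_
  have h0 : (0 : ℝ) < ε := hε
  have q0 := Real.exp_pos (-ε)
  have q1 : Real.exp (-ε) < 1 := Real.exp_lt_one_iff.2 (by linarith)
  have hgeo : HasSum (fun k => F k ε) (Real.exp (-ε) * (1 - Real.exp (-ε)) ^ 2 / ε
      * (1 - Real.exp (-ε) ^ 2)⁻¹) := by
    simp_rw [hFe]
    exact (hasSum_geometric_of_lt_one (by positivity) (by nlinarith)).mul_left _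
  rw [hgeo.tsum_eq, one_sub_tanh_eq, show 2 * (ε / 2) = ε by ring]
  have e : Real.exp ε * Real.exp (-ε) = 1 := by rw [← Real.exp_add]; simp
  have e2 : 2 / (Real.exp ε + 1) = 2 * Real.exp (-ε) / (1 + Real.exp (-ε)) := by
    rw [div_eq_div_iff (by positivity) (by positivity)]
    linear_combination (-2 : ℝ) * e
  rw [e2]
  set q := Real.exp (-ε)
  have h1 : 1 - q ^ 2 = (1 - q) * (1 + q) := by ring
  have h2 : 1 - q ≠ 0 := by linarith
  rw [h1]
  field_simp
  ring

theorem integral_tanhCore :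
    ∫ ε in Ioi (0 : ℝ), tanhCore ε = Real.eulerMascheroniConstant - Real.log (Real.pi / 2) := by
  have hb : ∀ ε, 0 < ε → |(1 - Real.tanh (ε / 2) - Real.exp (-ε)) / ε| ≤ 6 * decay ε := by
    intro ε hε
    refine le_trans ?_ (exp_neg_le_decay hε)
    have q0 := Real.exp_pos (-ε)
    have q1 : Real.exp (-ε) < 1 := Real.exp_lt_one_iff.2 (by linarith)
    have e : Real.exp ε * Real.exp (-ε) = 1 := by rw [← Real.exp_add]; simp
    have e2 : 2 / (Real.exp ε + 1) = 2 * Real.exp (-ε) / (1 + Real.exp (-ε)) := by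
      rw [div_eq_div_iff (by positivity) (by positivity)]
      linear_combination (-2 : ℝ) * e
    have h1 := Real.add_one_le_exp (-ε)
    rw [one_sub_tanh_eq, show 2 * (ε / 2) = ε by ring, e2, abs_div, abs_of_pos hε, div_le_iff₀ hε]
    set q := Real.exp (-ε)
    have e3 : 2 * q / (1 + q) - q = q * ((1 - q) / (1 + q)) := by field_simp; ring
    have h2 : 0 ≤ (1 - q) / (1 + q) := div_nonneg (by linarith) (by linarith)
    rw [e3, abs_of_nonneg (by positivity)]
    gcongr
    rw [div_le_iff₀ (by linarith)]; nlinarith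
  have hm : Measurable fun ε : ℝ => (1 - Real.tanh (ε / 2) - Real.exp (-ε)) / ε := by
    have := continuous_tanh.measurable
    fun_prop
  have i1 := integrableOn_of_abs_le_decay hm hb
  have i2 := integrableOn_of_abs_le_decay measurable_tanhCore fun ε hε => abs_tanhCore_le hε
  have e : ∀ ε, tanhCore ε + (1 - Real.tanh (ε / 2) - Real.exp (-ε)) / ε
      = (1 - Real.exp (-ε)) / ε - invTail ε := by
    intro ε; rw [tanhCore_eq]; ring
  have h := integral_add i2 i1
  simp only [e] at h
  rw [integral_exp_core, integral_tanh_sub_exp] at h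
  linarith

theorem gapConst_pos : 0 < gapConst := by
  have := Real.pi_pos
  unfold gapConst; positivity

theorem log_gapConst : Real.log gapConst = Real.log Real.pi - Real.eulerMascheroniConstant := by
  unfold gapConst
  rw [Real.log_mul Real.pi_pos.ne' (Real.exp_pos _).ne', Real.log_exp]; ring

/-- The closed form that makes `π e^{-γ}` the gap ratio at zero temperature. -/
theorem bcsIntegral_zero_right {x : ℝ} (hx : 0 < x) :
    bcsIntegral x 0 = Real.log gapConst - Real.log x := by
  obtain ⟨C, hC⟩ := exists_abs_sqrtCore_le hx
  have i1 := integrableOn_of_abs_le_decay (measurable_sqrtCore x) hC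
  have i2 := integrableOn_of_abs_le_decay measurable_tanhCore fun ε hε => abs_tanhCore_le hε
  have h := integral_sub i1 i2
  have e : ∀ ε, 1 / Real.sqrt (x ^ 2 + ε ^ 2) - invTail ε - tanhCore ε = bcsIntegrand x 0 ε := by
    intro ε; rw [sqrtCore_eq]; ring
  simp only [e] at h
  rw [bcsIntegral, h, integral_sqrtCore hx, integral_tanhCore, log_gapConst,
    Real.log_div hx.ne' two_ne_zero, Real.log_div Real.pi_pos.ne' two_ne_zero]
  ring

/-! ### The function `fBCS` -/

theorem tendsto_tanh_half_atTop : Tendsto (fun ε : ℝ => Real.tanh (ε / 2)) atTop (𝓝 1) := by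
  have h : Tendsto (fun ε : ℝ => 1 - Real.tanh (ε / 2)) atTop (𝓝 0) := by
    have h4 : Tendsto (fun ε : ℝ => 4 * ε⁻¹) atTop (𝓝 0) := by
      simpa using (tendsto_inv_atTop_zero (𝕜 := ℝ)).const_mul 4
    refine squeeze_zero' (Eventually.of_forall fun ε => by
      linarith [Real.tanh_lt_one (ε / 2)]) ?_ h4
    filter_upwards [eventually_ge_atTop 1] with ε hε
    have hε0 : 0 < ε := by linarith
    refine (one_sub_tanh_le (half_pos hε0)).trans ?_
    rw [← div_eq_mul_inv, div_le_div_iff₀ (by positivity) hε0]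
    nlinarith
  simpa using h.const_sub 1

/-- Rescaling the integration variable by `y` reduces `bcsIntegral` to the temperature `1`; the
logarithm is Frullani's integral of `tanh`. -/
theorem bcsIntegral_eq_sub_log {x y : ℝ} (hy : 0 < y) (hy1 : y ≤ 1) :
    bcsIntegral x y = bcsIntegral (x / y) 1 - Real.log y := by
  have hi := integrableOn_bcsIntegrand (x := x) hy.le hy1 (Or.inr hy)
  have hi1 := integrableOn_bcsIntegrand (x := x / y) zero_le_one le_rfl (Or.inr one_pos)
  have hi2 : IntegrableOn (fun u => y * bcsIntegrand x y (y * u)) (Ioi 0) := by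
    refine Integrable.const_mul ?_ y
    have := (integrableOn_Ioi_comp_mul_left_iff (bcsIntegrand x y) 0 hy).2
    rw [mul_zero] at this
    exact this hi
  have key : ∀ u ∈ Ioi (0 : ℝ), y * bcsIntegrand x y (y * u) - bcsIntegrand (x / y) 1 u
      = u⁻¹ • (Real.tanh (1 * u / 2) - Real.tanh (y * u / 2)) := by
    intro u hu
    have hu0 : (0 : ℝ) < u := hu
    rw [bcsIntegrand_eq, bcsIntegrand_eq]
    have e : Real.sqrt (x ^ 2 + (y * u) ^ 2) = Real.sqrt ((x / y) ^ 2 + u ^ 2) * y := by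
      rw [← Real.sqrt_sq hy.le, ← Real.sqrt_mul (by positivity), Real.sqrt_sq hy.le]
      congr 1; field_simp
    have e2 := gapKernel_mul hy 1 (Real.sqrt ((x / y) ^ 2 + u ^ 2))
    rw [one_mul] at e2
    rw [e, e2, smul_eq_mul, one_mul]
    field_simp
    ring
  have hF := Frullani.integral_Ioi_eq (f := fun ε : ℝ => Real.tanh (ε / 2)) (a := 1) (b := y)
    (L := 0) (R := 1)
    ((continuous_tanh.comp (by fun_prop : Continuous fun ε : ℝ => ε / 2)).locallyIntegrable
      |>.locallyIntegrableOn _) one_pos hy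
    (by
      have : Tendsto (fun ε : ℝ => Real.tanh (ε / 2)) (𝓝 0) (𝓝 (Real.tanh (0 / 2))) :=
        (continuous_tanh.comp (by fun_prop : Continuous fun ε : ℝ => ε / 2)).tendsto 0
      simpa using this.mono_left nhdsWithin_le_nhds)
    tendsto_tanh_half_atTop
    ((hi2.sub hi1).congr_fun key measurableSet_Ioi)
  rw [← setIntegral_congr_fun measurableSet_Ioi key, integral_sub hi2 hi1, integral_const_mul,
    integral_comp_mul_left_Ioi (bcsIntegrand x y) 0 hy, mul_zero, smul_eq_mul,
    mul_inv_cancel_left₀ hy.ne', div_one, smul_eq_mul] at hF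
  unfold bcsIntegral
  linarith

theorem bcsIntegral_zero_one : bcsIntegral 0 1 = 0 := by
  unfold bcsIntegral
  rw [setIntegral_congr_fun (g := fun _ => (0 : ℝ)) measurableSet_Ioi, integral_zero]
  intro ε hε
  simp only
  have hε0 : (0 : ℝ) < ε := hε
  rw [bcsIntegrand_eq, ← gapKernel_one, zero_pow two_ne_zero, zero_add, Real.sqrt_sq hε0.le,
    sub_self]

theorem strictAntiOn_bcsIntegral {y : ℝ} (hy : 0 < y) (hy1 : y ≤ 1) :
    StrictAntiOn (fun x => bcsIntegral x y) (Ici 0) := fun _ h₁ _ _ h12 =>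
  bcsIntegral_lt hy.le h₁ h12 (integrableOn_bcsIntegrand hy.le hy1 (Or.inr hy))
    (integrableOn_bcsIntegrand hy.le hy1 (Or.inr hy))

theorem bcsIntegral_le_zero_right {x y : ℝ} (hx : 0 < x) (hy : 0 ≤ y) (hy1 : y ≤ 1) :
    bcsIntegral x y ≤ bcsIntegral x 0 := by
  refine setIntegral_mono_on (integrableOn_bcsIntegrand hy hy1 (Or.inl hx))
    (integrableOn_bcsIntegrand le_rfl zero_le_one (Or.inl hx)) measurableSet_Ioi fun ε hε => ?_
  rw [bcsIntegrand_eq, bcsIntegrand_eq, gapKernel_zero_left]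
  have := gapKernel_le_inv (T := y) (Real.sqrt_nonneg (x ^ 2 + ε ^ 2))
  linarith

theorem bcsIntegral_zero_right_sub_le {x y : ℝ} (hx : 0 < x) (hy : 0 ≤ y) (hy1 : y ≤ 1) :
    bcsIntegral x 0 - bcsIntegral x y ≤ 4 * y ^ 2 / x ^ 2 := by
  have hi₁ := integrableOn_bcsIntegrand hy hy1 (Or.inl hx)
  have hi₀ := integrableOn_bcsIntegrand le_rfl zero_le_one (Or.inl hx)
  obtain ⟨hi, hv⟩ := integral_one_div_sqrt_pow hx
  unfold bcsIntegral
  rw [← integral_sub hi₀ hi₁, ← mul_one_div (4 * y ^ 2), ← hv, ← integral_const_mul]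
  refine setIntegral_mono_on (hi₀.sub hi₁) (hi.const_mul _) measurableSet_Ioi fun ε hε => ?_
  simp only [bcsIntegrand_eq, gapKernel_zero_left]
  have := one_div_sub_gapKernel_le hy (sqrt_pos_of_pos_right x hε)
  rw [mul_one_div]
  linarith

theorem not_integrableOn_bcsIntegrand_zero_zero : ¬ IntegrableOn (bcsIntegrand 0 0) (Ioi 0) := by
  intro h
  have h1 : IntegrableOn (gapKernel 1) (Ioc 0 1) := by
    refine Measure.integrableOn_of_bounded (M := 1 / (2 * 1)) (by simp)
      (measurable_gapKernel 1).aestronglyMeasurable ?_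
    filter_upwards [ae_restrict_mem measurableSet_Ioc] with ε hε
    rw [Real.norm_of_nonneg (gapKernel_nonneg zero_le_one hε.1.le)]
    exact gapKernel_le one_pos hε.1.le
  have h2 : IntegrableOn (fun ε : ℝ => ε⁻¹) (Ioc 0 1) := by
    refine ((h.mono_set Ioc_subset_Ioi_self).add h1).congr_fun (fun ε hε => ?_) measurableSet_Ioc
    have hε0 : 0 < ε := hε.1
    simp only [Pi.add_apply]
    rw [bcsIntegrand_eq, gapKernel_zero_left, ← gapKernel_one, zero_pow two_ne_zero, zero_add,
      Real.sqrt_sq hε0.le, one_div]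
    ring
  have h3 := (intervalIntegrable_iff_integrableOn_Ioc_of_le zero_le_one).2 h2
  rw [intervalIntegrable_inv_iff] at h3
  simp at h3

theorem isBCSSolution_iff {x y : ℝ} (hy : 0 < y) (hy1 : y ≤ 1) :
    IsBCSSolution x y ↔ 0 ≤ x ∧ bcsIntegral x y = 0 :=
  ⟨fun h => ⟨h.1, h.2.2⟩,
    fun h => ⟨h.1, integrableOn_bcsIntegrand hy.le hy1 (Or.inr hy), h.2⟩⟩

theorem isBCSSolution_zero_iff {x : ℝ} : IsBCSSolution x 0 ↔ x = gapConst := by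
  have hg := gapConst_pos
  constructor
  · rintro ⟨h0, hi, h⟩
    rcases h0.eq_or_lt with rfl | hx
    · exact absurd hi not_integrableOn_bcsIntegrand_zero_zero
    · have := bcsIntegral_zero_right hx
      unfold bcsIntegral at this
      rw [h] at this
      exact Real.log_injOn_pos hx hg (by linarith)
  · rintro rfl
    refine ⟨hg.le, integrableOn_bcsIntegrand le_rfl zero_le_one (Or.inl hg), ?_⟩
    have := bcsIntegral_zero_right hg
    unfold bcsIntegral at this
    linarith

/-- For `0 < y`, a sign change of `bcsIntegral · y` lies between `0` and `gapConst`. -/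
theorem existsUnique_isBCSSolution {y : ℝ} (hy : y ∈ Icc (0 : ℝ) 1) :
    ∃! x, IsBCSSolution x y := by
  rcases hy.1.eq_or_lt with rfl | hy0
  · exact ⟨gapConst, isBCSSolution_zero_iff.2 rfl, fun x hx => isBCSSolution_zero_iff.1 hx⟩
  have hg := gapConst_pos
  have hanti := strictAntiOn_bcsIntegral hy0 hy.2
  have h1 : bcsIntegral gapConst y ≤ 0 :=
    (bcsIntegral_le_zero_right hg hy.1 hy.2).trans (by rw [bcsIntegral_zero_right hg]; simp)
  have h0 : 0 ≤ bcsIntegral 0 y := by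
    rw [bcsIntegral_eq_sub_log hy0 hy.2, zero_div, bcsIntegral_zero_one]
    have := Real.log_nonpos hy.1 hy.2
    linarith
  obtain ⟨x, hx, hx0⟩ := intermediate_value_Icc' hg.le
    (continuous_bcsIntegral hy0 hy.2).continuousOn ⟨h1, h0⟩
  refine ⟨x, (isBCSSolution_iff hy0 hy.2).2 ⟨hx.1, hx0⟩, fun z hz => ?_⟩
  obtain ⟨hz0, hz⟩ := (isBCSSolution_iff hy0 hy.2).1 hz
  exact hanti.injOn hz0 hx.1 (hz.trans hx0.symm)

theorem isBCSSolution_fBCS {y : ℝ} (hy : y ∈ Icc (0 : ℝ) 1) : IsBCSSolution (fBCS y) y := by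
  have h := (existsUnique_isBCSSolution hy).exists
  rw [fBCS, dif_pos h]
  exact h.choose_spec

theorem fBCS_zero : fBCS 0 = gapConst :=
  isBCSSolution_zero_iff.1 (isBCSSolution_fBCS ⟨le_rfl, zero_le_one⟩)

theorem bcsIntegral_fBCS {y : ℝ} (hy : y ∈ Icc (0 : ℝ) 1) : bcsIntegral (fBCS y) y = 0 :=
  (isBCSSolution_fBCS hy).2.2

theorem fBCS_pos {y : ℝ} (hy : y ∈ Ico (0 : ℝ) 1) : 0 < fBCS y := by
  have hy' : y ∈ Icc (0 : ℝ) 1 := ⟨hy.1, hy.2.le⟩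
  rcases hy.1.eq_or_lt with rfl | hy0
  · rw [fBCS_zero]; exact gapConst_pos
  · refine (isBCSSolution_fBCS hy').1.lt_of_ne fun h => ?_
    have h1 := bcsIntegral_fBCS hy'
    rw [← h, bcsIntegral_eq_sub_log hy0 hy.2.le, zero_div, bcsIntegral_zero_one] at h1
    have := Real.log_neg hy0 hy.2
    linarith

theorem bcsIntegral_fBCS_div {y : ℝ} (hy : y ∈ Ioo (0 : ℝ) 1) :
    bcsIntegral (fBCS y / y) 1 = Real.log y := by
  have h := bcsIntegral_fBCS ⟨hy.1.le, hy.2.le⟩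
  rw [bcsIntegral_eq_sub_log hy.1 hy.2.le] at h
  linarith

theorem continuousAt_fBCS_div {y : ℝ} (hy : y ∈ Ioo (0 : ℝ) 1) :
    ContinuousAt (fun y => fBCS y / y) y := by
  have hanti := strictAntiOn_bcsIntegral one_pos le_rfl
  have hev : ∀ᶠ z in 𝓝 y, z ∈ Ioo (0 : ℝ) 1 := isOpen_Ioo.mem_nhds hy
  have hpos : ∀ {z : ℝ}, z ∈ Ioo (0 : ℝ) 1 → 0 < fBCS z / z := fun hz =>
    div_pos (fBCS_pos ⟨hz.1.le, hz.2⟩) hz.1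
  have hlog : ContinuousAt Real.log y := Real.continuousAt_log hy.1.ne'
  refine tendsto_order.2 ⟨fun a ha => ?_, fun a ha => ?_⟩
  · have ha' : max a 0 < fBCS y / y := max_lt ha (hpos hy)
    have h1 := hanti (le_max_right a 0) (hpos hy).le ha'
    simp only [bcsIntegral_fBCS_div hy] at h1
    filter_upwards [hev, hlog.eventually_lt_const h1] with z hz hz1
    rw [← bcsIntegral_fBCS_div hz] at hz1
    exact (le_max_left a 0).trans_lt ((hanti.lt_iff_gt (hpos hz).le (le_max_right a 0)).1 hz1)
  · have ha0 : 0 ≤ a := (hpos hy).le.trans ha.le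
    have h1 := hanti (hpos hy).le ha0 ha
    simp only [bcsIntegral_fBCS_div hy] at h1
    filter_upwards [hev, hlog.eventually_const_lt h1] with z hz hz1
    rw [← bcsIntegral_fBCS_div hz] at hz1
    exact (hanti.lt_iff_gt ha0 (hpos hz).le).1 hz1

theorem bcsSlope_eq_div {x y : ℝ} (hx : 0 < x) (hy : 0 < y) (hy1 : y ≤ 1) :
    bcsSlope x y = bcsSlope (x / y) 1 / y := by
  refine (hasDerivAt_bcsIntegral hx hy.le hy1).unique ?_
  have h : (fun x => bcsIntegral x y) = fun x => bcsIntegral (x / y) 1 - Real.log y := by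
    funext x; exact bcsIntegral_eq_sub_log hy hy1
  rw [h]
  have h2 : HasDerivAt (fun x : ℝ => x / y) (1 / y) x := (hasDerivAt_id x).div_const y
  have h1 := hasDerivAt_bcsIntegral (div_pos hx hy) zero_le_one le_rfl
  have h3 := HasDerivAt.comp x (h := fun x => x / y) h1 h2
  exact (h3.sub_const (Real.log y)).congr_deriv (by ring)

/-- By the scaling relation, `y ↦ fBCS y / y` is inverse to `r ↦ exp (bcsIntegral r 1)`. -/
theorem hasDerivAt_fBCS {y : ℝ} (hy : y ∈ Ioo (0 : ℝ) 1) :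
    HasDerivAt fBCS (fBCS y / y + 1 / (y * bcsSlope (fBCS y) y)) y := by
  have hpos := fBCS_pos ⟨hy.1.le, hy.2⟩
  have hr : 0 < fBCS y / y := div_pos hpos hy.1
  have hs := bcsSlope_neg hr zero_le_one le_rfl
  have hev : ∀ᶠ z in 𝓝 y, z ∈ Ioo (0 : ℝ) 1 := isOpen_Ioo.mem_nhds hy
  have h1 : HasDerivAt (fun r => Real.exp (bcsIntegral r 1)) (y * bcsSlope (fBCS y / y) 1)
      (fBCS y / y) := by
    have := (hasDerivAt_bcsIntegral hr zero_le_one le_rfl).exp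
    rwa [bcsIntegral_fBCS_div hy, Real.exp_log hy.1] at this
  have h2 : HasDerivAt (fun y => fBCS y / y) (y * bcsSlope (fBCS y / y) 1)⁻¹ y :=
    HasDerivAt.of_local_left_inverse (continuousAt_fBCS_div hy) h1 (mul_ne_zero hy.1.ne' hs.ne)
      (by
        filter_upwards [hev] with z hz
        rw [bcsIntegral_fBCS_div hz, Real.exp_log hz.1])
  have h3 : HasDerivAt (fun y => y * (fBCS y / y))
      (1 * (fBCS y / y) + y * (y * bcsSlope (fBCS y / y) 1)⁻¹) y := (hasDerivAt_id y).mul h2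
  refine (h3.congr_of_eventuallyEq ?_).congr_deriv ?_
  · filter_upwards [hev] with z hz
    rw [mul_div_cancel₀ _ hz.1.ne']
  · rw [bcsSlope_eq_div hpos hy.1 hy.2.le]
    have h0 := hy.1.ne'
    have := hs.ne
    field_simp

theorem fBCS_le {y : ℝ} (hy : y ∈ Ico (0 : ℝ) 1) : fBCS y ≤ gapConst := by
  have hp := fBCS_pos hy
  have h := bcsIntegral_le_zero_right hp hy.1 hy.2.le
  rw [bcsIntegral_fBCS ⟨hy.1, hy.2.le⟩, bcsIntegral_zero_right hp] at h
  exact (Real.log_le_log_iff hp gapConst_pos).1 (by linarith)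

/-- `fBCS` is quadratically flat at temperature zero. -/
theorem eventually_abs_fBCS_sub_le :
    ∀ᶠ y in 𝓝[≥] (0 : ℝ), |fBCS y - gapConst| ≤ 16 / gapConst * y ^ 2 := by
  have hg := gapConst_pos
  have hlog2 := Real.log_pos one_lt_two
  have hc : Tendsto (fun y : ℝ => 16 * y ^ 2 / gapConst ^ 2) (𝓝[≥] 0) (𝓝 0) := by
    have : Continuous fun y : ℝ => 16 * y ^ 2 / gapConst ^ 2 := by fun_prop
    have h := this.tendsto 0
    simp only [ne_eq, OfNat.ofNat_ne_zero, not_false_eq_true, zero_pow, mul_zero, zero_div] at h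
    exact h.mono_left nhdsWithin_le_nhds
  have hlt : ∀ᶠ y in 𝓝[≥] (0 : ℝ), y < 1 := nhdsWithin_le_nhds (gt_mem_nhds one_pos)
  filter_upwards [hc.eventually_lt_const hlog2, hlt, self_mem_nhdsWithin] with y h1 hy1 hy0
  have hy : y ∈ Ico (0 : ℝ) 1 := ⟨hy0, hy1⟩
  have hp := fBCS_pos hy
  have hle := fBCS_le hy
  have hhalf : gapConst / 2 ≤ fBCS y := by
    by_contra! hcon
    have hlt := bcsIntegral_lt hy.1 hp.le hcon
      (integrableOn_bcsIntegrand hy.1 hy1.le (Or.inl hp))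
      (integrableOn_bcsIntegrand hy.1 hy1.le (Or.inl (half_pos hg)))
    have h2 := bcsIntegral_zero_right_sub_le (half_pos hg) hy.1 hy1.le
    rw [bcsIntegral_zero_right (half_pos hg), Real.log_div hg.ne' two_ne_zero] at h2
    rw [bcsIntegral_fBCS ⟨hy.1, hy1.le⟩] at hlt
    have e : 4 * y ^ 2 / (gapConst / 2) ^ 2 = 16 * y ^ 2 / gapConst ^ 2 := by
      field_simp; ring
    rw [e] at h2
    linarith
  have h2 := bcsIntegral_zero_right_sub_le hp hy.1 hy1.le
  rw [bcsIntegral_zero_right hp, bcsIntegral_fBCS ⟨hy.1, hy1.le⟩, sub_zero] at h2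
  have h3 : 4 * y ^ 2 / fBCS y ^ 2 ≤ 4 * y ^ 2 / (gapConst / 2) ^ 2 := by gcongr
  have h4 := Real.log_le_sub_one_of_pos (div_pos hp hg)
  have h5 := Real.one_sub_inv_le_log_of_pos (div_pos hg hp)
  rw [inv_div, Real.log_div hg.ne' hp.ne'] at h5
  rw [abs_sub_comm, abs_of_nonneg (by linarith)]
  have h6 : 1 - fBCS y / gapConst ≤ 4 * y ^ 2 / (gapConst / 2) ^ 2 := by linarith
  calc gapConst - fBCS y = gapConst * (1 - fBCS y / gapConst) := by field_simp
    _ ≤ gapConst * (4 * y ^ 2 / (gapConst / 2) ^ 2) := by gcongr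
    _ = 16 / gapConst * y ^ 2 := by field_simp; ring

theorem hasDerivWithinAt_fBCS_zero : HasDerivWithinAt fBCS 0 (Icc 0 1) 0 := by
  rw [hasDerivWithinAt_iff_isLittleO]
  have hle : 𝓝[Icc 0 1] (0 : ℝ) ≤ 𝓝[≥] 0 := nhdsWithin_mono _ Icc_subset_Ici_self
  have hO : (fun y => fBCS y - fBCS 0 - (y - 0) • (0 : ℝ)) =O[𝓝[Icc 0 1] 0] fun y : ℝ => y ^ 2 := by
    refine IsBigO.of_bound (16 / gapConst) (hle ?_)
    filter_upwards [eventually_abs_fBCS_sub_le] with y hy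
    simpa [fBCS_zero] using hy
  refine hO.trans_isLittleO ?_
  simp only [sub_zero]
  exact (isLittleO_pow_id one_lt_two).mono nhdsWithin_le_nhds

theorem bcsSlope_zero_right {x : ℝ} (hx : 0 < x) : bcsSlope x 0 = -(1 / x) := by
  refine (hasDerivAt_bcsIntegral hx le_rfl zero_le_one).unique ?_
  have h : HasDerivAt (fun x => Real.log gapConst - Real.log x) (-(1 / x)) x := by
    rw [one_div]
    exact (Real.hasDerivAt_log hx.ne').const_sub _
  refine h.congr_of_eventuallyEq ?_
  filter_upwards [lt_mem_nhds hx] with z hz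
  exact bcsIntegral_zero_right hz

theorem differentiableOn_fBCS : DifferentiableOn ℝ fBCS (Ico 0 1) := by
  intro y hy
  rcases hy.1.eq_or_lt with rfl | hy0
  · exact (hasDerivWithinAt_fBCS_zero.mono Ico_subset_Icc_self).differentiableWithinAt
  · exact (hasDerivAt_fBCS ⟨hy0, hy.2⟩).differentiableAt.differentiableWithinAt

/-- Implicit differentiation of `bcsIntegral (fBCS y) y = 0`, in the form in which it enters the
coefficient `c1`. -/
theorem sub_mul_derivWithin_mul_bcsSlope {y : ℝ} (hy : y ∈ Ico (0 : ℝ) 1) :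
    (fBCS y - y * derivWithin fBCS (Icc 0 1) y) * bcsSlope (fBCS y) y = -1 := by
  have hs := bcsSlope_neg (fBCS_pos hy) hy.1 hy.2.le
  rcases hy.1.eq_or_lt with rfl | hy0
  · rw [bcsSlope_zero_right (fBCS_pos hy)]
    have := (fBCS_pos hy).ne'
    field_simp
    ring
  · rw [derivWithin_of_mem_nhds (Icc_mem_nhds hy0 hy.2), (hasDerivAt_fBCS ⟨hy0, hy.2⟩).deriv]
    have := hs.ne
    field_simp
    ring

theorem integrableOn_c1Integrand {y : ℝ} (hy : y ∈ Ico (0 : ℝ) 1) :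
    IntegrableOn (c1Integrand (fBCS y) y) (Ioi 0) := by
  have h : IntegrableOn (fun ε => 1 / (2 * Real.pi)
      * (Real.log (16 / ε) * bcsIntegrand (fBCS y) y ε)) (Ioi 0) :=
    (integrableOn_log_mul_bcsIntegrand hy.1 hy.2.le (Or.inl (fBCS_pos hy))).const_mul _
  refine h.congr_fun (fun ε _ => ?_) measurableSet_Ioi
  simp only [c1Integrand]
  ring

theorem integral_c1Integrand (x y : ℝ) :
    ∫ ε in Ioi (0 : ℝ), c1Integrand x y ε = bcsLogIntegral x y / (2 * Real.pi) := by
  unfold bcsLogIntegral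
  rw [← integral_div]
  refine setIntegral_congr_fun measurableSet_Ioi fun ε _ => ?_
  simp only [c1Integrand]
  ring

theorem c1_mul_bcsSlope {y : ℝ} (hy : y ∈ Ico (0 : ℝ) 1) :
    c1 y * bcsSlope (fBCS y) y = -(bcsLogIntegral (fBCS y) y / (2 * Real.pi)) := by
  rw [c1, integral_c1Integrand, mul_right_comm, sub_mul_derivWithin_mul_bcsSlope hy]
  ring

theorem c1_zero_eq : c1 0 = gapConst *
    ∫ ε in Ioi (0 : ℝ), Real.log (16 / ε) / (2 * Real.pi) *
      (1 / Real.sqrt (gapConst ^ 2 + ε ^ 2) - Real.tanh (ε / 2) / ε) := by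
  rw [c1, zero_mul, sub_zero, fBCS_zero]
  simp only [c1Integrand, bcsIntegrand_eq, gapKernel_zero_left]

/-! ### Weak-coupling expansion of the gap ratio -/

/-- Subtracting the equation for the Néel temperature `τ` from the mean-field equation leaves the
BCS integrand, integrated against the density of states. -/
theorem bandGap_sub_bandGap {τ x y : ℝ} (hτ : 0 < τ) (hx : 0 < x) (hy : 0 ≤ y) :
    bandGap (x * τ) (y * τ) - bandGap 0 τ
      = ∫ u in Ioo (0 : ℝ) (4 / τ), bandDensity (τ * u) * bcsIntegrand x y u := by
  have h0 := bandGap_mul hτ 0 1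
  rw [zero_mul, one_mul] at h0
  have i1 := integrableOn_bandDensity_comp_mul_mul (C := 1 / x) hτ (measurable_gapKernel_sqrt y x)
    fun u hu => by
      rw [abs_of_nonneg (gapKernel_nonneg hy (Real.sqrt_nonneg _))]
      exact gapKernel_sqrt_le_one_div hx le_rfl
  have i2 := integrableOn_bandDensity_comp_mul_mul (C := 1 / (2 * 1)) hτ (measurable_gapKernel_sqrt 1 0)
    fun u hu => by
      rw [abs_of_nonneg (gapKernel_nonneg zero_le_one (Real.sqrt_nonneg _))]
      exact gapKernel_le one_pos (Real.sqrt_nonneg _)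
  rw [bandGap_mul hτ, h0, ← integral_sub i1 i2]
  refine setIntegral_congr_fun measurableSet_Ioo fun u hu => ?_
  have hu0 : 0 < u := hu.1
  simp only [bcsIntegrand_eq]
  rw [zero_pow two_ne_zero, zero_add, Real.sqrt_sq hu0.le, gapKernel_one]
  ring

theorem abs_bandGap_sub_div_le {τ x y C : ℝ} (hτ : 0 < τ) (hL : 1 ≤ -Real.log τ) (hx : 0 < x)
    (hy : 0 ≤ y) (hy1 : y ≤ 1)
    (hC : ∫ ε in Ioi (0 : ℝ), Real.sqrt ε * |bcsIntegrand x y ε| ≤ C) :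
    |(bandGap (x * τ) (y * τ) - bandGap 0 τ) / -Real.log τ
      - (bcsIntegral x y + bcsLogIntegral x y * (1 / -Real.log τ))| ≤
      16 * C * (1 / -Real.log τ) ^ 2 := by
  obtain ⟨D, hD⟩ := exists_abs_bcsIntegrand_le (x := x) hy hy1 (Or.inl hx)
  have h := abs_integral_bandDensity_sub_le (measurable_bcsIntegrand x y) hD hτ
  rw [← bandGap_sub_bandGap hτ hx hy] at h
  change |_ - (-Real.log τ * bcsIntegral x y + bcsLogIntegral x y)| ≤ _ at h
  set L := -Real.log τ
  have hL0 : 0 < L := by linarith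
  have hC0 : 0 ≤ C := (setIntegral_nonneg measurableSet_Ioi fun ε _ => by positivity).trans hC
  have hs : Real.sqrt τ ≤ 2 * (1 / L) := by
    have e : Real.sqrt τ = Real.exp (-(L / 2)) := by
      rw [Real.sqrt_eq_rpow, Real.rpow_def_of_pos hτ]
      congr 1; simp only [L]; ring
    have h1 := Real.add_one_le_exp (L / 2)
    rw [e, Real.exp_neg, show 2 * (1 / L) = (L / 2)⁻¹ by field_simp]
    exact inv_anti₀ (by positivity) (by linarith)
  have e : (bandGap (x * τ) (y * τ) - bandGap 0 τ) / L
      - (bcsIntegral x y + bcsLogIntegral x y * (1 / L))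
      = (bandGap (x * τ) (y * τ) - bandGap 0 τ
        - (L * bcsIntegral x y + bcsLogIntegral x y)) * (1 / L) := by
    field_simp
  rw [e, abs_mul, abs_of_pos (by positivity : 0 < 1 / L)]
  calc _ ≤ 8 * Real.sqrt τ * (∫ u in Ioi (0 : ℝ), Real.sqrt u * |bcsIntegrand x y u|) * (1 / L) := by
        gcongr
    _ ≤ 8 * (2 * (1 / L)) * C * (1 / L) := by gcongr
    _ = 16 * C * (1 / L) ^ 2 := by ring

theorem bcsSlope_fBCS_le {m y : ℝ} (hm : 0 < m) (hy : y ∈ Ico (0 : ℝ) 1) (hmy : m ≤ fBCS y) :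
    bcsSlope (fBCS y) y ≤ -(tanhSlope (m / 2) / gapConst) := by
  have hp : 0 < fBCS y := hm.trans_le hmy
  refine (bcsSlope_le hp hy.1 hy.2.le).trans (neg_le_neg ?_)
  have : tanhSlope (m / 2) ≤ tanhSlope (fBCS y / 2) :=
    strictMonoOn_tanhSlope.monotoneOn (mem_Ici.2 (by positivity)) (mem_Ici.2 (by positivity))
      (by linarith)
  exact div_le_div₀ ((tanhSlope_pos (half_pos hm)).le.trans this) this hp (fBCS_le hy)

/-- Near `fBCS y + c1 y √U` the difference of the two gap equations is, to order `U`, the linear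
function with slope `bcsSlope`: the order-`√U` contributions of the shift and of `bcsLogIntegral`
cancel by the choice of `c1`. -/
theorem exists_abs_bandGap_sub_div_sub_le {m : ℝ} (hm : 0 < m) :
    ∃ B, 0 ≤ B ∧ ∀ C, 0 ≤ C → ∃ U₀, 0 < U₀ ∧ ∀ U, 0 < U → U < U₀ →
      1 ≤ -Real.log (neelTemperature U 0) ∧
      ∀ y ∈ Ico (0 : ℝ) 1, m ≤ fBCS y → ∀ κ : ℝ, |κ| ≤ C →
      0 < fBCS y + c1 y * Real.sqrt U + κ * U ∧
      |(bandGap ((fBCS y + c1 y * Real.sqrt U + κ * U) * neelTemperature U 0)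
          (y * neelTemperature U 0) - bandGap 0 (neelTemperature U 0))
          / -Real.log (neelTemperature U 0) - κ * bcsSlope (fBCS y) y * U| ≤ B * U := by
  have hg := gapConst_pos
  obtain ⟨Cb, hCb0, hCb1, hCb2, hCb3⟩ := exists_bcsLogIntegral_bound (a := m / 2)
    (b := gapConst + m) (half_pos hm)
  obtain ⟨N, U₁, hN, hU₁, hneel⟩ := exists_neelTemperature_asymptotics
  have hpi := Real.pi_pos
  have hts := tanhSlope_pos (half_pos hm)
  set c0 : ℝ := tanhSlope (m / 2) / gapConst with hc0
  have hc0p : 0 < c0 := by positivity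
  set D : ℝ := Cb / (2 * Real.pi) / c0 with hD
  have hD0 : 0 ≤ D := by positivity
  refine ⟨6 / (m / 2) ^ 2 * (D + 1) ^ 2 + Cb * N + Cb * (D + 1) * (1 + N) + 16 * Cb * (1 + N) ^ 2,
    by positivity, fun C hC => ?_⟩
  have hmD : 0 < m / (2 * (D + 1)) := by positivity
  refine ⟨min U₁ (min 1 (min (1 / (C + 1)) (m / (2 * (D + 1)))) ^ 2), by positivity,
    fun U hU hUU => ?_⟩
  have hU1 := hUU.trans_le (min_le_left _ _)
  obtain ⟨hL, hLs⟩ := hneel U hU hU1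
  refine ⟨hL, fun y hy hmy κ hκ => ?_⟩
  have hy1 : y ∈ Icc (0 : ℝ) 1 := ⟨hy.1, hy.2.le⟩
  set τ := neelTemperature U 0
  have hτ : 0 < τ := (neelTemperature_spec hU).1
  set s := Real.sqrt U with hs
  have hs0 : 0 < s := Real.sqrt_pos.2 hU
  have hsU : U = s ^ 2 := (Real.sq_sqrt hU.le).symm
  have hss : s < min 1 (min (1 / (C + 1)) (m / (2 * (D + 1)))) := by
    rw [hs]
    exact (Real.sqrt_lt' (by positivity)).2 (hUU.trans_le (min_le_right _ _))
  have hs1 : s ≤ 1 := (hss.trans_le (min_le_left _ _)).le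
  have hsC : C * s ≤ 1 := by
    have := (hss.trans_le ((min_le_right _ _).trans (min_le_left _ _))).le
    rw [le_div_iff₀ (by positivity)] at this
    nlinarith
  have hsD : (D + 1) * s ≤ m / 2 := by
    have := (hss.trans_le ((min_le_right _ _).trans (min_le_right _ _))).le
    rw [le_div_iff₀ (by positivity)] at this
    linarith
  set x₀ := fBCS y
  have hx₀ : 0 < x₀ := hm.trans_le hmy
  have hx₀g : x₀ ≤ gapConst := fBCS_le hy
  set S := bcsSlope x₀ y with hS
  have hSle : S ≤ -c0 := bcsSlope_fBCS_le hm hy hmy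
  have hx₀m : x₀ ∈ Icc (m / 2) (gapConst + m) := ⟨by linarith, by linarith⟩
  have hcS : c1 y * S = -(bcsLogIntegral x₀ y / (2 * Real.pi)) := c1_mul_bcsSlope hy
  have hc1 : |c1 y| ≤ D := by
    have h1 := congrArg abs hcS
    rw [abs_mul, abs_neg, abs_div, abs_of_pos (by positivity : 0 < 2 * Real.pi)] at h1
    have h2 : c0 ≤ |S| := by rw [abs_of_neg (by linarith)]; linarith
    rw [hD, le_div_iff₀ hc0p]
    calc |c1 y| * c0 ≤ |c1 y| * |S| := by gcongr
      _ = |bcsLogIntegral x₀ y| / (2 * Real.pi) := h1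
      _ ≤ Cb / (2 * Real.pi) := by gcongr; exact hCb1 x₀ hx₀m y hy1
  set x := x₀ + c1 y * s + κ * U with hx
  have hδ : |x - x₀| ≤ (D + 1) * s := by
    have e : x - x₀ = c1 y * s + κ * s * s := by rw [hx, hsU]; ring
    rw [e]
    have h1 : |c1 y * s| ≤ D * s := by rw [abs_mul, abs_of_pos hs0]; gcongr
    have h2 : |κ * s * s| ≤ 1 * s := by
      rw [abs_mul, abs_mul, abs_of_pos hs0]
      gcongr
      exact (mul_le_mul_of_nonneg_right hκ hs0.le).trans hsC
    calc _ ≤ |c1 y * s| + |κ * s * s| := abs_add_le _ _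
      _ ≤ D * s + 1 * s := add_le_add h1 h2
      _ = (D + 1) * s := by ring
  have hxm : x ∈ Icc (m / 2) (gapConst + m) := by
    have := abs_le.1 (hδ.trans hsD)
    exact ⟨by linarith [this.1], by linarith [this.2]⟩
  have hxp : 0 < x := (half_pos hm).trans_le hxm.1
  refine ⟨hxp, ?_⟩
  have hmain := abs_bandGap_sub_div_le hτ hL hxp hy.1 hy.2.le (hCb2 x hxm y hy1)
  have htay := abs_bcsIntegral_taylor_le (half_pos hm) hx₀m.1 hxm.1 hy.1 hy.2.le
  rw [bcsIntegral_fBCS hy1, sub_zero, ← hS] at htay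
  have hlip := hCb3 x hxm x₀ hx₀m y hy1
  have hJ := hCb1 x₀ hx₀m y hy1
  set Λ := 1 / -Real.log τ
  have hΛ0 : 0 < Λ := by positivity
  have hΛ : Λ ≤ (1 + N) * s := by
    have h1 := (abs_le.1 hLs).2
    have h2 : s / (2 * Real.pi) ≤ s := div_le_self hs0.le (by linarith [Real.pi_gt_three])
    have h3 : N * U ≤ N * s := by rw [hsU]; gcongr; nlinarith
    linarith
  set Φ := (bandGap (x * τ) (y * τ) - bandGap 0 τ) / -Real.log τ
  have e : Φ - κ * S * U = (Φ - (bcsIntegral x y + bcsLogIntegral x y * Λ))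
      + (bcsIntegral x y - S * (x - x₀)) + bcsLogIntegral x₀ y * (Λ - s / (2 * Real.pi))
      + (bcsLogIntegral x y - bcsLogIntegral x₀ y) * Λ := by
    have e1 : x - x₀ = c1 y * s + κ * U := by rw [hx]; ring
    rw [e1]
    linear_combination s * hcS
  rw [e]
  have b1 : 16 * Cb * Λ ^ 2 ≤ 16 * Cb * (1 + N) ^ 2 * U := by
    calc 16 * Cb * Λ ^ 2 ≤ 16 * Cb * ((1 + N) * s) ^ 2 := by gcongr
      _ = _ := by rw [hsU]; ring
  have b2 : 6 / (m / 2) ^ 2 * (x - x₀) ^ 2 ≤ 6 / (m / 2) ^ 2 * (D + 1) ^ 2 * U := by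
    rw [← sq_abs (x - x₀)]
    calc _ ≤ 6 / (m / 2) ^ 2 * ((D + 1) * s) ^ 2 := by gcongr
      _ = _ := by rw [hsU]; ring
  have b3 : |bcsLogIntegral x₀ y * (Λ - s / (2 * Real.pi))| ≤ Cb * N * U := by
    rw [abs_mul, mul_assoc]
    exact mul_le_mul hJ hLs (abs_nonneg _) hCb0
  have b4 : |(bcsLogIntegral x y - bcsLogIntegral x₀ y) * Λ| ≤ Cb * (D + 1) * (1 + N) * U := by
    rw [abs_mul, abs_of_pos hΛ0]
    calc _ ≤ (Cb * ((D + 1) * s)) * ((1 + N) * s) := by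
          gcongr
          exact hlip.trans (by gcongr)
      _ = _ := by rw [hsU]; ring
  refine (abs_add_le _ _).trans ?_
  have t1 := abs_add_le (Φ - (bcsIntegral x y + bcsLogIntegral x y * Λ)
    + (bcsIntegral x y - S * (x - x₀))) (bcsLogIntegral x₀ y * (Λ - s / (2 * Real.pi)))
  have t2 := abs_add_le (Φ - (bcsIntegral x y + bcsLogIntegral x y * Λ))
    (bcsIntegral x y - S * (x - x₀))
  linarith

/-- The sign of the difference of the two gap equations at the trial values with `κ = ± C` encloses the
order parameter. -/
theorem exists_abs_gapRatio_sub_le_of_le {m : ℝ} (hm : 0 < m) :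
    ∃ C U₀ : ℝ, 0 < U₀ ∧ ∀ U, 0 < U → U < U₀ → ∀ T, 0 ≤ T →
      T / neelTemperature U 0 ∈ Ico (0 : ℝ) 1 → m ≤ fBCS (T / neelTemperature U 0) →
      |gapRatio U 0 T - (fBCS (T / neelTemperature U 0)
        + c1 (T / neelTemperature U 0) * Real.sqrt U)| ≤ C * U := by
  have hg := gapConst_pos
  obtain ⟨B, hB, h⟩ := exists_abs_bandGap_sub_div_sub_le hm
  have hts := tanhSlope_pos (half_pos hm)
  set c0 : ℝ := tanhSlope (m / 2) / gapConst with hc0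
  have hc0p : 0 < c0 := by positivity
  set C : ℝ := (B + 1) / c0 with hCdef
  have hC : 0 ≤ C := by positivity
  have hCc : C * c0 = B + 1 := by rw [hCdef]; field_simp
  obtain ⟨U₀, hU₀, h⟩ := h C hC
  refine ⟨C, U₀, hU₀, fun U hU hUU T hT hy hmy => ?_⟩
  obtain ⟨hL, h⟩ := h U hU hUU
  obtain ⟨hτ, hτe⟩ := neelTemperature_spec hU
  rw [gapRatio]
  set τ := neelTemperature U 0
  set y := T / τ with hyd
  have hTy : T = y * τ := by rw [hyd]; field_simp
  have hTN : T < τ := by rw [hTy]; nlinarith [hy.2]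
  obtain ⟨hΔ, hΔe⟩ := orderParameter_spec hU hT hTN
  set Δ := orderParameter U 0 T
  have hL0 : 0 < -Real.log τ := by linarith
  have hSle : bcsSlope (fBCS y) y ≤ -c0 := bcsSlope_fBCS_le hm hy hmy
  -- the gap integral decreases in the gap, so its size at a trial value locates the solution
  have hanti : ∀ {a b : ℝ}, 0 < a → bandGap a T < bandGap b T → b < a := by
    intro a b ha hlt
    by_contra! hle
    rcases hle.eq_or_lt with rfl | hlt'
    · exact lt_irrefl _ hlt
    · exact lt_asymm hlt (bandGap_lt_of_lt hT ha.le (Or.inl ha) hlt')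
  have hCS : B * U < C * -bcsSlope (fBCS y) y * U := by
    have h1 : C * c0 ≤ C * -bcsSlope (fBCS y) y := by gcongr; linarith
    exact mul_lt_mul_of_pos_right (by linarith) hU
  obtain ⟨hp1, hb1⟩ := h y hy hmy C (abs_of_nonneg hC).le
  obtain ⟨hp2, hb2⟩ := h y hy hmy (-C) (by rw [abs_neg, abs_of_nonneg hC])
  rw [← hTy] at hb1 hb2
  rw [hτe, ← hΔe] at hb1 hb2
  have h1 : bandGap ((fBCS y + c1 y * Real.sqrt U + C * U) * τ) T < bandGap Δ T := by
    have := (abs_le.1 hb1).2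
    have h2 := (div_lt_iff₀ hL0).1 (lt_of_le_of_lt (sub_le_iff_le_add.1 this)
      (by linarith : B * U + C * bcsSlope (fBCS y) y * U < 0))
    linarith
  have h2 : bandGap Δ T < bandGap ((fBCS y + c1 y * Real.sqrt U + -C * U) * τ) T := by
    have := (abs_le.1 hb2).1
    have h2 := (lt_div_iff₀ hL0).1 (lt_of_lt_of_le
      (by linarith : 0 < -(B * U) + -C * bcsSlope (fBCS y) y * U) (le_sub_iff_add_le.1 this))
    linarith
  have h3 := (div_lt_iff₀ hτ).2 (hanti (mul_pos hp1 hτ) h1)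
  have h4 := (lt_div_iff₀ hτ).2 (hanti hΔ h2)
  rw [abs_le]
  constructor <;> linarith

theorem exists_abs_gapRatio_sub_le {K : Set ℝ} (hK : IsCompact K) (hK1 : K ⊆ Ico 0 1) :
    ∃ C U₀ : ℝ, 0 < U₀ ∧ ∀ U, 0 < U → U < U₀ → ∀ T, 0 ≤ T →
      T / neelTemperature U 0 ∈ K →
      |gapRatio U 0 T - (fBCS (T / neelTemperature U 0)
        + c1 (T / neelTemperature U 0) * Real.sqrt U)| ≤ C * U := by
  rcases K.eq_empty_or_nonempty with rfl | hne
  · exact ⟨0, 1, one_pos, fun U _ _ T _ h => absurd h (notMem_empty _)⟩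
  obtain ⟨y₀, hy₀, hmin⟩ := hK.exists_isMinOn hne (differentiableOn_fBCS.continuousOn.mono hK1)
  obtain ⟨C, U₀, hU₀, h⟩ := exists_abs_gapRatio_sub_le_of_le (fBCS_pos (hK1 hy₀))
  exact ⟨C, U₀, hU₀, fun U hU hUU T hT hTK => h U hU hUU T hT (hK1 hTK) (hmin hTK)⟩

theorem gapRatio_zero_isBigO :
    (fun U : ℝ => gapRatio U 0 0 - (gapConst + c1 0 * Real.sqrt U)) =O[𝓝[>] 0] fun U : ℝ => U := by
  obtain ⟨C, U₀, hU₀, h⟩ := exists_abs_gapRatio_sub_le (isCompact_singleton (x := (0 : ℝ)))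
    (singleton_subset_iff.2 ⟨le_rfl, one_pos⟩)
  refine IsBigO.of_bound C ?_
  filter_upwards [Ioo_mem_nhdsGT hU₀] with U hU
  have := h U hU.1 hU.2 0 le_rfl (by simp)
  rw [zero_div, fBCS_zero] at this
  rwa [Real.norm_eq_abs, Real.norm_eq_abs, abs_of_pos hU.1]

/-! ### The second logarithmic moment of the exponential distribution -/

/-- The derivative of the Gamma function, as a Mellin transform. -/
def gammaDeriv : ℂ → ℂ := mellin fun t : ℝ => Real.log t • ((Real.exp (-t) : ℝ) : ℂ)

theorem locallyIntegrableOn_exp_neg :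
    LocallyIntegrableOn (fun t : ℝ => ((Real.exp (-t) : ℝ) : ℂ)) (Ioi 0) :=
  Continuous.locallyIntegrable (by fun_prop) |>.locallyIntegrableOn _

theorem exp_neg_isBigO_atTop (a : ℝ) :
    (fun t : ℝ => ((Real.exp (-t) : ℝ) : ℂ)) =O[atTop] fun t : ℝ => t ^ (-a) := by
  rw [← isBigO_norm_left]
  simp_rw [Complex.norm_real, isBigO_norm_left]
  simpa only [neg_one_mul] using (isLittleO_exp_neg_mul_rpow_atTop zero_lt_one (-a)).isBigO

theorem exp_neg_isBigO_nhdsGT :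
    (fun t : ℝ => ((Real.exp (-t) : ℝ) : ℂ)) =O[𝓝[>] 0] fun t : ℝ => t ^ (-(0 : ℝ)) := by
  simp_rw [neg_zero, Real.rpow_zero]
  refine IsBigO.of_bound 1 ?_
  filter_upwards [self_mem_nhdsWithin] with t ht
  rw [Complex.norm_real, Real.norm_of_nonneg (Real.exp_pos _).le, norm_one, mul_one]
  exact Real.exp_le_one_iff.2 (by linarith [mem_Ioi.1 ht])

theorem hasDerivAt_complexGamma {s : ℂ} (hs : 0 < s.re) :
    HasDerivAt Complex.Gamma (gammaDeriv s) s := by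
  have h := (mellin_hasDerivAt_of_isBigO_rpow locallyIntegrableOn_exp_neg
    (exp_neg_isBigO_atTop (s.re + 1)) (lt_add_one _) exp_neg_isBigO_nhdsGT hs).2
  refine h.congr_of_eventuallyEq ?_
  filter_upwards [(isOpen_lt continuous_const Complex.continuous_re).mem_nhds hs] with z hz
  rw [Complex.Gamma_eq_integral hz, Complex.GammaIntegral_eq_mellin]

theorem hasDerivAt_gammaDeriv_one :
    HasDerivAt gammaDeriv (((∫ t in Ioi (0 : ℝ), Real.log t ^ 2 * Real.exp (-t) : ℝ)) : ℂ) 1 := by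
  have hlog1 : (fun t : ℝ => Real.log t) =O[atTop] fun t : ℝ => t ^ (1 : ℝ) :=
    (isLittleO_log_rpow_atTop one_pos).isBigO
  have hlog0 : (fun t : ℝ => Real.log t) =O[𝓝[>] 0] fun t : ℝ => t ^ (-(1 / 2) : ℝ) :=
    (isLittleO_log_rpow_nhdsGT_zero (by norm_num)).isBigO
  have h := (mellin_hasDerivAt_of_isBigO_rpow (a := 2) (b := 1 / 2) (s := 1)
    (f := fun t : ℝ => Real.log t • ((Real.exp (-t) : ℝ) : ℂ)) ?_ ?_ (by norm_num) ?_
    (by norm_num)).2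
  · refine h.congr_deriv ?_
    rw [mellin, ← integral_complex_ofReal]
    refine setIntegral_congr_fun measurableSet_Ioi fun t _ => ?_
    simp only [sub_self, Complex.cpow_zero, one_smul, Complex.real_smul]
    push_cast
    ring
  · refine ContinuousOn.locallyIntegrableOn ?_ measurableSet_Ioi
    refine ContinuousOn.smul (Real.continuousOn_log.mono fun t ht => ?_)
      (Continuous.continuousOn (by fun_prop))
    exact (mem_Ioi.1 ht).ne'
  · refine (hlog1.smul (exp_neg_isBigO_atTop 3)).congr' EventuallyEq.rfl ?_
    filter_upwards [eventually_gt_atTop 0] with t ht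
    rw [smul_eq_mul, ← Real.rpow_add ht]
    norm_num
  · refine (hlog0.smul exp_neg_isBigO_nhdsGT).congr' EventuallyEq.rfl ?_
    filter_upwards [self_mem_nhdsWithin] with t ht
    rw [smul_eq_mul, ← Real.rpow_add ht]
    norm_num

theorem gammaDeriv_one : gammaDeriv 1 = -Real.eulerMascheroniConstant :=
  (hasDerivAt_complexGamma (by simp)).unique Complex.hasDerivAt_Gamma_one

theorem hasDerivAt_realGamma {x : ℝ} (hx : 0 < x) :
    HasDerivAt Real.Gamma (gammaDeriv x).re x :=
  (hasDerivAt_complexGamma (s := (x : ℂ)) (by simpa using hx)).real_of_complex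

theorem hasDerivAt_gammaDeriv_re_one : HasDerivAt (fun x : ℝ => (gammaDeriv x).re)
    (∫ t in Ioi (0 : ℝ), Real.log t ^ 2 * Real.exp (-t)) 1 := by
  have h := hasDerivAt_gammaDeriv_one
  rw [← Complex.ofReal_one] at h
  simpa using h.real_of_complex

theorem tendsto_sin_sub_mul_cos_div_pow :
    Tendsto (fun x : ℝ => (Real.sin x - x * Real.cos x) / x ^ 3) (𝓝[>] 0) (𝓝 (1 / 3)) := by
  have hn : ∀ x : ℝ, HasDerivAt (fun x => Real.sin x - x * Real.cos x) (x * Real.sin x) x := by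
    intro x
    refine ((Real.hasDerivAt_sin x).sub ((hasDerivAt_id x).mul (Real.hasDerivAt_cos x))).congr_deriv
      ?_
    simp
  have hd : ∀ x : ℝ, HasDerivAt (fun x => x ^ 3) (3 * x ^ 2) x := fun x => by
    simpa using hasDerivAt_pow 3 x
  refine HasDerivAt.lhopital_zero_nhdsGT (Eventually.of_forall hn) (Eventually.of_forall hd) ?_ ?_ ?_ ?_
  · filter_upwards [self_mem_nhdsWithin] with x hx
    have : (0 : ℝ) < x := hx
    positivity
  · simpa using (hn 0).continuousAt.tendsto.mono_left nhdsWithin_le_nhds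
  · simpa using (hd 0).continuousAt.tendsto.mono_left nhdsWithin_le_nhds
  · have h : Tendsto (fun x => Real.sinc x / 3) (𝓝[>] 0) (𝓝 (1 / 3)) := by
      have := (Real.continuous_sinc.tendsto 0).div_const 3
      rw [Real.sinc_zero] at this
      exact this.mono_left nhdsWithin_le_nhds
    refine h.congr' ?_
    filter_upwards [self_mem_nhdsWithin] with x hx
    have : x ≠ 0 := (mem_Ioi.1 hx).ne'
    rw [Real.sinc_of_ne_zero this]
    field_simp

/-- Compare the second-order behaviour at `0` of the two sides of Euler's reflection formula
`Γ (1 + s) Γ (1 - s) = π s / sin (π s)`. -/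
theorem integral_log_sq_mul_exp_neg :
    ∫ t in Ioi (0 : ℝ), Real.log t ^ 2 * Real.exp (-t)
      = Real.eulerMascheroniConstant ^ 2 + Real.pi ^ 2 / 6 := by
  set M := ∫ t in Ioi (0 : ℝ), Real.log t ^ 2 * Real.exp (-t)
  have hpi := Real.pi_pos
  have hp : ∀ s : ℝ, HasDerivAt (fun s : ℝ => 1 + s) 1 s := fun s => (hasDerivAt_id s).const_add 1
  have hm : ∀ s : ℝ, HasDerivAt (fun s : ℝ => 1 - s) (-1) s := fun s => (hasDerivAt_id s).const_sub 1
  set F : ℝ → ℝ := fun s => Real.Gamma (1 + s) * Real.Gamma (1 - s)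
  set F' : ℝ → ℝ := fun s => (gammaDeriv ((1 + s : ℝ) : ℂ)).re * Real.Gamma (1 - s)
    - Real.Gamma (1 + s) * (gammaDeriv ((1 - s : ℝ) : ℂ)).re
  have hF : ∀ s ∈ Ioo (-1 : ℝ) 1, HasDerivAt F (F' s) s := by
    intro s hs
    have h1 := HasDerivAt.comp s (h := fun s : ℝ => 1 + s)
      (hasDerivAt_realGamma (x := 1 + s) (by linarith [hs.1])) (hp s)
    have h2 := HasDerivAt.comp s (h := fun s : ℝ => 1 - s)
      (hasDerivAt_realGamma (x := 1 - s) (by linarith [hs.2])) (hm s)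
    refine (h1.mul h2).congr_deriv ?_
    simp only [F', Function.comp]
    ring
  have hg1 : (gammaDeriv 1).re = -Real.eulerMascheroniConstant := by simp [gammaDeriv_one]
  have hF' : HasDerivAt F' (2 * (M - Real.eulerMascheroniConstant ^ 2)) 0 := by
    have e1 : HasDerivAt (fun x : ℝ => (gammaDeriv x).re) M (1 + 0) := by
      rw [add_zero]; exact hasDerivAt_gammaDeriv_re_one
    have e2 : HasDerivAt (fun x : ℝ => (gammaDeriv x).re) M (1 - 0) := by
      rw [sub_zero]; exact hasDerivAt_gammaDeriv_re_one
    have h1 := HasDerivAt.comp 0 (h := fun s : ℝ => 1 + s) e1 (hp 0)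
    have h2 := HasDerivAt.comp 0 (h := fun s : ℝ => 1 - s) e2 (hm 0)
    have h3 := HasDerivAt.comp 0 (h := fun s : ℝ => 1 + s)
      (hasDerivAt_realGamma (x := 1 + 0) (by norm_num)) (hp 0)
    have h4 := HasDerivAt.comp 0 (h := fun s : ℝ => 1 - s)
      (hasDerivAt_realGamma (x := 1 - 0) (by norm_num)) (hm 0)
    refine ((h1.mul h4).sub (h3.mul h2)).congr_deriv ?_
    simp only [Function.comp, add_zero, sub_zero, Complex.ofReal_one, hg1, Real.Gamma_one]
    ring
  have hF'0 : F' 0 = 0 := by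
    simp only [F', add_zero, sub_zero, Real.Gamma_one]
    ring
  have hlim1 : Tendsto (fun s => F' s / s) (𝓝[>] 0)
      (𝓝 (2 * (M - Real.eulerMascheroniConstant ^ 2))) := by
    have h := (hasDerivAt_iff_tendsto_slope.1 hF').mono_left
      (nhdsWithin_mono (0 : ℝ) fun x (hx : 0 < x) => hx.ne')
    refine h.congr fun s => ?_
    rw [slope_def_field, hF'0, sub_zero, sub_zero]
  have hFe : ∀ s ∈ Ioo (0 : ℝ) 1, F s = Real.pi * s / Real.sin (Real.pi * s) := by
    intro s hs
    simp only [F]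
    rw [add_comm, Real.Gamma_add_one hs.1.ne', mul_assoc, Real.Gamma_mul_Gamma_one_sub]
    ring
  have hFd : ∀ s ∈ Ioo (0 : ℝ) 1, F' s = Real.pi * (Real.sin (Real.pi * s)
      - Real.pi * s * Real.cos (Real.pi * s)) / Real.sin (Real.pi * s) ^ 2 := by
    intro s hs
    have hsin : 0 < Real.sin (Real.pi * s) :=
      Real.sin_pos_of_pos_of_lt_pi (mul_pos hpi hs.1) (by nlinarith [hs.2])
    have hlin : HasDerivAt (fun s => Real.pi * s) Real.pi s := by
      simpa using (hasDerivAt_id s).const_mul Real.pi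
    have h1 : HasDerivAt (fun s => Real.pi * s / Real.sin (Real.pi * s)) _ s :=
      hlin.div hlin.sin hsin.ne'
    have h2 := (hF s ⟨by linarith [hs.1], hs.2⟩).congr_of_eventuallyEq
      (f₁ := fun s => Real.pi * s / Real.sin (Real.pi * s)) (by
        filter_upwards [isOpen_Ioo.mem_nhds hs] with z hz
        exact (hFe z hz).symm)
    rw [h2.unique h1]
    ring
  have hlim2 : Tendsto (fun s => F' s / s) (𝓝[>] 0) (𝓝 (Real.pi ^ 2 * (1 / 3) * (1 / 1) ^ 2)) := by
    have hx : Tendsto (fun s : ℝ => Real.pi * s) (𝓝[>] 0) (𝓝[>] 0) := by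
      refine tendsto_nhdsWithin_iff.2 ⟨?_, ?_⟩
      · have : Continuous fun s : ℝ => Real.pi * s := by fun_prop
        simpa using (this.tendsto 0).mono_left (nhdsWithin_le_nhds (s := Ioi 0))
      · filter_upwards [self_mem_nhdsWithin] with s hs
        exact mul_pos hpi hs
    have h1 := (tendsto_sin_sub_mul_cos_div_pow.comp hx).const_mul (Real.pi ^ 2)
    have h2 : Tendsto (fun x => Real.sinc x) (𝓝[>] 0) (𝓝 1) := by
      have := Real.continuous_sinc.tendsto 0
      rw [Real.sinc_zero] at this
      exact this.mono_left nhdsWithin_le_nhds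
    have h3 := ((tendsto_const_nhds (x := (1 : ℝ))).div (h2.comp hx) one_ne_zero).pow 2
    refine (h1.mul h3).congr' ?_
    filter_upwards [Ioo_mem_nhdsGT one_pos] with s hs
    have hsin : 0 < Real.sin (Real.pi * s) :=
      Real.sin_pos_of_pos_of_lt_pi (mul_pos hpi hs.1) (by nlinarith [hs.2])
    have hs0 := hs.1.ne'
    rw [hFd s hs]
    simp only [Function.comp, Pi.div_apply]
    rw [Real.sinc_of_ne_zero (mul_pos hpi hs.1).ne']
    field_simp
  have := tendsto_nhds_unique hlim1 hlim2
  linarith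

/-! ### Approximation of the logistic density by exponential sums -/

theorem integrableOn_log_pow_mul_exp_neg :
    IntegrableOn (fun ε : ℝ => Real.exp (-ε)) (Ioi 0) ∧
    IntegrableOn (fun ε : ℝ => Real.log ε * Real.exp (-ε)) (Ioi 0) ∧
    IntegrableOn (fun ε : ℝ => Real.log ε ^ 2 * Real.exp (-ε)) (Ioi 0) := by
  have hm : Measurable fun ε : ℝ => Real.exp (-ε) := by fun_prop
  have hb : ∀ ε : ℝ, 0 < ε → |Real.exp (-ε)| ≤ 6 * decay ε := fun ε hε => by
    rw [abs_of_pos (Real.exp_pos _)]; exact exp_neg_le_decay hε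
  exact ⟨integrableOn_exp_neg_Ioi 0, integrableOn_log_mul' hm hb, integrableOn_log_sq_mul hm hb⟩

theorem integral_log_sq_mul_exp_neg_mul {c : ℝ} (hc : 0 < c) :
    IntegrableOn (fun ε => Real.log ε ^ 2 * Real.exp (-(c * ε))) (Ioi 0) ∧
    ∫ ε in Ioi (0 : ℝ), Real.log ε ^ 2 * Real.exp (-(c * ε))
      = (Real.eulerMascheroniConstant ^ 2 + Real.pi ^ 2 / 6
        + 2 * Real.eulerMascheroniConstant * Real.log c + Real.log c ^ 2) / c := by
  obtain ⟨i0, i1, i2⟩ := integrableOn_log_pow_mul_exp_neg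
  set g : ℝ → ℝ := fun u => Real.log u ^ 2 * Real.exp (-u)
    + ((-(2 * Real.log c)) * (Real.log u * Real.exp (-u)) + Real.log c ^ 2 * Real.exp (-u)) with hg
  have j1 := i1.const_mul (-(2 * Real.log c))
  have j0 := i0.const_mul (Real.log c ^ 2)
  have j : IntegrableOn (fun u => -(2 * Real.log c) * (Real.log u * Real.exp (-u))
      + Real.log c ^ 2 * Real.exp (-u)) (Ioi 0) := j1.add j0
  have hgi : IntegrableOn g (Ioi 0) := i2.add j
  have e : ∀ ε ∈ Ioi (0 : ℝ), g (c * ε) = Real.log ε ^ 2 * Real.exp (-(c * ε)) := by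
    intro ε hε
    simp only [hg]
    rw [Real.log_mul hc.ne' (mem_Ioi.1 hε).ne']
    ring
  have hi := (integrableOn_Ioi_comp_mul_left_iff g 0 hc).2 (by rwa [mul_zero])
  refine ⟨hi.congr_fun e measurableSet_Ioi, ?_⟩
  rw [← setIntegral_congr_fun measurableSet_Ioi e, integral_comp_mul_left_Ioi g 0 hc, mul_zero, hg,
    integral_add i2 j, integral_add j1 j0, integral_const_mul, integral_const_mul,
    integral_log_sq_mul_exp_neg, integral_log_mul_exp_neg, integral_exp_neg_Ioi_zero, smul_eq_mul]
  ring

/-- Coefficients, multiplied by `22619537 ^ 2`, of the polynomial `a` of degree `9` for which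
`2 - (1 + q) ^ 2 * a q = T (2 q - 1) / T (-3) * (2 + β (1 + q))`, where `T` is the Chebyshev
polynomial of degree `10`, with `T (-3) = 22619537`, and `β` is the number for which the right-hand
side has vanishing derivative at `q = -1`, so that `(1 + q) ^ 2` divides out. -/
def logisticCoeff : Fin 10 → ℝ :=
  ![1023286543061104, -2046500380483968, 3067368353234432, -4059501607960576, 4878160161853440,
    -5123946745987072, 4324317560438784, -2622212691460096, 982564096442368, -167713733345280]

/-- On `[0, 1]` the Chebyshev polynomial is bounded by `1`, while `T (-3)` is large. -/
theorem abs_sub_sum_logisticCoeff_le {q : ℝ} (hq0 : 0 ≤ q) (hq1 : q ≤ 1) :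
    |2 * q / (1 + q) ^ 2 - (∑ i, logisticCoeff i * q ^ ((i : ℕ) + 1)) / 22619537 ^ 2|
      ≤ 7.14e-7 * q := by
  -- `p` is the Chebyshev polynomial of degree `5` at `t`, and `2 * p ^ 2 - 1` that of degree `10`
  set t := 2 * q - 1 with ht
  set p := 16 * t ^ 5 - 20 * t ^ 3 + 5 * t with hp
  have hp1 : p ^ 2 ≤ 1 := by
    have e : 1 - p ^ 2 = 4 * q * (1 - q) * (16 * t ^ 4 - 12 * t ^ 2 + 1) ^ 2 := by
      rw [hp, ht]; ring
    have : 0 ≤ 4 * q * (1 - q) * (16 * t ^ 4 - 12 * t ^ 2 + 1) ^ 2 := by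
      have : 0 ≤ 1 - q := by linarith
      positivity
    linarith
  have hc : |2 * p ^ 2 - 1| ≤ 1 := by
    rw [abs_le]; constructor <;> nlinarith [sq_nonneg p]
  have key : 2 * q / (1 + q) ^ 2 - (∑ i, logisticCoeff i * q ^ ((i : ℕ) + 1)) / 22619537 ^ 2
      = (2 * p ^ 2 - 1) * ((45239074 + 319888560 * (1 + q)) / (22619537 ^ 2 * (1 + q) ^ 2) * q) := by
    have h1 : (1 + q) ≠ 0 := by positivity
    simp only [logisticCoeff, Fin.sum_univ_succ, Fin.sum_univ_zero]
    simp
    rw [hp, ht]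
    field_simp
    ring
  rw [key, abs_mul]
  have h2 : 0 ≤ (45239074 + 319888560 * (1 + q)) / (22619537 ^ 2 * (1 + q) ^ 2) * q := by positivity
  rw [abs_of_nonneg h2]
  refine (mul_le_of_le_one_left h2 hc).trans (mul_le_mul_of_nonneg_right ?_ hq0)
  rw [div_le_iff₀ (by positivity)]
  nlinarith

theorem abs_integral_log_sq_mul_logisticDensity_sub_le :
    |(∫ ε in Ioi (0 : ℝ), Real.log ε ^ 2 * logisticDensity ε)
      - (∑ i, logisticCoeff i * ((Real.eulerMascheroniConstant ^ 2 + Real.pi ^ 2 / 6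
        + 2 * Real.eulerMascheroniConstant * Real.log ((i : ℕ) + 1) + Real.log ((i : ℕ) + 1) ^ 2)
          / ((i : ℕ) + 1))) / 22619537 ^ 2|
      ≤ 7.14e-7 * (Real.eulerMascheroniConstant ^ 2 + Real.pi ^ 2 / 6) := by
  have hc : ∀ i : Fin 10, (0 : ℝ) < (i : ℕ) + 1 := fun i => by positivity
  have hi : IntegrableOn (fun ε : ℝ => Real.log ε ^ 2 * logisticDensity ε) (Ioi 0) :=
    integrableOn_log_sq_mul measurable_logisticDensity fun ε hε => abs_logisticDensity_le hε
  have hs : ∀ i : Fin 10, IntegrableOn (fun ε : ℝ => logisticCoeff i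
      * (Real.log ε ^ 2 * Real.exp (-(((i : ℕ) + 1) * ε)))) (Ioi 0) := fun i =>
    (integral_log_sq_mul_exp_neg_mul (hc i)).1.const_mul _
  have hsum : IntegrableOn (fun ε : ℝ => (∑ i : Fin 10, logisticCoeff i
      * (Real.log ε ^ 2 * Real.exp (-(((i : ℕ) + 1) * ε)))) / 22619537 ^ 2) (Ioi 0) :=
    (integrable_finsetSum _ fun i _ => hs i).div_const _
  have e : (∑ i, logisticCoeff i * ((Real.eulerMascheroniConstant ^ 2 + Real.pi ^ 2 / 6
        + 2 * Real.eulerMascheroniConstant * Real.log ((i : ℕ) + 1) + Real.log ((i : ℕ) + 1) ^ 2)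
          / ((i : ℕ) + 1))) / 22619537 ^ 2
      = ∫ ε in Ioi (0 : ℝ), (∑ i : Fin 10, logisticCoeff i
        * (Real.log ε ^ 2 * Real.exp (-(((i : ℕ) + 1) * ε)))) / 22619537 ^ 2 := by
    rw [integral_div, integral_finsetSum _ fun i _ => hs i]
    congr 1
    refine Finset.sum_congr rfl fun i _ => ?_
    rw [integral_const_mul, (integral_log_sq_mul_exp_neg_mul (hc i)).2]
  rw [e, ← integral_sub hi hsum, ← integral_log_sq_mul_exp_neg, ← integral_const_mul,
    ← Real.norm_eq_abs]
  refine norm_integral_le_of_norm_le (integrableOn_log_pow_mul_exp_neg.2.2.const_mul _) ?_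
  filter_upwards [ae_restrict_mem measurableSet_Ioi] with ε hε
  have hq1 : Real.exp (-ε) ≤ 1 := Real.exp_le_one_iff.2 (by linarith [mem_Ioi.1 hε])
  have h := abs_sub_sum_logisticCoeff_le (Real.exp_pos (-ε)).le hq1
  have e2 : Real.log ε ^ 2 * logisticDensity ε - (∑ i : Fin 10, logisticCoeff i
        * (Real.log ε ^ 2 * Real.exp (-(((i : ℕ) + 1) * ε)))) / 22619537 ^ 2
      = Real.log ε ^ 2 * (2 * Real.exp (-ε) / (1 + Real.exp (-ε)) ^ 2
        - (∑ i, logisticCoeff i * Real.exp (-ε) ^ ((i : ℕ) + 1)) / 22619537 ^ 2) := by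
    rw [logisticDensity_eq, mul_sub, mul_div_assoc' _ _ ((22619537 : ℝ) ^ 2), Finset.mul_sum]
    congr 2
    refine Finset.sum_congr rfl fun i _ => ?_
    rw [← Real.exp_nat_mul]
    push_cast
    rw [mul_neg]
    ring
  rw [e2, Real.norm_eq_abs, abs_mul, abs_of_nonneg (sq_nonneg _)]
  calc _ ≤ Real.log ε ^ 2 * (7.14e-7 * Real.exp (-ε)) := by gcongr
    _ = _ := by ring

/-! ### Bounds for Euler's constant -/

theorem nonneg_of_hasDerivAt_nonneg {f f' : ℝ → ℝ} (hf : ∀ x, 0 ≤ x → HasDerivAt f (f' x) x)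
    (hf' : ∀ x, 0 ≤ x → 0 ≤ f' x) (h0 : f 0 = 0) {x : ℝ} (hx : 0 ≤ x) : 0 ≤ f x := by
  have h : MonotoneOn f (Ici 0) := by
    refine monotoneOn_of_deriv_nonneg (convex_Ici 0)
      (fun y hy => (hf y hy).continuousAt.continuousWithinAt) (fun y hy => ?_) fun y hy => ?_
    · rw [interior_Ici] at hy
      exact (hf y hy.le).differentiableAt.differentiableWithinAt
    · rw [interior_Ici] at hy
      rw [(hf y hy.le).deriv]
      exact hf' y hy.le
  rw [← h0]
  exact h (mem_Ici.2 le_rfl) hx hx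

/-- The trapezoidal rule overestimates `∫ 1 / t`. -/
theorem log_one_add_le {x : ℝ} (hx : 0 ≤ x) : Real.log (1 + x) ≤ (x + x / (1 + x)) / 2 := by
  have h := nonneg_of_hasDerivAt_nonneg (f := fun x => (x + x / (1 + x)) / 2 - Real.log (1 + x))
    (f' := fun x => (1 - 1 / (1 + x)) ^ 2 / 2) (fun x hx => ?_) (fun x _ => by positivity)
    (by simp) hx
  · linarith
  · have hx1 : 1 + x ≠ 0 := by positivity
    have h1 : HasDerivAt (fun x : ℝ => 1 + x) 1 x := (hasDerivAt_id x).const_add 1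
    have h2 := (((hasDerivAt_id x).add ((hasDerivAt_id x).div h1 hx1)).div_const 2).sub
      (h1.log hx1)
    refine h2.congr_deriv ?_
    simp only [id]
    field_simp
    ring

/-- The Euler–Maclaurin correction of the trapezoidal rule underestimates `∫ 1 / t`. -/
theorem le_log_one_add {x : ℝ} (hx : 0 ≤ x) :
    (x + x / (1 + x)) / 2 - (x ^ 2 - (x / (1 + x)) ^ 2) / 12 ≤ Real.log (1 + x) := by
  have h := nonneg_of_hasDerivAt_nonneg
    (f := fun x => Real.log (1 + x) - (x + x / (1 + x)) / 2 + (x ^ 2 - (x / (1 + x)) ^ 2) / 12)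
    (f' := fun x => x ^ 4 / (6 * (1 + x) ^ 3)) (fun x hx => ?_) (fun x _ => by positivity)
    (by simp) hx
  · linarith
  · have hx1 : 1 + x ≠ 0 := by positivity
    have h1 : HasDerivAt (fun x : ℝ => 1 + x) 1 x := (hasDerivAt_id x).const_add 1
    have hd : HasDerivAt (fun x : ℝ => x / (1 + x)) ((1 * (1 + x) - x * 1) / (1 + x) ^ 2) x :=
      (hasDerivAt_id x).div h1 hx1
    have h2 := ((h1.log hx1).sub (((hasDerivAt_id x).add hd).div_const 2)).add
      (((hasDerivAt_pow 2 x).sub (hd.pow 2)).div_const 12)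
    refine h2.congr_deriv ?_
    simp only [Nat.cast_ofNat, Nat.reduceSub, pow_one]
    field_simp
    ring

theorem eulerMascheroniSeq'_succ_sub {n : ℕ} (hn : 1 ≤ n) :
    Real.eulerMascheroniSeq' (n + 1) - Real.eulerMascheroniSeq' n
      = 1 / ((n : ℝ) + 1) - Real.log (1 + 1 / n) := by
  have hn0 : (0 : ℝ) < n := by exact_mod_cast hn
  rw [Real.eulerMascheroniSeq', Real.eulerMascheroniSeq', if_neg (by omega), if_neg (by omega),
    harmonic_succ, show 1 + 1 / (n : ℝ) = (n + 1) / n by field_simp,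
    Real.log_div (by positivity) hn0.ne']
  push_cast
  ring

theorem tendsto_one_div_two_mul : Tendsto (fun n : ℕ => 1 / (2 * (n : ℝ))) atTop (𝓝 0) := by
  have h := (tendsto_one_div_atTop_nhds_zero_nat (𝕜 := ℝ)).const_mul (1 / 2)
  rw [mul_zero] at h
  exact h.congr fun n => by ring

theorem sub_le_eulerMascheroniConstant {N : ℕ} (hN : 1 ≤ N) :
    Real.eulerMascheroniSeq' N - 1 / (2 * N) ≤ Real.eulerMascheroniConstant := by
  have hmono : ∀ n, N ≤ n → Real.eulerMascheroniSeq' N - 1 / (2 * N)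
      ≤ Real.eulerMascheroniSeq' n - 1 / (2 * n) := by
    intro n hn
    induction n, hn using Nat.le_induction with
    | base => exact le_rfl
    | succ n hn ih =>
      have hn1 : 1 ≤ n := hN.trans hn
      have hn0 : (0 : ℝ) < n := by exact_mod_cast hn1
      have h1 := eulerMascheroniSeq'_succ_sub hn1
      have h2 := log_one_add_le (x := 1 / (n : ℝ)) (by positivity)
      have e1 : 1 / (n : ℝ) / (1 + 1 / n) = 1 / (n + 1) := by field_simp
      have e2 : 1 / (2 * (n : ℝ)) = 1 / n / 2 := by field_simp
      have e3 : 1 / (2 * ((n + 1 : ℕ) : ℝ)) = 1 / (n + 1) / 2 := by push_cast; field_simp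
      rw [e1] at h2
      rw [e2] at ih
      rw [e3]
      linarith
  have hlim : Tendsto (fun n : ℕ => Real.eulerMascheroniSeq' n - 1 / (2 * n)) atTop
      (𝓝 Real.eulerMascheroniConstant) := by
    simpa using Real.tendsto_eulerMascheroniSeq'.sub tendsto_one_div_two_mul
  exact ge_of_tendsto hlim (eventually_atTop.2 ⟨N, hmono⟩)

theorem eulerMascheroniConstant_le_add {N : ℕ} (hN : 1 ≤ N) :
    Real.eulerMascheroniConstant
      ≤ Real.eulerMascheroniSeq' N - 1 / (2 * N) + (1 / (N : ℝ)) ^ 2 / 12 := by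
  have hanti : ∀ n, N ≤ n → Real.eulerMascheroniSeq' n - 1 / (2 * n) + (1 / (n : ℝ)) ^ 2 / 12
      ≤ Real.eulerMascheroniSeq' N - 1 / (2 * N) + (1 / (N : ℝ)) ^ 2 / 12 := by
    intro n hn
    induction n, hn using Nat.le_induction with
    | base => exact le_rfl
    | succ n hn ih =>
      have hn1 : 1 ≤ n := hN.trans hn
      have hn0 : (0 : ℝ) < n := by exact_mod_cast hn1
      have h1 := eulerMascheroniSeq'_succ_sub hn1
      have h2 := le_log_one_add (x := 1 / (n : ℝ)) (by positivity)
      have e1 : 1 / (n : ℝ) / (1 + 1 / n) = 1 / (n + 1) := by field_simp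
      have e2 : 1 / (2 * (n : ℝ)) = 1 / n / 2 := by field_simp
      have e3 : 1 / (2 * ((n + 1 : ℕ) : ℝ)) = 1 / (n + 1) / 2 := by push_cast; field_simp
      have e4 : 1 / ((n + 1 : ℕ) : ℝ) = 1 / (n + 1) := by push_cast; rfl
      rw [e1] at h2
      rw [e2] at ih
      rw [e3, e4]
      linarith
  have hlim : Tendsto (fun n : ℕ => Real.eulerMascheroniSeq' n - 1 / (2 * n)
      + (1 / (n : ℝ)) ^ 2 / 12) atTop (𝓝 Real.eulerMascheroniConstant) := by
    simpa using (Real.tendsto_eulerMascheroniSeq'.sub tendsto_one_div_two_mul).add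
      (((tendsto_one_div_atTop_nhds_zero_nat (𝕜 := ℝ)).pow 2).div_const 12)
  exact le_of_tendsto hlim (eventually_atTop.2 ⟨N, hanti⟩)

/-- `sub_le_eulerMascheroniConstant` and `eulerMascheroniConstant_le_add` at powers of two, for which only
`log 2` is needed. -/
theorem eulerMascheroniConstant_bounds :
    0.5771 ≤ Real.eulerMascheroniConstant ∧ Real.eulerMascheroniConstant ≤ 0.577219 := by
  have h1 := Real.log_two_gt_d9
  have h2 := Real.log_two_lt_d9
  constructor
  · refine le_trans ?_ (sub_le_eulerMascheroniConstant (N := 32) (by norm_num))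
    have e : Real.log (32 : ℕ) = 5 * Real.log 2 := by
      rw [show ((32 : ℕ) : ℝ) = 2 ^ 5 by norm_num, Real.log_pow]; norm_num
    rw [Real.eulerMascheroniSeq', if_neg (by norm_num), e]
    norm_num [harmonic, Finset.sum_range_succ]
    linarith
  · refine (eulerMascheroniConstant_le_add (N := 8) (by norm_num)).trans ?_
    have e : Real.log (8 : ℕ) = 3 * Real.log 2 := by
      rw [show ((8 : ℕ) : ℝ) = 2 ^ 3 by norm_num, Real.log_pow]; norm_num
    rw [Real.eulerMascheroniSeq', if_neg (by norm_num), e]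
    norm_num [harmonic, Finset.sum_range_succ]
    linarith

/-! ### The numerical value of the coefficient at temperature zero -/

theorem exp_neg_eulerMascheroniConstant_bounds :
    0.56145 ≤ Real.exp (-Real.eulerMascheroniConstant) ∧
      Real.exp (-Real.eulerMascheroniConstant) ≤ 0.56154 := by
  obtain ⟨h1, h2⟩ := eulerMascheroniConstant_bounds
  have h3 := Real.log_two_gt_d9
  have h4 := Real.log_two_lt_d9
  have e : Real.exp (-Real.eulerMascheroniConstant)
      = Real.exp (Real.log 2 - Real.eulerMascheroniConstant) / 2 := by
    rw [Real.exp_sub, Real.exp_log two_pos, Real.exp_neg]; ring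
  rw [e]
  constructor
  · have h := Real.exp_le_exp.2 
      (by linarith : (14491 / 125000 : ℝ) ≤ Real.log 2 - Real.eulerMascheroniConstant)
    have h' := Real.sum_le_exp_of_nonneg (x := 14491 / 125000) (by norm_num) 5
    norm_num [Finset.sum_range_succ, Nat.factorial] at h'
    linarith
  · have h := Real.exp_le_exp.2 
      (by linarith : Real.log 2 - Real.eulerMascheroniConstant ≤ 2321 / 20000)
    have h' := Real.exp_bound' (x := 2321 / 20000) (by norm_num) (by norm_num) (n := 4) (by norm_num)
    norm_num [Finset.sum_range_succ, Nat.factorial] at h'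
    linarith

theorem abs_log_one_add_sub_le {x : ℝ} (hx : 0 ≤ x) (hx1 : x ≤ 1 / 2) :
    |Real.log (1 + x) - (x - x ^ 2 / 2)| ≤ 2 * x ^ 3 := by
  have h := Real.abs_log_sub_add_sum_range_le (x := -x) (by rw [abs_neg, abs_of_nonneg hx]; linarith) 2
  rw [abs_neg, abs_of_nonneg hx, sub_neg_eq_add] at h
  have e : (∑ i ∈ Finset.range 2, (-x) ^ (i + 1) / ((i : ℝ) + 1)) + Real.log (1 + x)
      = Real.log (1 + x) - (x - x ^ 2 / 2) := by
    simp [Finset.sum_range_succ]; ring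
  rw [e] at h
  refine h.trans ?_
  rw [div_le_iff₀ (by linarith)]
  have : 0 ≤ x ^ 3 * (1 / 2 - x) := mul_nonneg (by positivity) (by linarith)
  change x ^ 3 ≤ 2 * x ^ 3 * (1 - x)
  linarith

/-- `7⁴ = 2401` is close to `2400 = 2⁵ 3 5²`. -/
theorem log_seven_bounds : 1.945910148 < Real.log 7 ∧ Real.log 7 < 1.945910150 := by
  have h := abs_le.1 (abs_log_one_add_sub_le (x := 1 / 2400) (by norm_num) (by norm_num))
  have e : 4 * Real.log 7 = 5 * Real.log 2 + Real.log 3 + 2 * Real.log 5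
      + Real.log (1 + 1 / 2400) := by
    have : (7 : ℝ) ^ 4 = 2 ^ 5 * 3 * 5 ^ 2 * (1 + 1 / 2400) := by norm_num
    have h2 := congrArg Real.log this
    rw [Real.log_mul (by norm_num) (by norm_num), Real.log_mul (by norm_num) (by norm_num),
      Real.log_mul (by norm_num) (by norm_num), Real.log_pow, Real.log_pow, Real.log_pow] at h2
    push_cast at h2
    linarith
  have a1 := Real.log_two_gt_d9
  have a2 := Real.log_two_lt_d9
  have a3 := Real.log_three_gt_d9
  have a4 := Real.log_three_lt_d9
  have a5 := Real.log_five_gt_d9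
  have a6 := Real.log_five_lt_d9
  norm_num at *
  constructor <;> linarith

/-- `π` is compared with `392 / 125 = 2³ 7² / 5³`. -/
theorem log_pi_bounds : 1.1447296 < Real.log Real.pi ∧ Real.log Real.pi < 1.1447301 := by
  obtain ⟨b1, b2⟩ := log_seven_bounds
  have a1 := Real.log_two_gt_d9
  have a2 := Real.log_two_lt_d9
  have a5 := Real.log_five_gt_d9
  have a6 := Real.log_five_lt_d9
  have e : ∀ x : ℝ, 0 ≤ x → Real.log (392 / 125 * (1 + x))
      = 3 * Real.log 2 + 2 * Real.log 7 - 3 * Real.log 5 + Real.log (1 + x) := by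
    intro x hx
    rw [show (392 : ℝ) / 125 = 2 ^ 3 * 7 ^ 2 / 5 ^ 3 by norm_num,
      Real.log_mul (by norm_num) (by positivity), Real.log_div (by norm_num) (by norm_num),
      Real.log_mul (by norm_num) (by norm_num), Real.log_pow, Real.log_pow, Real.log_pow]
    push_cast
    ring
  constructor
  · have h := abs_le.1 (abs_log_one_add_sub_le (x := 699 / 392000) (by norm_num) (by norm_num))
    have h1 := Real.log_lt_log (by norm_num) Real.pi_gt_d6
    rw [show (3.141592 : ℝ) = 392 / 125 * (1 + 699 / 392000) by norm_num, e _ (by norm_num)] at h1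
    norm_num at *
    linarith
  · have h := abs_le.1 (abs_log_one_add_sub_le (x := 699125 / 392000000) (by norm_num)
      (by norm_num))
    have h1 := Real.log_lt_log Real.pi_pos Real.pi_lt_d6
    rw [show (3.141593 : ℝ) = 392 / 125 * (1 + 699125 / 392000000) by norm_num,
      e _ (by norm_num)] at h1
    norm_num at *
    linarith

theorem c1_zero_eq_sub : c1 0 = Real.exp (-Real.eulerMascheroniConstant) / 4
    * (Real.pi ^ 2 / 6 + (Real.log (Real.pi / 2) - Real.eulerMascheroniConstant) ^ 2
      - ∫ ε in Ioi (0 : ℝ), Real.log ε ^ 2 * logisticDensity ε) := by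
  have hg := gapConst_pos
  have hpi := Real.pi_pos
  obtain ⟨C, hC⟩ := exists_abs_sqrtCore_le hg
  have i1 := integrableOn_log_mul' (measurable_sqrtCore gapConst) hC
  have i2 := integrableOn_log_mul' measurable_tanhCore fun ε hε => abs_tanhCore_le hε
  have i0 := (integrableOn_bcsIntegrand le_rfl zero_le_one
    (Or.inl hg : 0 < gapConst ∨ (0 : ℝ) < 0)).const_mul (Real.log 16)
  have h0 : ∫ ε in Ioi (0 : ℝ), bcsIntegrand gapConst 0 ε = 0 := by
    have := bcsIntegral_zero_right hg
    rwa [sub_self] at this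
  have hJ : bcsLogIntegral gapConst 0
      = Real.log (gapConst / 2) ^ 2 / 2 + Real.pi ^ 2 / 12
        - (∫ ε in Ioi (0 : ℝ), Real.log ε ^ 2 * logisticDensity ε) / 2 := by
    have h := integral_sub i0 (i1.sub i2)
    rw [integral_const_mul, h0, integral_sub' i1 i2, integral_log_mul_sqrtCore hg,
      integral_log_mul_tanhCore] at h
    have e : bcsLogIntegral gapConst 0 = _ := (setIntegral_congr_fun measurableSet_Ioi
      fun ε hε => ?_).trans h
    · rw [e]; ring
    · simp only [Pi.sub_apply]
      rw [Real.log_div (by norm_num) (mem_Ioi.1 hε).ne', sqrtCore_eq]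
      ring
  have hlog : Real.log (gapConst / 2)
      = Real.log (Real.pi / 2) - Real.eulerMascheroniConstant := by
    rw [Real.log_div hg.ne' two_ne_zero, Real.log_div hpi.ne' two_ne_zero, log_gapConst]
    ring
  rw [c1, integral_c1Integrand, zero_mul, sub_zero, fBCS_zero, hJ, hlog, gapConst]
  field_simp
  ring

theorem sum_logisticCoeff_mul (f : ℝ → ℝ) :
    (∑ i, logisticCoeff i * (f ((i : ℕ) + 1) / ((i : ℕ) + 1))) / 22619537 ^ 2
      = ((1023286543061104 / 1) * f 1 + (-2046500380483968 / 2) * f 2 + (3067368353234432 / 3) * f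
        3 + (-4059501607960576 / 4) * f 4 + (4878160161853440 / 5) * f 5 + (-5123946745987072 / 6) *
        f 6 + (4324317560438784 / 7) * f 7 + (-2622212691460096 / 8) * f 8 + (982564096442368 / 9) *
        f 9 + (-167713733345280 / 10) * f 10) / 22619537 ^ 2 := by
  simp only [logisticCoeff, Fin.sum_univ_succ, Fin.sum_univ_zero]
  simp
  norm_num
  ring

theorem log_bounds_of_le_ten :
    (0.6931471803 ≤ Real.log 2 ∧ Real.log 2 ≤ 0.6931471808) ∧
    (1.0986122885 ≤ Real.log 3 ∧ Real.log 3 ≤ 1.0986122888) ∧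
    (1.3862943606 ≤ Real.log 4 ∧ Real.log 4 ≤ 1.3862943616) ∧
    (1.6094379123 ≤ Real.log 5 ∧ Real.log 5 ≤ 1.6094379126) ∧
    (1.7917594688 ≤ Real.log 6 ∧ Real.log 6 ≤ 1.7917594696) ∧
    (1.945910148 ≤ Real.log 7 ∧ Real.log 7 ≤ 1.945910150) ∧
    (2.0794415409 ≤ Real.log 8 ∧ Real.log 8 ≤ 2.0794415424) ∧
    (2.1972245770 ≤ Real.log 9 ∧ Real.log 9 ≤ 2.1972245776) ∧
    (2.3025850926 ≤ Real.log 10 ∧ Real.log 10 ≤ 2.3025850934) := by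
  have a2 := Real.log_two_gt_d9
  have b2 := Real.log_two_lt_d9
  have a3 := Real.log_three_gt_d9
  have b3 := Real.log_three_lt_d9
  have a5 := Real.log_five_gt_d9
  have b5 := Real.log_five_lt_d9
  obtain ⟨a7, b7⟩ := log_seven_bounds
  have h4 : Real.log 4 = 2 * Real.log 2 := by
    rw [show (4 : ℝ) = 2 ^ 2 by norm_num, Real.log_pow]; norm_num
  have h6 : Real.log 6 = Real.log 2 + Real.log 3 := by
    rw [← Real.log_mul (by norm_num) (by norm_num)]; norm_num
  have h8 : Real.log 8 = 3 * Real.log 2 := by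
    rw [show (8 : ℝ) = 2 ^ 3 by norm_num, Real.log_pow]; norm_num
  have h9 : Real.log 9 = 2 * Real.log 3 := by
    rw [show (9 : ℝ) = 3 ^ 2 by norm_num, Real.log_pow]; norm_num
  rw [h4, h6, h8, h9, Real.log_ten_eq]
  refine ⟨⟨?_, ?_⟩, ⟨?_, ?_⟩, ⟨?_, ?_⟩, ⟨?_, ?_⟩, ⟨?_, ?_⟩, ⟨?_, ?_⟩, ⟨?_, ?_⟩, ⟨?_, ?_⟩, ?_, ?_⟩ <;>
    linarith

/-- The sum `∑ aₙ (log n) ^ k / n` over the coefficients `aₙ` of the approximating polynomial, the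
power `qⁿ` corresponding to the index `n - 1` of `logisticCoeff`. -/
def logisticMoment (k : ℕ) : ℝ :=
  (∑ i, logisticCoeff i * (Real.log ((i : ℕ) + 1) ^ k / ((i : ℕ) + 1))) / 22619537 ^ 2

theorem abs_one_sub_logisticMoment_zero_le : |1 - logisticMoment 0| ≤ 1e-8 := by
  rw [logisticMoment, sum_logisticCoeff_mul fun c => Real.log c ^ 0]
  norm_num [abs_le]

theorem logisticMoment_one_bounds :
    -0.4515829 ≤ logisticMoment 1 ∧ logisticMoment 1 ≤ -0.4515825 := by
  rw [logisticMoment, sum_logisticCoeff_mul fun c => Real.log c ^ 1]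
  obtain ⟨⟨u2, v2⟩, ⟨u3, v3⟩, ⟨u4, v4⟩, ⟨u5, v5⟩, ⟨u6, v6⟩, ⟨u7, v7⟩, ⟨u8, v8⟩, ⟨u9, v9⟩, ⟨u10, v10⟩⟩ :=
    log_bounds_of_le_ten
  simp only [pow_one, Real.log_one]
  rw [le_div_iff₀ (by norm_num), div_le_iff₀ (by norm_num)]
  constructor <;> linarith

theorem logisticMoment_two_bounds :
    -0.1220589 ≤ logisticMoment 2 ∧ logisticMoment 2 ≤ -0.1220576 := by
  rw [logisticMoment, sum_logisticCoeff_mul fun c => Real.log c ^ 2]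
  obtain ⟨⟨u2, v2⟩, ⟨u3, v3⟩, ⟨u4, v4⟩, ⟨u5, v5⟩, ⟨u6, v6⟩, ⟨u7, v7⟩, ⟨u8, v8⟩, ⟨u9, v9⟩, ⟨u10, v10⟩⟩ :=
    log_bounds_of_le_ten
  have hsq : ∀ {a b x : ℝ}, 0 ≤ a → a ≤ x → x ≤ b → a ^ 2 ≤ x ^ 2 ∧ x ^ 2 ≤ b ^ 2 :=
    fun ha hx hb => ⟨pow_le_pow_left₀ ha hx 2, pow_le_pow_left₀ (ha.trans hx) hb 2⟩
  obtain ⟨s2, t2⟩ := hsq (by norm_num) u2 v2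
  obtain ⟨s3, t3⟩ := hsq (by norm_num) u3 v3
  obtain ⟨s4, t4⟩ := hsq (by norm_num) u4 v4
  obtain ⟨s5, t5⟩ := hsq (by norm_num) u5 v5
  obtain ⟨s6, t6⟩ := hsq (by norm_num) u6 v6
  obtain ⟨s7, t7⟩ := hsq (by norm_num) u7 v7
  obtain ⟨s8, t8⟩ := hsq (by norm_num) u8 v8
  obtain ⟨s9, t9⟩ := hsq (by norm_num) u9 v9
  obtain ⟨s10, t10⟩ := hsq (by norm_num) u10 v10
  simp only [Real.log_one]
  rw [le_div_iff₀ (by norm_num), div_le_iff₀ (by norm_num)]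
  clear u2 u3 u4 u5 u6 u7 u8 u9 u10 v2 v3 v4 v5 v6 v7 v8 v9 v10 hsq
  generalize Real.log 2 ^ 2 = x2 at *
  generalize Real.log 3 ^ 2 = x3 at *
  generalize Real.log 4 ^ 2 = x4 at *
  generalize Real.log 5 ^ 2 = x5 at *
  generalize Real.log 6 ^ 2 = x6 at *
  generalize Real.log 7 ^ 2 = x7 at *
  generalize Real.log 8 ^ 2 = x8 at *
  generalize Real.log 9 ^ 2 = x9 at *
  generalize Real.log 10 ^ 2 = x10 at *
  constructor <;> linarith

theorem abs_c1_zero_sub_le : |c1 0 - 0.04576| ≤ 0.000005 := by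
  have hm := abs_integral_log_sq_mul_logisticDensity_sub_le
  rw [c1_zero_eq_sub, Real.log_div Real.pi_pos.ne' two_ne_zero]
  set m := ∫ ε in Ioi (0 : ℝ), Real.log ε ^ 2 * logisticDensity ε
  obtain ⟨g1, g2⟩ := eulerMascheroniConstant_bounds
  obtain ⟨x1, x2⟩ := exp_neg_eulerMascheroniConstant_bounds
  obtain ⟨p1, p2⟩ := log_pi_bounds
  have hpi : Real.pi ^ 2 ≤ 9.87 := by nlinarith [Real.pi_lt_d6, Real.pi_pos]
  obtain ⟨a2, b2⟩ := log_bounds_of_le_ten.1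
  have k0 := abs_one_sub_logisticMoment_zero_le
  obtain ⟨k1, k1'⟩ := logisticMoment_one_bounds
  obtain ⟨k2, k2'⟩ := logisticMoment_two_bounds
  set γ := Real.eulerMascheroniConstant
  set κ := Real.log Real.pi - Real.log 2
  have k3 : |logisticMoment 1 + κ| ≤ 1e-6 := by
    rw [abs_le]
    constructor <;> linarith
  have hκ1 : 0.4515824 ≤ κ := by linarith
  have hκ2 : κ ≤ 0.451583 := by linarith
  have k4 : 0.4515824 ^ 2 ≤ κ ^ 2 := pow_le_pow_left₀ (by norm_num) hκ1 2
  have k5 : κ ^ 2 ≤ 0.451583 ^ 2 := pow_le_pow_left₀ (by linarith) hκ2 2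
  set P := γ ^ 2 + Real.pi ^ 2 / 6 with hP
  have hP1 : P ≤ 2 := by nlinarith
  have hP0 : 0 ≤ P := by positivity
  have hm' : |m - (logisticMoment 0 * P + 2 * γ * logisticMoment 1 + logisticMoment 2)|
      ≤ 7.14e-7 * P := by
    refine le_of_eq_of_le (congrArg abs (congrArg (m - ·) ?_)) hm
    simp only [logisticMoment, pow_zero, pow_one]
    rw [div_mul_eq_mul_div, mul_div_assoc', ← add_div, ← add_div, Finset.sum_mul, Finset.mul_sum,
      ← Finset.sum_add_distrib, ← Finset.sum_add_distrib]
    refine congrArg (· / _) (Finset.sum_congr rfl fun i _ => ?_)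
    ring
  have d0 : |(1 - logisticMoment 0) * P| ≤ 1e-8 * 2 := by
    rw [abs_mul, abs_of_nonneg hP0]
    exact mul_le_mul k0 hP1 hP0 (by norm_num)
  have d1 : |2 * γ * (logisticMoment 1 + κ)| ≤ 1.2 * 1e-6 := by
    rw [abs_mul, abs_of_nonneg (by linarith)]
    exact mul_le_mul (by linarith) k3 (abs_nonneg _) (by norm_num)
  -- in this form Euler's constant enters only through differences that nearly vanish
  have e : Real.pi ^ 2 / 6 + (κ - γ) ^ 2 - m
      = (1 - logisticMoment 0) * P - 2 * γ * (logisticMoment 1 + κ) + κ ^ 2 - logisticMoment 2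
        - (m - (logisticMoment 0 * P + 2 * γ * logisticMoment 1 + logisticMoment 2)) := by
    rw [hP]; ring
  rw [abs_le] at hm' d0 d1
  obtain ⟨q1, q2⟩ : 0.325980 ≤ Real.pi ^ 2 / 6 + (κ - γ) ^ 2 - m ∧
      Real.pi ^ 2 / 6 + (κ - γ) ^ 2 - m ≤ 0.325991 := by
    rw [e]
    constructor <;> linarith [hm'.1, hm'.2, d0.1, d0.2, d1.1, d1.2]
  have r1 := mul_le_mul x1 q1 (by norm_num) (Real.exp_pos _).le
  have r2 := mul_le_mul x2 q2 (by linarith) (by norm_num)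
  rw [abs_le]
  constructor <;> linarith

end Hubbard

end

theorem theorem2p4 :
    -- the objects involved are well defined
    (∀ U : ℝ, 0 < U → ∃! T : ℝ, 0 < T ∧ Hubbard.NeelEquation U 0 T) ∧
    (∀ U : ℝ, 0 < U → ∀ T : ℝ, 0 ≤ T → T < Hubbard.neelTemperature U 0 →
      ∃! Δ : ℝ, 0 < Δ ∧ Hubbard.MeanFieldEquation U 0 T Δ) ∧
    (∀ y ∈ Icc (0 : ℝ) 1, ∃! x : ℝ, Hubbard.IsBCSSolution x y) ∧
    DifferentiableOn ℝ Hubbard.fBCS (Ico 0 1) ∧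
    (∀ y ∈ Ico (0 : ℝ) 1, IntegrableOn (Hubbard.c1Integrand (Hubbard.fBCS y) y) (Ioi 0)) ∧
    -- the expansion, uniformly for `T / T_N` in compact subsets of `[0, 1)`
    (∀ K : Set ℝ, IsCompact K → K ⊆ Ico 0 1 →
      ∃ C : ℝ, ∃ U₀ : ℝ, 0 < U₀ ∧ ∀ U : ℝ, 0 < U → U < U₀ → ∀ T : ℝ, 0 ≤ T →
        T / Hubbard.neelTemperature U 0 ∈ K →
        |Hubbard.gapRatio U 0 T -
          (Hubbard.fBCS (T / Hubbard.neelTemperature U 0) +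
            Hubbard.c1 (T / Hubbard.neelTemperature U 0) * Real.sqrt U)| ≤ C * U) ∧
    -- the case `T = 0`
    ((fun U : ℝ => Hubbard.gapRatio U 0 0 - (Hubbard.gapConst + Hubbard.c1 0 * Real.sqrt U))
      =O[𝓝[>] 0] fun U : ℝ => U) ∧
    Hubbard.c1 0 = Hubbard.gapConst *
      ∫ ε in Ioi (0 : ℝ), Real.log (16 / ε) / (2 * Real.pi) *
        (1 / Real.sqrt (Hubbard.gapConst ^ 2 + ε ^ 2) - Real.tanh (ε / 2) / ε) ∧
    |Hubbard.c1 0 - 0.04576| ≤ 0.000005 := by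
  refine ⟨fun U hU => Hubbard.existsUnique_neel hU,
    fun U hU T hT hTN => Hubbard.existsUnique_orderParameter hU hT hTN,
    fun y hy => Hubbard.existsUnique_isBCSSolution hy, Hubbard.differentiableOn_fBCS,
    fun y hy => Hubbard.integrableOn_c1Integrand hy, fun K hK hK1 => ?_,
    Hubbard.gapRatio_zero_isBigO, Hubbard.c1_zero_eq, Hubbard.abs_c1_zero_sub_le⟩
  obtain ⟨C, U₀, hU₀, h⟩ := Hubbard.exists_abs_gapRatio_sub_le hK hK1
  exact ⟨C, U₀, hU₀, h⟩
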